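/- **Setting.** An instance of the joint (robust) beamforming and antenna selection problem has $N\ge1$ antennas, $M\ge1$ users, a limit $L\le N$, channels $h_m\in\mathbb C^N$, radii $\varepsilon_m\ge0$, noise levels $\sigma_m>0$ and targets $\gamma_m>0$. The problem is to minimize $\|W\|_F^2$ over $W=[w_1,\dots,w_M]\in\mathbb C^{N\times M}$ with at most $L$ nonzero rows such that $|w_m^H\bar h|^2/(\sum_{l\ne m}|w_l^H\bar h|^2+\sigma_m^2)\ge\gamma_m$ for all $m$ and all $\|\bar h-h_m\|_2\le\varepsilon_m$ ($\varepsilon_m=0$: perfect channel knowledge). *MINIMAL* is branch and bound on nodes $(\mathcal A,\mathcal B)$ of included and excluded antennas. $\Phi(\mathcal B)\in[0,\infty]$ denotes the optimal value with the rows in $\mathcal B$ set to zero and the bound on the number of nonzero rows dropped. The lower bound at a node is $\Phi(\mathcal B)$. The upper bound is $\Phi(\widetilde{\mathcal B})$, where $\widetilde{\mathcal B}\supseteq\mathcal B$ has $N-L$ elements and adds undecided antennas of least power in the relaxed solution. A non-leaf node of lowest lower bound is selected and classified. If it is classified as relevant, it is branched on the undecided antenna of largest power in the relaxed solution (a child with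 $L$ included or $N-L$ excluded antennas is completed to a leaf); otherwise it is discarded. The incumbent is the solution of best upper bound found; nodes whose lower bound exceeds the global upper bound $u_G$ are removed; $l_G$ is the least lower bound over the remaining nodes, updated at each branching. The procedure stops when there is no node to select or $|u_G-l_G|/l_G\le\epsilon$, where $\epsilon\ge0$, and returns the incumbent. A node is *relevant* (label $y=1$) if $\mathcal A\subseteq\mathcal A^\star$ and $\mathcal B\cap\mathcal A^\star=\emptyset$ for a fixed optimal antenna subset $\mathcal A^\star$, $|\mathcal A^\star|=L$; otherwise $y=0$. The *classifier* $\pi_\theta$ maps features $\phi$ of a node (vectors $x_u\in\mathbb R^E$ at the $U=N+M$ vertices of the complete bipartite antenna-user graph and $e_{uv}\in\mathbb R^E$ at its edges) to $\pi_\theta(\phi)=\frac1U\sum_u\zeta(\beta^\top q_u^{(D)})$, where $q^{(0)}_u=x_u$, $q_u^{(d)}=\xi\big(Z_1q_u^{(d-1)}+\sum_{v\sim u}\xi(Z_2q_v^{(d-1)}+Z_3e_{uv})\big)$, $\zeta$ is the logistic sigmoid and $\theta=(Z_1,Z_2,Z_3,\beta)\in\mathbb R^{3E^2+E}$. A node is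 classified as relevant iff $\pi_\theta(\phi)\ge r$, where the threshold $r$ has a given law $\tau$ on $\mathbb R$ and is redrawn for each node ($r=\frac12$: hard decision; $r$ uniform on $[0,1]$: $\pi_\theta(\phi)$ is the probability of being classified as relevant). *Assumptions.* Features satisfy $\|x_u\|_2,\|e_{uv}\|_2\le B_x$; $\xi,\zeta$ are $C_\xi$- and $C_\zeta$-Lipschitz and $\xi(0)=0$; $\Theta=\{\theta:\|Z_i\|_2\le B_Z,\ \|\beta\|_2\le B_\beta\}$ with $B_Z>0$; for outputs of the network with $\theta\in\Theta$, $|\mathcal L|\le B_{\mathcal L}$ and $\mathcal L(\cdot,y)$ is $C_{\mathcal L}$-Lipschitz. $\Theta$ has $\ell_\infty$-diameter at most $H$, and for $1\le i\le I$ and any batches $D_1,\dots,D_i$ of $J$ samples with bounded features, $g_i(\theta)=\frac1i\sum_{t\le i}\frac1J\sum_{(\phi,y)\in D_t}\mathcal L(\pi_\theta(\phi),y)$ is $G$-Lipschitz on $\Theta$ in the $\ell_1$ norm. *Training.* Start from $\theta^{(1)}\in\Theta$. In round $i$, the batch $D_i$ consists of $J$ samples that are i.i.d. given $\theta^{(i)}$,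 each obtained from an independent random problem instance using $\theta^{(i)}$; let $p_i$ be their law given $\theta^{(i)}$. Then $\psi_i$ is drawn with independent $\mathrm{Exp}(\eta)$ coordinates, independently of everything before, and $\theta^{(i+1)}\in\arg\min_{\theta\in\Theta}g_i(\theta)-\psi_i^\top\theta$. For $1\le i\le I$ let $\ell_i=\mathbb E_{(\phi,y)\sim p_i}\mathbb E_\psi[\mathcal L(\pi_{\theta^{(i)}}(\phi),y)]$, where $\mathbb E_\psi$ is over a fresh perturbation in the definition of $\theta^{(i)}$ with the data $D_1,\dots,D_{i-1}$ fixed (for $i=1$, $\theta^{(1)}$ is fixed). The returned $\widehat\theta=\theta^{(\hat\imath)}$ minimizes $\ell_i$ over $i\le I$; write $p_{\widehat\theta}=p_{\hat\imath}$. For the classifications by $\widehat\theta$, either the realized parameter is used, or it is redrawn for each node by a fresh $\psi$ as above. In either case let $\rho$ be the probability that a node $(\phi,y)\sim p_{\widehat\theta}$ is classified correctly, and let $\mathbb E_{p_{\widehat\theta},\psi}$ be the corresponding expectation. **Theorem.** There are a constant $C$ and rates $\eta_I>0$ depending only on $E,G,H$ (and $I$ for the latter) such that the following holds. 1. Suppose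 that MINIMAL is run on an instance that has an optimal solution and that every node it selects is classified correctly with conditional probability at least $\rho$ given the past. If $\rho>\frac12$, then the expected number of visited nodes (nodes of the search tree) satisfies $$Q_{\widehat\theta}\le\frac{2N(2\rho-\rho^N)}{2\rho-1}+1 .$$ 2. Let $\eta=\eta_I$, $0<\delta<1$, and suppose that almost surely $\min_{\theta\in\Theta}\frac1{IJ}\sum_{i\le I}\sum_{(\phi,y)\in D_i}\mathcal L(\pi_\theta(\phi),y)\le\nu$. Then with probability at least $1-\delta$ $$\ell_{\hat\imath}\le\nu+\frac{C}{I^{1/3}}+\mathsf{Gap}\big(\tfrac\delta2,J\big)\sqrt{\frac{2\log(2/\delta)}{I}},$$ where, with $\alpha=(1+UC_\xi)C_\xi B_Z\neq1$, $$\mathsf{Gap}(\delta,K)=\frac{8C_{\mathcal L}}K+\frac{24C_{\mathcal L}B_{\mathcal L}}{\sqrt K}\sqrt{(3E^2+E)\log\Lambda}+3B_{\mathcal L}\sqrt{\frac{\log(2/\delta)}{2K}},$$ $\Lambda=1+12\sqrt{EK}\,B_Z\max\{\Sigma_1,\Sigma_2,\Sigma_3,\frac{B_\beta}{B_Z}\Sigma_\beta\}$,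 $\Sigma_1=C_\zeta B_\beta UC_\xi^3B_ZB_x\frac{\alpha^{D+1}-2\alpha+1}{(\alpha-1)^2}$, $\Sigma_2=UC_\xi\Sigma_1$, $\Sigma_3=C_\zeta B_\beta UC_\xi^2B_ZB_x\frac{\alpha^D-1}{\alpha-1}$, $\Sigma_\beta=C_\zeta B_x\alpha^D+C_\zeta UC_\xi^2B_ZB_x\frac{\alpha^D-1}{\alpha-1}$. 3. If $\mathcal L$ is the logistic loss $-y\log x-(1-y)\log(1-x)$ and nodes are classified as relevant with probability $\pi_{\widehat\theta}(\phi)$ ($r$ uniform on $[0,1]$), then $\rho\ge\exp\big(-\mathbb E_{p_{\widehat\theta},\psi}[\mathcal L(\pi_{\widehat\theta}(\phi),y)]\big)$. 4. Under the first sentence of 1, with probability at least $\rho^N$ MINIMAL stops and returns a feasible $W$ whose power $\|W\|_F^2$ is at most $1+\epsilon$ times the optimal one; for $\epsilon=0$, an optimal solution. Parts 1, 3 and 4 hold for every $\eta>0$. -/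

import Mathlib

open MeasureTheory ProbabilityTheory Finset
open scoped ENNReal NNReal

noncomputable section

/-! ## The joint (robust) beamforming and antenna selection problem

`N` antennas, `M` users, at most `L` active antennas. -/

/-- Data of a problem instance. The robust problem has uncertainty radii `err m`; the radius `0`
gives the problem with perfect channel knowledge. -/
structure BFInstance (N M : ℕ) where
  /-- number of antennas that may be active -/
  L : ℕ
  /-- channel vectors -/
  h : Fin M → EuclideanSpace ℂ (Fin N)
  /-- bounds on the channel errors -/
  err : Fin M → ℝ
  /-- noise levels -/
  sigma : Fin M → ℝ
  /-- required signal to interference and noise ratios -/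
  gamma : Fin M → ℝ
  L_le : L ≤ N
  err_nonneg : ∀ m, 0 ≤ err m
  sigma_pos : ∀ m, 0 < sigma m
  gamma_pos : ∀ m, 0 < gamma m

/-- `|wᵐᴴ g|²`, where `wᵐ` is column `m` of `W`. -/
def gain {N M : ℕ} (W : Matrix (Fin N) (Fin M) ℂ) (m : Fin M) (g : EuclideanSpace ℂ (Fin N)) : ℝ :=
  ‖∑ n, star (W n m) * g n‖ ^ 2

/-- Squared Frobenius norm. -/
def sqFrob {N M : ℕ} (W : Matrix (Fin N) (Fin M) ℂ) : ℝ := ∑ n, ∑ m, ‖W n m‖ ^ 2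

/-- Power of antenna `n`: squared norm of row `n`. -/
def rowPower {N M : ℕ} (W : Matrix (Fin N) (Fin M) ℂ) (n : Fin N) : ℝ := ∑ m, ‖W n m‖ ^ 2

namespace BFInstance

variable {N M : ℕ} (Q : BFInstance N M)

/-- The worst-case signal to interference and noise ratio of every user is large enough. -/
def MeetsSINR (W : Matrix (Fin N) (Fin M) ℂ) : Prop :=
  ∀ m, ∀ g : EuclideanSpace ℂ (Fin N), ‖g - Q.h m‖ ≤ Q.err m →
    Q.gamma m ≤ gain W m g / ((∑ l ∈ univ.erase m, gain W l g) + Q.sigma m ^ 2)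

/-- Feasibility for the joint problem: the ratios are met and at most `L` rows are nonzero. -/
def Feasible (W : Matrix (Fin N) (Fin M) ℂ) : Prop :=
  Q.MeetsSINR W ∧ {n : Fin N | ∃ m, W n m ≠ 0}.ncard ≤ Q.L

/-- `W` is feasible and its power is within the factor `1 + ε` of the power of every feasible
matrix. For `ε = 0`: `W` is an optimal solution of the joint problem. -/
def OptimalWithin (ε : ℝ≥0) (W : Matrix (Fin N) (Fin M) ℂ) : Prop :=
  Q.Feasible W ∧ ∀ W', Q.Feasible W' → sqFrob W ≤ (1 + ε) * sqFrob W'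

/-- `A` is the antenna subset of an optimal solution: `L` antennas outside which some optimal
solution vanishes. -/
def IsOptimalSubset (A : Finset (Fin N)) : Prop :=
  A.card = Q.L ∧ ∃ W, Q.OptimalWithin 0 W ∧ ∀ n, n ∉ A → ∀ m, W n m = 0

/-- Feasible set of the beamforming problem in which the antennas in `B` are shut down and the
bound on the number of active antennas is dropped. -/
def relaxed (B : Finset (Fin N)) : Set (Matrix (Fin N) (Fin M) ℂ) :=
  {W | Q.MeetsSINR W ∧ ∀ n ∈ B, ∀ m, W n m = 0}

/-- Optimal value of that problem, `∞` if it is infeasible. -/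
def value (B : Finset (Fin N)) : ℝ≥0∞ := ⨅ W ∈ Q.relaxed B, ENNReal.ofReal (sqFrob W)

end BFInstance

/-! ## The branch and bound procedure with node classification -/

/-- A node of the search tree: the antennas included (`A`) and excluded (`B`), and the level. -/
structure BBNode (N : ℕ) where
  A : Finset (Fin N)
  B : Finset (Fin N)
  level : ℕ

instance (N : ℕ) : DecidableEq (BBNode N) := Classical.decEq _

namespace BBNode

variable {N : ℕ}

def undecided (n : BBNode N) : Finset (Fin N) := univ \ (n.A ∪ n.B)

/-- Leaf nodes: all antennas are decided, `L` of them included. -/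
def IsLeaf (L : ℕ) (n : BBNode N) : Prop := n.A.card = L ∧ n.B.card = N - L

/-- Nodes that can still be completed to a leaf. -/
def Valid (L : ℕ) (n : BBNode N) : Prop :=
  Disjoint n.A n.B ∧ n.A.card ≤ L ∧ n.B.card ≤ N - L

/-- Once `L` antennas are included, exclude all others; once `N - L` are excluded, include all
others. -/
def close (L : ℕ) (n : BBNode N) : BBNode N :=
  if n.A.card = L then ⟨n.A, univ \ n.A, n.level⟩
  else if n.B.card = N - L then ⟨univ \ n.B, n.B, n.level⟩
  else n

def root (N L : ℕ) : BBNode N := close L ⟨∅, ∅, 0⟩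

/-- The child that excludes the antenna `v`. -/
def left (L : ℕ) (n : BBNode N) (v : Fin N) : BBNode N :=
  close L ⟨n.A, insert v n.B, n.level + 1⟩

/-- The child that includes the antenna `v`. -/
def right (L : ℕ) (n : BBNode N) (v : Fin N) : BBNode N :=
  close L ⟨insert v n.A, n.B, n.level + 1⟩

/-- The label of a node: `true` (relevant) if the decisions made at the node agree with the
optimal antenna subset `Aopt`. -/
def label (Aopt : Finset (Fin N)) (n : BBNode N) : Bool := decide (n.A ⊆ Aopt ∧ n.B ⊆ univ \ Aopt)

end BBNode

/-- The choices that branch and bound leaves open: which minimizers and maximizers are taken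
when there are several. -/
structure BBRules {N M : ℕ} (Q : BFInstance N M) where
  /-- an optimal solution of the relaxed problem with the antennas `B` shut down -/
  solve : Finset (Fin N) → Matrix (Fin N) (Fin M) ℂ
  solve_spec : ∀ B, (Q.relaxed B).Nonempty →
    solve B ∈ Q.relaxed B ∧ ∀ W ∈ Q.relaxed B, sqFrob (solve B) ≤ sqFrob W
  /-- the `N - L` antennas shut down for the upper bound at a node: the excluded ones and
  undecided ones of least power in the relaxed solution -/
  shut : BBNode N → Finset (Fin N)
  shut_spec : ∀ n, n.Valid Q.L → n.B ⊆ shut n ∧ Disjoint n.A (shut n) ∧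
    (shut n).card = N - Q.L ∧
    ∀ i ∈ n.undecided ∩ shut n, ∀ j ∈ n.undecided \ shut n,
      rowPower (solve n.B) i ≤ rowPower (solve n.B) j
  /-- the antenna to branch on: undecided, of largest power in the relaxed solution -/
  branch : BBNode N → Fin N
  branch_spec : ∀ n, n.undecided.Nonempty → branch n ∈ n.undecided ∧
    ∀ i ∈ n.undecided, rowPower (solve n.B) i ≤ rowPower (solve n.B) (branch n)
  /-- node selection: lowest lower bound first -/
  pick : Finset (BBNode N) → BBNode N
  pick_spec : ∀ s, s.Nonempty → pick s ∈ s ∧ ∀ n ∈ s, Q.value (pick s).B ≤ Q.value n.B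

/-- State of the procedure. -/
structure BBState (N M : ℕ) where
  /-- the nodes still under consideration -/
  frontier : Finset (BBNode N)
  /-- global upper bound -/
  upper : ℝ≥0∞
  /-- global lower bound -/
  lower : ℝ≥0∞
  incumbent : Matrix (Fin N) (Fin M) ℂ
  /-- number of nodes of the tree generated so far -/
  visited : ℕ

namespace BBRules

variable {N M : ℕ} {Q : BFInstance N M} (R : BBRules Q)

/-- Lower bound at a node. -/
def lb (_ : BBRules Q) (n : BBNode N) : ℝ≥0∞ := Q.value n.B

/-- Upper bound at a node. -/
def ub (n : BBNode N) : ℝ≥0∞ := Q.value (R.shut n)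

def init : BBState N M where
  frontier := {BBNode.root N Q.L}
  upper := R.ub (BBNode.root N Q.L)
  lower := R.lb (BBNode.root N Q.L)
  incumbent := R.solve (R.shut (BBNode.root N Q.L))
  visited := 1

open Classical in
/-- The nodes that can be selected. -/
def open_ (_ : BBRules Q) (S : BBState N M) : Finset (BBNode N) :=
  S.frontier.filter fun n => ¬ n.IsLeaf Q.L

/-- The selected node. -/
def current (S : BBState N M) : BBNode N := R.pick (R.open_ S)

/-- The procedure goes on while there is a node to select and the relative gap between the global
bounds exceeds `ε`. (A node stays in the frontier only if its lower bound is at most `upper`, so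
the truncated difference loses nothing.) -/
def Continues (ε : ℝ≥0) (S : BBState N M) : Prop :=
  (R.open_ S).Nonempty ∧ (ε : ℝ≥0∞) < (S.upper - S.lower) / S.lower

open Classical in
/-- One iteration; `d` is the decision of the classifier on the selected node: branch it (`true`)
or discard it (`false`). -/
def step (ε : ℝ≥0) (S : BBState N M) (d : Bool) : BBState N M :=
  if R.Continues ε S then
    let n := R.current S
    let rest := S.frontier.erase n
    if d then
      let c₁ := n.left Q.L (R.branch n)
      let c₂ := n.right Q.L (R.branch n)
      let all := insert c₁ (insert c₂ rest)
      let k := if R.ub c₁ ≤ R.ub c₂ then c₁ else c₂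
      let u := if R.ub k ≤ S.upper then R.ub k else S.upper
      { frontier := all.filter fun c => R.lb c ≤ u
        upper := u
        lower := all.inf R.lb
        incumbent := if R.ub k ≤ S.upper then R.solve (R.shut k) else S.incumbent
        visited := S.visited + 2 }
    else { S with frontier := rest.filter fun c => R.lb c ≤ S.upper }
  else S

end BBRules

/-! ## The graph neural network -/

/-- Features of a node: vectors at the antennas and the users, and at the antenna-user edges. -/
abbrev Features (N M E : ℕ) : Type :=
  (Fin N ⊕ Fin M → EuclideanSpace ℝ (Fin E)) × (Fin N → Fin M → EuclideanSpace ℝ (Fin E))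

/-- A training pair: features and label. -/
abbrev Sample (N M E : ℕ) : Type := Features N M E × Bool

/-- Positions in the parameter vector `θ = (vec Z₁, vec Z₂, vec Z₃, β)`. -/
abbrev Coord (E : ℕ) : Type := (Fin 3 × Fin E × Fin E) ⊕ Fin E

abbrev Params (E : ℕ) : Type := Coord E → ℝ

/-- The aggregation matrix `Z₁`, `Z₂` or `Z₃` (`i = 0, 1, 2`). -/
def Params.Z {E : ℕ} (θ : Params E) (i : Fin 3) : Matrix (Fin E) (Fin E) ℝ :=
  Matrix.of fun a b => θ (Sum.inl (i, a, b))

def Params.β {E : ℕ} (θ : Params E) : EuclideanSpace ℝ (Fin E) :=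
  WithLp.toLp 2 fun a => θ (Sum.inr a)

/-- A matrix acting on Euclidean space; its operator norm is the spectral norm. -/
def Params.act {E : ℕ} (θ : Params E) (i : Fin 3) :
    EuclideanSpace ℝ (Fin E) →L[ℝ] EuclideanSpace ℝ (Fin E) :=
  Matrix.toEuclideanCLM (n := Fin E) (𝕜 := ℝ) (θ.Z i)

section GNN

variable {N M E : ℕ} (ξ : EuclideanSpace ℝ (Fin E) → EuclideanSpace ℝ (Fin E))

/-- The sum of the messages that a vertex receives from its neighbours in the complete bipartite
graph between antennas and users. -/
def messages (θ : Params E) (φ : Features N M E)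
    (q : Fin N ⊕ Fin M → EuclideanSpace ℝ (Fin E)) : Fin N ⊕ Fin M → EuclideanSpace ℝ (Fin E)
  | Sum.inl n => ∑ m, ξ (θ.act 1 (q (Sum.inr m)) + θ.act 2 (φ.2 n m))
  | Sum.inr m => ∑ n, ξ (θ.act 1 (q (Sum.inl n)) + θ.act 2 (φ.2 n m))

/-- The embeddings of the vertices after `d` layers. -/
def embed (θ : Params E) (φ : Features N M E) : ℕ → Fin N ⊕ Fin M → EuclideanSpace ℝ (Fin E)
  | 0 => φ.1
  | d + 1 => fun u => ξ (θ.act 0 (embed θ φ d u) + messages ξ θ φ (embed θ φ d) u)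

/-- Output of the network with `depth` layers: mean over the `N + M` vertices of the sigmoid of
`βᵀ q`. -/
def gnn (depth : ℕ) (θ : Params E) (φ : Features N M E) : ℝ :=
  (1 / (N + M : ℝ)) * ∑ u, Real.sigmoid (inner ℝ θ.β (embed ξ θ φ depth u))

end GNN

/-- Logistic (binary cross-entropy) loss. -/
def logisticLoss (x : ℝ) (y : Bool) : ℝ := if y then -Real.log x else -Real.log (1 - x)

/-- The constants in the assumptions on the data and on the network. -/
structure Bounds where
  Bx : ℝ
  Cξ : ℝ
  Cζ : ℝ
  CL : ℝ
  BL : ℝ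
  BZ : ℝ
  Bβ : ℝ

namespace Bounds

variable (c : Bounds)

/-- The parameter set `Θ`. -/
def paramSet (E : ℕ) : Set (Params E) := {θ | (∀ i, ‖θ.act i‖ ≤ c.BZ) ∧ ‖θ.β‖ ≤ c.Bβ}

/-- Bounded features. -/
def Admissible {N M E : ℕ} (φ : Features N M E) : Prop :=
  (∀ u, ‖φ.1 u‖ ≤ c.Bx) ∧ ∀ n m, ‖φ.2 n m‖ ≤ c.Bx

/-- `α`, where `U` is the number of vertices. -/
def α (U : ℕ) : ℝ := (1 + U * c.Cξ) * c.Cξ * c.BZ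

def S₁ (U D : ℕ) : ℝ :=
  c.Cζ * c.Bβ * U * c.Cξ ^ 3 * c.BZ * c.Bx *
    ((c.α U ^ (D + 1) - 2 * c.α U + 1) / (c.α U - 1) ^ 2)

def S₂ (U D : ℕ) : ℝ := U * c.Cξ * c.S₁ U D

def S₃ (U D : ℕ) : ℝ :=
  c.Cζ * c.Bβ * U * c.Cξ ^ 2 * c.BZ * c.Bx * ((c.α U ^ D - 1) / (c.α U - 1))

def Sβ (U D : ℕ) : ℝ :=
  c.Cζ * c.Bx * c.α U ^ D +
    c.Cζ * U * c.Cξ ^ 2 * c.BZ * c.Bx * ((c.α U ^ D - 1) / (c.α U - 1))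

def Lam (E U D K : ℕ) : ℝ :=
  1 + 12 * √(E * K) * c.BZ *
    max (max (c.S₁ U D) (c.S₂ U D)) (max (c.S₃ U D) (c.Bβ / c.BZ * c.Sβ U D))

/-- The generalization gap `Gap(δ, K)` of the network with `D` layers, embedding dimension `E` and
`U` vertices. -/
def gap (E U D : ℕ) (δ : ℝ) (K : ℕ) : ℝ :=
  8 * c.CL / K
    + 24 * c.CL * c.BL / √K * √((3 * (E : ℝ) ^ 2 + E) * Real.log (c.Lam E U D K))
    + 3 * c.BL * √(Real.log (2 / δ) / (2 * K))

end Bounds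

/-! ## Online learning with random perturbation -/

/-- Training batches `D₁, …, Dᵢ` of `J` samples each. -/
abbrev Batches (N M E J i : ℕ) : Type := Fin i → Fin J → Sample N M E

/-- The law of the perturbation: independent exponential coordinates of rate `η`. -/
def perturbLaw (E : ℕ) (η : ℝ) : Measure (Params E) :=
  Measure.pi fun _ : Coord E => expMeasure η

/-- The law of the noise of one round. -/
def roundLaw {Z : Type*} [MeasurableSpace Z] (E J : ℕ) (μ : Measure Z) (η : ℝ) :
    Measure ((Fin J → Z) × Params E) :=
  (Measure.pi fun _ : Fin J => μ).prod (perturbLaw E η)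

/-- The ingredients of the training procedure. -/
structure Training (N M E J : ℕ) (Z : Type*) where
  /-- number of layers -/
  depth : ℕ
  /-- activation function -/
  ξ : EuclideanSpace ℝ (Fin E) → EuclideanSpace ℝ (Fin E)
  loss : ℝ → Bool → ℝ
  /-- Data collection: `gen i θ z` is the training pair obtained in round `i` (counted from `0`)
  from the random problem instance (and further random choices) `z` when nodes are generated with
  the current parameter `θ`. -/
  gen : ℕ → Params E → Z → Sample N M E
  /-- the initial parameter -/
  θinit : Params E
  /-- the optimizer: from the batches collected so far and the perturbation, the next parameter -/
  argmin : (i : ℕ) → Batches N M E J i → Params E → Params E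

namespace Training

variable {N M E J : ℕ} {Z : Type*} (T : Training N M E J Z)

/-- Loss of the parameter `θ` on a sample. -/
def sampleLoss (θ : Params E) (s : Sample N M E) : ℝ := T.loss (gnn T.ξ T.depth θ s.1) s.2

/-- The aggregated empirical loss `gᵢ(θ)`. -/
def g {i : ℕ} (D : Batches N M E J i) (θ : Params E) : ℝ :=
  (1 / (i : ℝ)) * ∑ t, (1 / (J : ℝ)) * ∑ j, T.sampleLoss θ (D t j)

/-- The batches collected in the first `i` rounds and the parameter used in the next one. The
noise of round `i` is `x i = (z, ψ)`: the `J` random instances and the perturbation `ψ`. -/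
def run (x : ℕ → (Fin J → Z) × Params E) : (i : ℕ) → Batches N M E J i × Params E
  | 0 => (Fin.elim0, T.θinit)
  | i + 1 =>
    let D : Batches N M E J (i + 1) :=
      Fin.snoc (α := fun _ => Fin J → Sample N M E) (run x i).1
        (fun j => T.gen i (run x i).2 ((x i).1 j))
    (D, T.argmin (i + 1) D (x i).2)

/-- The batches `D₁, …, Dᵢ`. -/
def data (x : ℕ → (Fin J → Z) × Params E) (i : ℕ) : Batches N M E J i := (T.run x i).1

/-- The parameter used in round `i` (counted from `0`). -/
def param (x : ℕ → (Fin J → Z) × Params E) (i : ℕ) : Params E := (T.run x i).2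

/-- The distribution of the training pairs of round `i`, given the parameter used to collect
them. -/
def sampleLaw [MeasurableSpace Z] (μ : Measure Z) (x : ℕ → (Fin J → Z) × Params E) (i : ℕ) :
    Measure (Sample N M E) :=
  μ.map (T.gen i (T.param x i))

/-- The law, over a fresh perturbation, of the parameter of round `i`, given the data collected
before that round. -/
def paramLaw (η : ℝ) (x : ℕ → (Fin J → Z) × Params E) : ℕ → Measure (Params E)
  | 0 => Measure.dirac T.θinit
  | i + 1 => (perturbLaw E η).map (T.argmin (i + 1) (T.data x (i + 1)))

/-- Expected loss for a sample of law `p` and a parameter of law `κ`, independent. -/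
def expectedLoss (p : Measure (Sample N M E)) (κ : Measure (Params E)) : ℝ :=
  ∫ s, ∫ θ, T.sampleLoss θ s ∂κ ∂p

/-- Expected loss of the parameter of round `i`, over the samples of that round and the
perturbation. -/
def roundLoss [MeasurableSpace Z] (μ : Measure Z) (η : ℝ) (x : ℕ → (Fin J → Z) × Params E)
    (i : ℕ) : ℝ :=
  T.expectedLoss (T.sampleLaw μ x i) (T.paramLaw η x i)

/-- The standing assumptions: on the data, the network and the loss; on the diameter of the
parameter set and the Lipschitz continuity of the aggregated losses in the `ℓ₁` norm (for all
batches of bounded features); and `argmin` is a (measurable) exact optimizer. -/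
structure Assumptions [MeasurableSpace Z] (c : Bounds) (I : ℕ) (G H : ℝ) : Prop where
  Bx_nonneg : 0 ≤ c.Bx
  Cξ_nonneg : 0 ≤ c.Cξ
  CL_nonneg : 0 ≤ c.CL
  BZ_pos : 0 < c.BZ
  Bβ_nonneg : 0 ≤ c.Bβ
  ξ_zero : T.ξ 0 = 0
  ξ_lip : ∀ a b, ‖T.ξ a - T.ξ b‖ ≤ c.Cξ * ‖a - b‖
  ζ_lip : ∀ a b : ℝ, |Real.sigmoid a - Real.sigmoid b| ≤ c.Cζ * |a - b|
  loss_meas : ∀ y, Measurable fun x => T.loss x y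
  loss_bound : ∀ θ ∈ c.paramSet E, ∀ s : Sample N M E, c.Admissible s.1 →
    |T.sampleLoss θ s| ≤ c.BL
  loss_lip : ∀ θ ∈ c.paramSet E, ∀ θ' ∈ c.paramSet E, ∀ φ φ' : Features N M E,
    c.Admissible φ → c.Admissible φ' → ∀ y,
      |T.loss (gnn T.ξ T.depth θ φ) y - T.loss (gnn T.ξ T.depth θ' φ') y|
        ≤ c.CL * |gnn T.ξ T.depth θ φ - gnn T.ξ T.depth θ' φ'|
  gen_meas : ∀ i, Measurable fun q : Params E × Z => T.gen i q.1 q.2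
  gen_adm : ∀ i, ∀ θ ∈ c.paramSet E, ∀ z, c.Admissible (T.gen i θ z).1
  diam : ∀ θ ∈ c.paramSet E, ∀ θ' ∈ c.paramSet E, ∀ a, |θ a - θ' a| ≤ H
  g_lip : ∀ i, 1 ≤ i → i ≤ I → ∀ D : Batches N M E J i, (∀ t j, c.Admissible (D t j).1) →
    ∀ θ ∈ c.paramSet E, ∀ θ' ∈ c.paramSet E, |T.g D θ - T.g D θ'| ≤ G * ∑ a, |θ a - θ' a|
  init_mem : T.θinit ∈ c.paramSet E
  argmin_meas : ∀ i, Measurable fun q : Batches N M E J i × Params E => T.argmin i q.1 q.2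
  argmin_mem : ∀ i D ψ, (∀ t j, c.Admissible (D t j).1) → T.argmin i D ψ ∈ c.paramSet E
  argmin_min : ∀ i D ψ, (∀ t j, c.Admissible (D t j).1) → ∀ θ ∈ c.paramSet E,
    T.g D (T.argmin i D ψ) - ∑ a, ψ a * T.argmin i D ψ a ≤ T.g D θ - ∑ a, ψ a * θ a

/-! ## The learned classifier and the accelerated procedure -/

/-- A node with features `φ` is classified as relevant if the output of the network reaches the
threshold `r`. The threshold `1/2` is the hard decision; with a threshold uniform on `[0, 1]` the
output is the probability that the node is classified as relevant. -/
def classify (θ : Params E) (r : ℝ) (φ : Features N M E) : Bool :=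
  decide (r ≤ gnn T.ξ T.depth θ φ)

/-- The probability that a node of law `p` is classified correctly, with parameter of law `κ` and
threshold of law `τ`. -/
def accuracy (p : Measure (Sample N M E)) (κ : Measure (Params E)) (τ : Measure ℝ) : ℝ :=
  (p.prod (κ.prod τ)).real {q | T.classify q.2.1 q.2.2 q.1.1 = q.1.2}

variable {Q : BFInstance N M}

/-- State of the accelerated branch and bound procedure after `t` iterations: `w t` holds the
parameter and the threshold used for the classification in iteration `t`, and `feat` computes the
features of the selected node. -/
def minimal (R : BBRules Q) (ε : ℝ≥0) (feat : BBState N M → BBNode N → Features N M E)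
    (w : ℕ → Params E × ℝ) : ℕ → BBState N M
  | 0 => R.init
  | t + 1 =>
    let S := minimal R ε feat w t
    R.step ε S (T.classify (w t).1 (w t).2 (feat S (R.current S)))

/-- Every node that the procedure has to classify is classified correctly with probability at
least `ρ`, given the past. -/
def ClassifiesWith (R : BBRules Q) (ε : ℝ≥0) (feat : BBState N M → BBNode N → Features N M E)
    (Aopt : Finset (Fin N)) (κ : Measure (Params E)) [IsProbabilityMeasure κ] (τ : Measure ℝ)
    [IsProbabilityMeasure τ] (ρ : ℝ) : Prop :=
  ∀ t, ∀ᵐ w ∂(Measure.infinitePi fun _ : ℕ => κ.prod τ),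
    let S := T.minimal R ε feat w t
    R.Continues ε S →
      ρ ≤ T.accuracy (Measure.dirac (feat S (R.current S), (R.current S).label Aopt)) κ τ

/-- The expected number of nodes visited. -/
def expectedNodes (R : BBRules Q) (ε : ℝ≥0) (feat : BBState N M → BBNode N → Features N M E)
    (κ : Measure (Params E)) [IsProbabilityMeasure κ] (τ : Measure ℝ)
    [IsProbabilityMeasure τ] : ℝ≥0∞ :=
  ∫⁻ w, ⨆ t, ((T.minimal R ε feat w t).visited : ℝ≥0∞)
    ∂(Measure.infinitePi fun _ : ℕ => κ.prod τ)

/-- The event that the procedure stops with a solution that is optimal within the tolerance. -/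
def success (R : BBRules Q) (ε : ℝ≥0) (feat : BBState N M → BBNode N → Features N M E) :
    Set (ℕ → Params E × ℝ) :=
  {w | ∃ t, ¬ R.Continues ε (T.minimal R ε feat w t) ∧
    Q.OptimalWithin ε (T.minimal R ε feat w t).incumbent}

end Training

end

/-!
A parameter drawn as perturbed leader from the data of the first `i` rounds hardly changes in law
when one more round is added, because an exponential variable is memoryless; this stability bounds
the regret against the best fixed parameter by `O(I ^ (-1/3))` per round. Given the past, the
expected loss of a round exceeds the loss measured on its own fresh batch by an average of `J`
centred independent terms, so the total excess is sub-Gaussian with variance proxy `I * B ^ 2 / J`.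
The gap of the theorem dominates `B / √J`, and the best round is no worse than the average round.

With a uniform threshold a sample is classified correctly with probability `exp (-loss)`, so
Jensen's inequality compares the accuracy with the expected loss.

For branch and bound, give every node of the frontier a potential depending on the number of its
undecided antennas and on whether it is relevant, such that in expectation the visited nodes plus
the potential of the frontier do not increase when classifications are correct with probability at
least `ρ`. Likewise `ρ` to the number of undecided antennas of the relevant frontier node, and `0`
once the optimum has been discarded, is a submartingale starting at `ρ ^ N` or more.
-/

/-! ## Product measures -/

section ProductMeasure

variable {ι : Type*} {A : ι → Type*} [∀ i, MeasurableSpace (A i)]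
  (ν : ∀ i, Measure (A i)) [∀ i, IsProbabilityMeasure (ν i)]

theorem map_update_infinitePi_prod [DecidableEq ι] (i : ι) :
    ((Measure.infinitePi ν).prod (ν i)).map (fun q => Function.update q.1 i q.2) =
      Measure.infinitePi ν := by
  refine Measure.eq_infinitePi _ fun s t ht => ?_
  rw [Measure.map_apply measurable_update' (MeasurableSet.pi s.countable_toSet fun j _ => ht j)]
  have preimage_eq : (fun q : (∀ j, A j) × A i => Function.update q.1 i q.2) ⁻¹' Set.pi s t =
      Set.pi (s.erase i : Finset ι) t ×ˢ {a | i ∈ s → a ∈ t i} := by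
    ext q
    have h := Set.update_mem_pi_iff (s := (s : Set ι)) (t := t) (a := q.1) (i := i) (b := q.2)
    simpa [and_comm] using h
  rw [preimage_eq, Measure.prod_prod, Measure.infinitePi_pi _ fun j _ => ht j]
  by_cases hi : i ∈ s
  · simpa [hi, mul_comm] using Finset.mul_prod_erase s (fun j => ν j (t j)) hi
  · simp [hi]

theorem lintegral_infinitePi_update [DecidableEq ι] (i : ι) {F : (∀ j, A j) → ℝ≥0∞}
    (hF : Measurable F) :
    ∫⁻ x, F x ∂Measure.infinitePi ν =
      ∫⁻ x, ∫⁻ a, F (Function.update x i a) ∂ν i ∂Measure.infinitePi ν := by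
  have hFu : Measurable fun q : (∀ j, A j) × A i => F (Function.update q.1 i q.2) :=
    hF.comp measurable_update'
  conv_lhs => rw [← map_update_infinitePi_prod ν i]
  rw [lintegral_map hF measurable_update', lintegral_prod _ hFu.aemeasurable]

theorem lintegral_infinitePi_eval (i : ι) {F : (∀ j, A j) → A i → ℝ≥0∞}
    (hF : Measurable fun q : (∀ j, A j) × A i => F q.1 q.2)
    (hdep : ∀ x x', (∀ j, j ≠ i → x j = x' j) → F x = F x') :
    ∫⁻ x, F x (x i) ∂Measure.infinitePi ν =
      ∫⁻ x, ∫⁻ a, F x a ∂ν i ∂Measure.infinitePi ν := by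
  classical
  rw [lintegral_infinitePi_update ν i (F := fun x => F x (x i))
    (hF.comp (measurable_id.prodMk (measurable_pi_apply i)))]
  refine lintegral_congr fun x => lintegral_congr fun a => ?_
  rw [hdep (Function.update x i a) x fun j hj => Function.update_of_ne hj _ _,
    Function.update_self]

theorem map_update_infinitePi_le [DecidableEq ι] (i : ι) {f : A i → A i} (hf : Measurable f)
    {c : ℝ≥0∞} (hle : (ν i).map f ≤ c • ν i) :
    (Measure.infinitePi ν).map (fun x => Function.update x i (f (x i))) ≤
      c • Measure.infinitePi ν := by
  have hfi : Measurable fun x : ∀ j, A j => Function.update x i (f (x i)) :=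
    measurable_update'.comp (measurable_id.prodMk (hf.comp (measurable_pi_apply i)))
  have resample : (fun x : ∀ j, A j => Function.update x i (f (x i))) ∘
      (fun q : (∀ j, A j) × A i => Function.update q.1 i q.2) =
      (fun q => Function.update q.1 i q.2) ∘ Prod.map id f := by
    funext q
    simp
  calc (Measure.infinitePi ν).map (fun x => Function.update x i (f (x i)))
      = ((Measure.infinitePi ν).prod ((ν i).map f)).map
          (fun q => Function.update q.1 i q.2) := by
        conv_lhs => rw [← map_update_infinitePi_prod ν i]
        rw [Measure.map_map hfi measurable_update', resample,
          ← Measure.map_map measurable_update' (measurable_id.prodMap hf),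
          ← Measure.map_prod_map _ _ measurable_id hf, Measure.map_id]
    _ ≤ ((Measure.infinitePi ν).prod (c • ν i)).map (fun q => Function.update q.1 i q.2) :=
        Measure.map_mono (Measure.prod_mono le_rfl hle) measurable_update'
    _ = c • Measure.infinitePi ν := by
        rw [Measure.prod_smul_right, Measure.map_smul, map_update_infinitePi_prod]

end ProductMeasure

/-! ## Functions of bounded oscillation -/

section Oscillation

variable {X : Type*} [MeasurableSpace X] {φ : X → ℝ} {H : ℝ}

theorem integrable_of_sub_le (hφ : Measurable φ) (hH : ∀ x y, φ x - φ y ≤ H) (μ : Measure X)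
    [IsFiniteMeasure μ] : Integrable φ μ := by
  rcases isEmpty_or_nonempty X with _ | ⟨⟨x₀⟩⟩
  · exact Integrable.of_isEmpty
  · refine Integrable.of_bound hφ.aestronglyMeasurable (|φ x₀| + H) (.of_forall fun x => ?_)
    rw [Real.norm_eq_abs, abs_le]
    constructor <;> linarith [hH x x₀, hH x₀ x, le_abs_self (φ x₀), neg_abs_le (φ x₀)]

theorem integral_le_integral_add_of_le_smul {μ ν : Measure X} [IsProbabilityMeasure μ]
    [IsProbabilityMeasure ν] {t : ℝ} (ht : 0 ≤ t)
    (hνμ : ν ≤ ENNReal.ofReal (Real.exp t) • μ) (hφ : Measurable φ)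
    (hH : ∀ x y, φ x - φ y ≤ H) :
    ∫ x, φ x ∂ν ≤ ∫ x, φ x ∂μ + t * H := by
  have := μ.nonempty_of_neZero
  have x₀ : X := Classical.arbitrary X
  have hbdd : BddBelow (Set.range φ) := ⟨φ x₀ - H, by rintro _ ⟨x, rfl⟩; linarith [hH x₀ x]⟩
  set m := ⨅ x, φ x
  have sub_nonneg : ∀ x, 0 ≤ φ x - m := fun x => sub_nonneg.2 (ciInf_le hbdd x)
  have sub_le : ∀ x, φ x - m ≤ H := fun x => by
    have : φ x - H ≤ m := le_ciInf fun y => by linarith [hH x y]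
    linarith
  have hφν := integrable_of_sub_le hφ hH ν
  have hφμ := integrable_of_sub_le hφ hH μ
  have integral_le : ∫ x, (φ x - m) ∂ν ≤ Real.exp t * ∫ x, (φ x - m) ∂μ := by
    calc ∫ x, (φ x - m) ∂ν ≤ ∫ x, (φ x - m) ∂ENNReal.ofReal (Real.exp t) • μ :=
          integral_mono_measure hνμ (.of_forall sub_nonneg)
            ((hφμ.sub (integrable_const m)).smul_measure ENNReal.ofReal_ne_top)
      _ = Real.exp t * ∫ x, (φ x - m) ∂μ := by
          rw [integral_smul_measure, ENNReal.toReal_ofReal (Real.exp_pos t).le, smul_eq_mul]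
  have integral_le_H : ∫ x, (φ x - m) ∂ν ≤ H := by
    calc ∫ x, (φ x - m) ∂ν ≤ ∫ _, H ∂ν :=
          integral_mono (hφν.sub (integrable_const m)) (integrable_const H) sub_le
      _ = H := by simp
  have one_sub_mul_le : (1 - t) * ∫ x, (φ x - m) ∂ν ≤ ∫ x, (φ x - m) ∂μ := by
    calc (1 - t) * ∫ x, (φ x - m) ∂ν ≤ Real.exp (-t) * ∫ x, (φ x - m) ∂ν := by
          gcongr
          · exact integral_nonneg sub_nonneg
          · exact Real.one_sub_le_exp_neg t
      _ ≤ Real.exp (-t) * (Real.exp t * ∫ x, (φ x - m) ∂μ) := by gcongr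
      _ = ∫ x, (φ x - m) ∂μ := by rw [← mul_assoc, ← Real.exp_add]; simp
  rw [integral_sub hφν (integrable_const m)] at integral_le_H one_sub_mul_le
  rw [integral_sub hφμ (integrable_const m)] at one_sub_mul_le
  simp only [integral_const, probReal_univ, one_smul] at integral_le_H one_sub_mul_le
  linarith [mul_le_mul_of_nonneg_left integral_le_H ht]

end Oscillation

/-! ## Exponential perturbations -/

section Exponential

theorem map_add_right_expMeasure_le (η : ℝ) {s : ℝ} (hs : 0 ≤ s) :
    (expMeasure η).map (· + s) ≤ ENNReal.ofReal (Real.exp (η * s)) • expMeasure η := by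
  have hpdf : Measurable (exponentialPDF η) :=
    (measurable_exponentialPDFReal η).ennreal_ofReal
  have exp_eq : expMeasure η = volume.withDensity (exponentialPDF η) := rfl
  have pdf_shift : ∀ x, exponentialPDF η x ≤
      ENNReal.ofReal (Real.exp (η * s)) * exponentialPDF η (x + s) := fun x => by
    rcases lt_or_ge x 0 with hx | hx
    · simp [exponentialPDF_of_neg hx]
    · rw [exponentialPDF_of_nonneg hx, exponentialPDF_of_nonneg (by positivity),
        ← ENNReal.ofReal_mul (Real.exp_pos _).le, mul_left_comm, ← Real.exp_add]
      ring_nf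
      rfl
  refine Measure.le_iff.2 fun S hS => ?_
  have hS' : MeasurableSet ((· + s) ⁻¹' S) := measurable_add_const s hS
  calc (expMeasure η).map (· + s) S
      = ∫⁻ x in (· + s) ⁻¹' S, exponentialPDF η x := by
        rw [Measure.map_apply (measurable_add_const s) hS, exp_eq, withDensity_apply _ hS']
    _ ≤ ∫⁻ x in (· + s) ⁻¹' S, ENNReal.ofReal (Real.exp (η * s)) * exponentialPDF η (x + s) :=
        lintegral_mono pdf_shift
    _ = ∫⁻ x in S, ENNReal.ofReal (Real.exp (η * s)) * exponentialPDF η x :=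
        (measurePreserving_add_right volume s).setLIntegral_comp_preimage hS (hpdf.const_mul _)
    _ = (ENNReal.ofReal (Real.exp (η * s)) • expMeasure η) S := by
        rw [lintegral_const_mul _ hpdf, exp_eq, Measure.smul_apply, withDensity_apply _ hS,
          smul_eq_mul]

theorem lintegral_abs_expMeasure {η : ℝ} (hη : 0 < η) :
    ∫⁻ x, ENNReal.ofReal |x| ∂expMeasure η = ENNReal.ofReal (1 / η) := by
  have hpdf : Measurable (gammaPDF 2 η) := (measurable_gammaPDFReal 2 η).ennreal_ofReal
  have pdf_mul_abs : ∀ x, exponentialPDF η x * ENNReal.ofReal |x| =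
      ENNReal.ofReal (1 / η) * gammaPDF 2 η x := fun x => by
    rcases lt_or_ge x 0 with hx | hx
    · simp [exponentialPDF_of_neg hx, gammaPDF_of_neg hx]
    · rw [exponentialPDF_of_nonneg hx, gammaPDF_of_nonneg hx, ← ENNReal.ofReal_mul (by positivity),
        ← ENNReal.ofReal_mul (by positivity), abs_of_nonneg hx]
      congr 1
      rw [show (2 : ℝ) - 1 = 1 by norm_num, Real.rpow_one, Real.Gamma_two, Real.rpow_two]
      field_simp
  calc ∫⁻ x, ENNReal.ofReal |x| ∂expMeasure η
      = ∫⁻ x, exponentialPDF η x * ENNReal.ofReal |x| :=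
        lintegral_withDensity_eq_lintegral_mul _ (measurable_gammaPDFReal 1 η).ennreal_ofReal
          (by fun_prop)
    _ = ENNReal.ofReal (1 / η) := by
        simp_rw [pdf_mul_abs]
        rw [lintegral_const_mul _ hpdf, lintegral_gammaPDF_eq_one two_pos hη, mul_one]

variable {ι : Type*} [Fintype ι]

theorem isProbabilityMeasure_pi_expMeasure {η : ℝ} (hη : 0 < η) :
    IsProbabilityMeasure (Measure.pi fun _ : ι => expMeasure η) :=
  have := isProbabilityMeasure_expMeasure hη
  inferInstance

theorem lintegral_abs_eval_pi_expMeasure {η : ℝ} (hη : 0 < η) (i : ι) :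
    ∫⁻ ψ, ENNReal.ofReal |ψ i| ∂(Measure.pi fun _ : ι => expMeasure η) =
      ENNReal.ofReal (1 / η) := by
  have := isProbabilityMeasure_expMeasure hη
  rw [← lintegral_abs_expMeasure hη,
    ← (measurePreserving_eval (fun _ : ι => expMeasure η) i).lintegral_comp (by fun_prop)]

theorem integrable_abs_eval_pi_expMeasure {η : ℝ} (hη : 0 < η) (i : ι) :
    Integrable (fun ψ : ι → ℝ => |ψ i|) (Measure.pi fun _ : ι => expMeasure η) := by
  refine ⟨Measurable.aestronglyMeasurable (by fun_prop), ?_⟩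
  rw [hasFiniteIntegral_iff_ofReal (.of_forall fun _ => abs_nonneg _),
    lintegral_abs_eval_pi_expMeasure hη]
  exact ENNReal.ofReal_lt_top

theorem integral_abs_eval_pi_expMeasure {η : ℝ} (hη : 0 < η) (i : ι) :
    ∫ ψ, |ψ i| ∂(Measure.pi fun _ : ι => expMeasure η) = 1 / η := by
  rw [integral_eq_lintegral_of_nonneg_ae (.of_forall fun _ => abs_nonneg _)
      (Measurable.aestronglyMeasurable (by fun_prop)),
    lintegral_abs_eval_pi_expMeasure hη, ENNReal.toReal_ofReal (by positivity)]

theorem integral_update_add_pi_expMeasure_le [DecidableEq ι] {η s H : ℝ} (hη : 0 < η)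
    (hs : 0 ≤ s) (i : ι) {φ : (ι → ℝ) → ℝ} (hφ : Measurable φ) (hH : ∀ x y, φ x - φ y ≤ H) :
    ∫ ψ, φ (Function.update ψ i (ψ i + s)) ∂(Measure.pi fun _ : ι => expMeasure η) ≤
      ∫ ψ, φ ψ ∂(Measure.pi fun _ : ι => expMeasure η) + η * s * H := by
  have := isProbabilityMeasure_expMeasure hη
  have hu : Measurable fun ψ : ι → ℝ => Function.update ψ i (ψ i + s) := by fun_prop
  rw [← integral_map hu.aemeasurable hφ.aestronglyMeasurable]
  have := Measure.isProbabilityMeasure_map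
    (μ := Measure.pi fun _ : ι => expMeasure η) hu.aemeasurable
  refine integral_le_integral_add_of_le_smul (by positivity) ?_ hφ hH
  rw [← Measure.infinitePi_eq_pi]
  exact map_update_infinitePi_le (fun _ => expMeasure η) i (measurable_add_const s)
    (map_add_right_expMeasure_le η hs)

end Exponential

/-! ## Follow the perturbed leader -/

theorem sum_range_le_of_forall_isMinOn {α : Type*} {Θ : Set α} {h : ℕ → α → ℝ} {a : ℕ → α}
    (hmem : ∀ k, a (k + 1) ∈ Θ)
    (hmin : ∀ k, IsMinOn (fun θ => ∑ t ∈ range (k + 1), h t θ) Θ (a (k + 1))) (n : ℕ) {θ : α}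
    (hθ : θ ∈ Θ) : ∑ t ∈ range n, h t (a (t + 1)) ≤ ∑ t ∈ range n, h t θ := by
  induction n generalizing θ with
  | zero => simp
  | succ n ih =>
    calc ∑ t ∈ range (n + 1), h t (a (t + 1))
        ≤ ∑ t ∈ range (n + 1), h t (a (n + 1)) := by
          rw [sum_range_succ, sum_range_succ]
          exact add_le_add_left (ih (hmem n)) _
      _ ≤ ∑ t ∈ range (n + 1), h t θ := hmin n hθ

/-- The average of `f 0, …, f (n - 1)`; it is `0` for `n = 0`. -/
noncomputable def runningMean {α : Type*} (f : ℕ → α → ℝ) (n : ℕ) (x : α) : ℝ :=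
  (1 / (n : ℝ)) * ∑ t ∈ range n, f t x

theorem succ_mul_runningMean {α : Type*} (f : ℕ → α → ℝ) (n : ℕ) (x : α) :
    (n + 1 : ℝ) * runningMean f (n + 1) x = ∑ t ∈ range (n + 1), f t x := by
  rw [runningMean]
  push_cast
  field_simp

theorem runningMean_succ_sub {α : Type*} (f : ℕ → α → ℝ) (n : ℕ) (x : α) :
    runningMean f (n + 2) x - runningMean f (n + 1) x =
      1 / (n + 2) * (f (n + 1) x - runningMean f (n + 1) x) := by
  have next := succ_mul_runningMean f (n + 1) x
  rw [sum_range_succ, ← succ_mul_runningMean] at next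
  push_cast at next
  have : (n : ℝ) + 2 ≠ 0 := by positivity
  field_simp
  linarith

theorem sum_one_div_sqrt_le (n : ℕ) : ∑ t ∈ range n, 1 / √((t : ℝ) + 1) ≤ 2 * √n := by
  induction n with
  | zero => simp
  | succ n ih =>
    have sqrt_pos : 0 < √((n : ℝ) + 1) := Real.sqrt_pos.2 (by positivity)
    have one_div_le : 1 / √((n : ℝ) + 1) ≤ 2 * √((n : ℝ) + 1) - 2 * √n := by
      rw [div_le_iff₀ sqrt_pos]
      nlinarith [sq_nonneg (√((n : ℝ) + 1) - √n), Real.mul_self_sqrt (Nat.cast_nonneg (α := ℝ) n),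
        Real.mul_self_sqrt (by positivity : (0 : ℝ) ≤ n + 1)]
    rw [sum_range_succ]
    push_cast
    linarith

section PerturbedLeader

variable {ι : Type*} [Fintype ι] {Θ : Set (ι → ℝ)} {G H η : ℝ}

/-- Lipschitz continuity on `Θ` in the `ℓ₁` norm; `LipschitzOnWith` on `ι → ℝ` would refer to the
supremum norm. -/
def L1LipschitzOn (G : ℝ) (f : (ι → ℝ) → ℝ) (Θ : Set (ι → ℝ)) : Prop :=
  ∀ θ ∈ Θ, ∀ θ' ∈ Θ, |f θ - f θ'| ≤ G * ∑ k, |θ k - θ' k|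

namespace L1LipschitzOn

variable {G' : ℝ} {f f' : (ι → ℝ) → ℝ}

theorem sub (hf : L1LipschitzOn G f Θ) (hf' : L1LipschitzOn G' f' Θ) :
    L1LipschitzOn (G + G') (fun θ => f θ - f' θ) Θ := fun θ hθ θ' hθ' => by
  calc |f θ - f' θ - (f θ' - f' θ')| = |(f θ - f θ') - (f' θ - f' θ')| := by ring_nf
    _ ≤ |f θ - f θ'| + |f' θ - f' θ'| := abs_sub _ _
    _ ≤ (G + G') * ∑ k, |θ k - θ' k| := by
        rw [add_mul]
        exact add_le_add (hf θ hθ θ' hθ') (hf' θ hθ θ' hθ')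

theorem const_mul (hf : L1LipschitzOn G f Θ) (r : ℝ) :
    L1LipschitzOn (|r| * G) (fun θ => r * f θ) Θ := fun θ hθ θ' hθ' => by
  rw [← mul_sub, abs_mul, mul_assoc]
  exact mul_le_mul_of_nonneg_left (hf θ hθ θ' hθ') (abs_nonneg r)

theorem sum_range {f : ℕ → (ι → ℝ) → ℝ} (hf : ∀ t, L1LipschitzOn G (f t) Θ) (n : ℕ) :
    L1LipschitzOn (n * G) (fun θ => ∑ t ∈ range n, f t θ) Θ := fun θ hθ θ' hθ' => by
  calc |∑ t ∈ range n, f t θ - ∑ t ∈ range n, f t θ'|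
      ≤ ∑ t ∈ range n, |f t θ - f t θ'| := by
        rw [← sum_sub_distrib]
        exact abs_sum_le_sum_abs _ _
    _ ≤ ∑ _t ∈ range n, G * ∑ k, |θ k - θ' k| := sum_le_sum fun t _ => hf t θ hθ θ' hθ'
    _ = n * G * ∑ k, |θ k - θ' k| := by simp [mul_assoc]

theorem sub_le (hf : L1LipschitzOn G f Θ) (hG : 0 ≤ G)
    (hH : ∀ θ ∈ Θ, ∀ θ' ∈ Θ, ∀ k, |θ k - θ' k| ≤ H) {θ θ' : ι → ℝ} (hθ : θ ∈ Θ) (hθ' : θ' ∈ Θ) :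
    f θ - f θ' ≤ G * (Fintype.card ι * H) := by
  have sum_le : ∑ k, |θ k - θ' k| ≤ Fintype.card ι * H :=
    (sum_le_sum fun k _ => hH θ hθ θ' hθ' k).trans (by simp)
  exact (le_abs_self _).trans ((hf θ hθ θ' hθ').trans (mul_le_mul_of_nonneg_left sum_le hG))

end L1LipschitzOn

/-- `a ψ` is, for every perturbation `ψ`, a minimizer over `Θ` of the perturbed objective
`g θ - ∑ k, ψ k * θ k`, chosen measurably. -/
structure IsPerturbedLeader (Θ : Set (ι → ℝ)) (g : (ι → ℝ) → ℝ) (a : (ι → ℝ) → ι → ℝ) :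
    Prop where
  measurable : Measurable a
  mem : ∀ ψ, a ψ ∈ Θ
  le : ∀ ψ, ∀ θ ∈ Θ, g (a ψ) - ∑ k, ψ k * a ψ k ≤ g θ - ∑ k, ψ k * θ k

theorem sum_update_add_mul [DecidableEq ι] (ψ θ : ι → ℝ) (i : ι) (s : ℝ) :
    ∑ k, Function.update ψ i (ψ i + s) k * θ k = ∑ k, ψ k * θ k + s * θ i := by
  have update_eq : Function.update ψ i (ψ i + s) = ψ + Pi.single i s := by
    ext k
    by_cases hk : k = i
    · subst hk
      simp
    · simp [hk]
  simp [update_eq, add_mul, sum_add_distrib, Pi.single_apply]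

namespace IsPerturbedLeader

variable {g g' f : (ι → ℝ) → ℝ} {a b : (ι → ℝ) → ι → ℝ} {d c : ℝ}

theorem coord_le_update [DecidableEq ι] (ha : IsPerturbedLeader Θ g a)
    (hb : IsPerturbedLeader Θ g' b) (hH : ∀ θ ∈ Θ, ∀ θ' ∈ Θ, ∀ k, |θ k - θ' k| ≤ H) (hd : 0 ≤ d)
    (hc : 0 < c) (hg : L1LipschitzOn d (fun θ => g' θ - g θ) Θ) (ψ : ι → ℝ) (i : ι) :
    a ψ i ≤ b (Function.update ψ i (ψ i + c)) i + d * (Fintype.card ι * H) / c := by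
  set θ' := b (Function.update ψ i (ψ i + c)) with hθ'_def
  have hθ' : θ' ∈ Θ := hb.mem _
  have leader_a := ha.le ψ θ' hθ'
  have leader_b := hb.le (Function.update ψ i (ψ i + c)) (a ψ) (ha.mem ψ)
  rw [sum_update_add_mul, sum_update_add_mul, ← hθ'_def] at leader_b
  have objective_change := hg.sub_le hd hH (ha.mem ψ) hθ'
  rw [← sub_le_iff_le_add', le_div_iff₀ hc]
  linarith

theorem integrable_coord (ha : IsPerturbedLeader Θ g a)
    (hH : ∀ θ ∈ Θ, ∀ θ' ∈ Θ, ∀ k, |θ k - θ' k| ≤ H) (i : ι) (μ : Measure (ι → ℝ))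
    [IsFiniteMeasure μ] : Integrable (fun ψ => a ψ i) μ :=
  integrable_of_sub_le ((measurable_pi_apply i).comp ha.measurable)
    (fun ψ ψ' => (le_abs_self _).trans (hH _ (ha.mem ψ) _ (ha.mem ψ') i)) μ

theorem max_coord_le_min_coord_update [DecidableEq ι] (ha : IsPerturbedLeader Θ g a)
    (hb : IsPerturbedLeader Θ g' b) (hH : ∀ θ ∈ Θ, ∀ θ' ∈ Θ, ∀ k, |θ k - θ' k| ≤ H) (hd : 0 ≤ d)
    (hc : 0 < c) (hg : L1LipschitzOn d (fun θ => g' θ - g θ) Θ) (ψ : ι → ℝ) (i : ι) :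
    max (a ψ i) (b ψ i) ≤ min (a (Function.update ψ i (ψ i + c)) i)
      (b (Function.update ψ i (ψ i + c)) i) + d * (Fintype.card ι * H) / c := by
  have hg_symm : L1LipschitzOn d (fun θ => g θ - g' θ) Θ := by
    simpa using hg.const_mul (-1)
  have lipschitz_self : ∀ h : (ι → ℝ) → ℝ, L1LipschitzOn d (fun θ => h θ - h θ) Θ :=
    fun h θ _ θ' _ => by
      simpa using mul_nonneg hd (sum_nonneg fun k _ => abs_nonneg (θ k - θ' k))
  rw [← min_add_add_right]
  exact max_le
    (le_min (ha.coord_le_update ha hH hd hc (lipschitz_self g) ψ i)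
      (ha.coord_le_update hb hH hd hc hg ψ i))
    (le_min (hb.coord_le_update ha hH hd hc hg_symm ψ i)
      (hb.coord_le_update hb hH hd hc (lipschitz_self g') ψ i))

theorem min_coord_sub_le (ha : IsPerturbedLeader Θ g a) (hb : IsPerturbedLeader Θ g' b)
    (hH : ∀ θ ∈ Θ, ∀ θ' ∈ Θ, ∀ k, |θ k - θ' k| ≤ H) (ψ ψ' : ι → ℝ) (i : ι) :
    min (a ψ i) (b ψ i) - min (a ψ' i) (b ψ' i) ≤ H := by
  have sub_le : ∀ θ ∈ Θ, a ψ i - H ≤ θ i := fun θ hθ => by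
    linarith [le_abs_self (a ψ i - θ i), hH (a ψ) (ha.mem ψ) θ hθ i]
  have : a ψ i - H ≤ min (a ψ' i) (b ψ' i) :=
    le_min (sub_le _ (ha.mem ψ')) (sub_le _ (hb.mem ψ'))
  linarith [min_le_left (a ψ i) (b ψ i)]

theorem integral_abs_sub_le (hη : 0 < η) (ha : IsPerturbedLeader Θ g a)
    (hb : IsPerturbedLeader Θ g' b) (hH : ∀ θ ∈ Θ, ∀ θ' ∈ Θ, ∀ k, |θ k - θ' k| ≤ H) (hd : 0 ≤ d)
    (hc : 0 < c) (hg : L1LipschitzOn d (fun θ => g' θ - g θ) Θ) (i : ι) :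
    ∫ ψ, |a ψ i - b ψ i| ∂(Measure.pi fun _ : ι => expMeasure η) ≤
      η * c * H + d * (Fintype.card ι * H) / c := by
  classical
  have := isProbabilityMeasure_pi_expMeasure (ι := ι) hη
  set P := Measure.pi fun _ : ι => expMeasure η
  set R := d * (Fintype.card ι * H) / c
  have hmax : Integrable (fun ψ => max (a ψ i) (b ψ i)) P :=
    (ha.integrable_coord hH i P).sup (hb.integrable_coord hH i P)
  have hmin : Integrable (fun ψ => min (a ψ i) (b ψ i)) P :=
    (ha.integrable_coord hH i P).inf (hb.integrable_coord hH i P)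
  have min_meas : Measurable fun ψ => min (a ψ i) (b ψ i) :=
    ((measurable_pi_apply i).comp ha.measurable).min ((measurable_pi_apply i).comp hb.measurable)
  have hu : Measurable fun ψ : ι → ℝ => Function.update ψ i (ψ i + c) := by fun_prop
  have hmin_update : Integrable (fun ψ => min (a (Function.update ψ i (ψ i + c)) i)
      (b (Function.update ψ i (ψ i + c)) i)) P :=
    integrable_of_sub_le (min_meas.comp hu) (fun _ _ => ha.min_coord_sub_le hb hH _ _ i) P
  calc ∫ ψ, |a ψ i - b ψ i| ∂P
      = ∫ ψ, max (a ψ i) (b ψ i) ∂P - ∫ ψ, min (a ψ i) (b ψ i) ∂P := by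
        rw [← integral_sub hmax hmin]
        simp only [max_sub_min_eq_abs']
    _ ≤ ∫ ψ, (min (a (Function.update ψ i (ψ i + c)) i) (b (Function.update ψ i (ψ i + c)) i)
          + R) ∂P - ∫ ψ, min (a ψ i) (b ψ i) ∂P := by
        exact sub_le_sub_right (integral_mono hmax (hmin_update.add (integrable_const R))
          fun ψ => ha.max_coord_le_min_coord_update hb hH hd hc hg ψ i) _
    _ ≤ η * c * H + R := by
        have shift_le := integral_update_add_pi_expMeasure_le hη hc.le i min_meas
          fun ψ ψ' => ha.min_coord_sub_le hb hH ψ ψ' i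
        have integral_add_R := integral_add hmin_update (integrable_const R)
        simp only [integral_const, probReal_univ, one_smul] at integral_add_R
        linarith

theorem integrable_comp (ha : IsPerturbedLeader Θ g a) (hf : Measurable f) (hG : 0 ≤ G)
    (hlip : L1LipschitzOn G f Θ) (hH : ∀ θ ∈ Θ, ∀ θ' ∈ Θ, ∀ k, |θ k - θ' k| ≤ H)
    (μ : Measure (ι → ℝ)) [IsFiniteMeasure μ] : Integrable (fun ψ => f (a ψ)) μ :=
  integrable_of_sub_le (hf.comp ha.measurable)
    (fun ψ ψ' => hlip.sub_le hG hH (ha.mem ψ) (ha.mem ψ')) μ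

theorem integral_comp_le_add_of_mem (ha : IsPerturbedLeader Θ g a) (hf : Measurable f)
    (hG : 0 ≤ G) (hlip : L1LipschitzOn G f Θ) (hH : ∀ θ ∈ Θ, ∀ θ' ∈ Θ, ∀ k, |θ k - θ' k| ≤ H)
    (hb : Measurable b) (hb_mem : ∀ ψ, b ψ ∈ Θ) (μ : Measure (ι → ℝ)) [IsProbabilityMeasure μ] :
    ∫ ψ, f (b ψ) ∂μ ≤ ∫ ψ, f (a ψ) ∂μ + G * (Fintype.card ι * H) := by
  have hfa := ha.integrable_comp hf hG hlip hH μ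
  have hfb := integrable_of_sub_le (hf.comp hb)
    (fun ψ ψ' => hlip.sub_le hG hH (hb_mem ψ) (hb_mem ψ')) μ
  calc ∫ ψ, f (b ψ) ∂μ ≤ ∫ ψ, (f (a ψ) + G * (Fintype.card ι * H)) ∂μ :=
        integral_mono hfb (hfa.add (integrable_const _)) fun ψ =>
          sub_le_iff_le_add'.1 (hlip.sub_le hG hH (hb_mem ψ) (ha.mem ψ))
    _ = ∫ ψ, f (a ψ) ∂μ + G * (Fintype.card ι * H) := by
        rw [integral_add hfa (integrable_const _), integral_const, probReal_univ, one_smul]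

theorem integral_comp_le (hη : 0 < η) (ha : IsPerturbedLeader Θ g a)
    (hb : IsPerturbedLeader Θ g' b) (hH : ∀ θ ∈ Θ, ∀ θ' ∈ Θ, ∀ k, |θ k - θ' k| ≤ H) (hd : 0 ≤ d)
    (hc : 0 < c) (hg : L1LipschitzOn d (fun θ => g' θ - g θ) Θ) (hf : Measurable f) (hG : 0 ≤ G)
    (hlip : L1LipschitzOn G f Θ) :
    ∫ ψ, f (a ψ) ∂(Measure.pi fun _ : ι => expMeasure η) ≤
      ∫ ψ, f (b ψ) ∂(Measure.pi fun _ : ι => expMeasure η) +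
        G * (Fintype.card ι * (η * c * H + d * (Fintype.card ι * H) / c)) := by
  have := isProbabilityMeasure_pi_expMeasure (ι := ι) hη
  set P := Measure.pi fun _ : ι => expMeasure η
  have hfb := hb.integrable_comp hf hG hlip hH P
  have hdist : ∀ k, Integrable (fun ψ => |a ψ k - b ψ k|) P := fun k =>
    ((ha.integrable_coord hH k P).sub (hb.integrable_coord hH k P)).abs
  have hsum : Integrable (fun ψ => G * ∑ k, |a ψ k - b ψ k|) P :=
    (integrable_finsetSum _ fun k _ => hdist k).const_mul G
  calc ∫ ψ, f (a ψ) ∂P ≤ ∫ ψ, (f (b ψ) + G * ∑ k, |a ψ k - b ψ k|) ∂P :=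
        integral_mono (ha.integrable_comp hf hG hlip hH P) (hfb.add hsum) fun ψ =>
          sub_le_iff_le_add'.1 ((le_abs_self _).trans (hlip _ (ha.mem ψ) _ (hb.mem ψ)))
    _ = ∫ ψ, f (b ψ) ∂P + G * ∑ k, ∫ ψ, |a ψ k - b ψ k| ∂P := by
        rw [integral_add hfb hsum, integral_const_mul, integral_finsetSum _ fun k _ => hdist k]
    _ ≤ ∫ ψ, f (b ψ) ∂P +
        G * ∑ _k : ι, (η * c * H + d * (Fintype.card ι * H) / c) := by
        gcongr with k
        exact ha.integral_abs_sub_le hη hb hH hd hc hg k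
    _ = _ := by rw [sum_const, card_univ, nsmul_eq_mul]

end IsPerturbedLeader

section Regret

variable {f : ℕ → (ι → ℝ) → ℝ} {a : ℕ → (ι → ℝ) → ι → ℝ}

theorem L1LipschitzOn.runningMean_succ (hf : ∀ t, L1LipschitzOn G (f t) Θ) (n : ℕ) :
    L1LipschitzOn G (runningMean f (n + 1)) Θ := by
  have h := (L1LipschitzOn.sum_range hf (n + 1)).const_mul (1 / ((n + 1 : ℕ) : ℝ))
  rwa [abs_of_pos (by positivity), ← mul_assoc, one_div_mul_cancel (by positivity), one_mul] at h

theorem L1LipschitzOn.runningMean_succ_sub (hf : ∀ t, L1LipschitzOn G (f t) Θ) (n : ℕ) :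
    L1LipschitzOn (2 * G / (n + 2))
      (fun θ => runningMean f (n + 2) θ - runningMean f (n + 1) θ) Θ := by
  have h := ((hf (n + 1)).sub (runningMean_succ hf n)).const_mul (1 / ((n : ℝ) + 2))
  simp only [_root_.runningMean_succ_sub]
  rwa [abs_of_pos (by positivity), ← two_mul, one_div_mul_eq_div] at h

namespace IsPerturbedLeader

-- Shifting by `1 / √(η (t + 2))` balances the two terms of `integral_abs_sub_le`.
theorem integral_comp_le_integral_comp_succ (hη : 0 < η) (hG : 0 ≤ G)
    (hf : ∀ t, Measurable (f t)) (hlip : ∀ t, L1LipschitzOn G (f t) Θ)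
    (hH : ∀ θ ∈ Θ, ∀ θ' ∈ Θ, ∀ k, |θ k - θ' k| ≤ H)
    (ha : ∀ n, IsPerturbedLeader Θ (runningMean f (n + 1)) (a (n + 1))) (t : ℕ) :
    ∫ ψ, f (t + 1) (a (t + 1) ψ) ∂(Measure.pi fun _ : ι => expMeasure η) ≤
      ∫ ψ, f (t + 1) (a (t + 2) ψ) ∂(Measure.pi fun _ : ι => expMeasure η) +
        G * Fintype.card ι * (1 + 2 * G * Fintype.card ι) * H * √η * (1 / √((t : ℝ) + 2)) := by
  refine ((ha t).integral_comp_le hη (ha (t + 1)) hH (by positivity)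
    (c := 1 / (√η * √((t : ℝ) + 2))) (by positivity) (L1LipschitzOn.runningMean_succ_sub hlip t)
    (hf (t + 1)) hG (hlip (t + 1))).trans_eq ?_
  have sq_sqrt_η : √η ^ 2 = η := Real.sq_sqrt hη.le
  have sq_sqrt_t : √((t : ℝ) + 2) ^ 2 = t + 2 := Real.sq_sqrt (by positivity)
  have sqrt_η_ne : √η ≠ 0 := (Real.sqrt_pos.2 hη).ne'
  have sqrt_t_ne : √((t : ℝ) + 2) ≠ 0 := (Real.sqrt_pos.2 (by positivity)).ne'
  have : (t : ℝ) + 2 ≠ 0 := by positivity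
  congr 1
  field_simp
  rw [sq_sqrt_η, sq_sqrt_t]
  ring

theorem sum_comp_succ_le (hH : ∀ θ ∈ Θ, ∀ θ' ∈ Θ, ∀ k, |θ k - θ' k| ≤ H)
    (ha : ∀ n, IsPerturbedLeader Θ (runningMean f (n + 1)) (a (n + 1))) (n : ℕ) {θ : ι → ℝ}
    (hθ : θ ∈ Θ) (ψ : ι → ℝ) :
    ∑ t ∈ range n, f t (a (t + 1) ψ) ≤ ∑ t ∈ range n, f t θ + n * (H * ∑ k, |ψ k|) := by
  have leader : ∑ t ∈ range n, (f t (a (t + 1) ψ) - ∑ k, ψ k * a (t + 1) ψ k) ≤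
      ∑ t ∈ range n, (f t θ - ∑ k, ψ k * θ k) := by
    refine sum_range_le_of_forall_isMinOn (a := fun t => a t ψ)
      (h := fun t θ => f t θ - ∑ k, ψ k * θ k) (fun k => (ha k).mem ψ) (fun m θ' hθ' => ?_) n hθ
    have := mul_le_mul_of_nonneg_left ((ha m).le ψ θ' hθ') (by positivity : (0 : ℝ) ≤ m + 1)
    simpa [mul_sub, succ_mul_runningMean] using this
  have perturbation_le : ∀ t, ∑ k, ψ k * a (t + 1) ψ k ≤ ∑ k, ψ k * θ k + H * ∑ k, |ψ k| := by
    intro t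
    rw [mul_sum, ← sum_add_distrib]
    refine sum_le_sum fun k _ => ?_
    rw [← sub_le_iff_le_add', ← mul_sub]
    calc ψ k * (a (t + 1) ψ k - θ k) ≤ |a (t + 1) ψ k - θ k| * |ψ k| := by
          rw [← abs_mul, mul_comm]
          exact le_abs_self _
      _ ≤ H * |ψ k| := by
          gcongr
          exact hH _ ((ha t).mem ψ) θ hθ k
  have sum_perturbation_le := sum_le_sum fun t (_ : t ∈ range n) => perturbation_le t
  simp only [sum_sub_distrib, sum_add_distrib, sum_const, card_range, nsmul_eq_mul] at *
  linarith

theorem sum_integral_comp_succ_le (hη : 0 < η) (hG : 0 ≤ G) (hf : ∀ t, Measurable (f t))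
    (hlip : ∀ t, L1LipschitzOn G (f t) Θ) (hH : ∀ θ ∈ Θ, ∀ θ' ∈ Θ, ∀ k, |θ k - θ' k| ≤ H)
    (ha : ∀ n, IsPerturbedLeader Θ (runningMean f (n + 1)) (a (n + 1))) (n : ℕ) {θ : ι → ℝ}
    (hθ : θ ∈ Θ) :
    ∑ t ∈ range n, ∫ ψ, f t (a (t + 1) ψ) ∂(Measure.pi fun _ : ι => expMeasure η) ≤
      ∑ t ∈ range n, f t θ + n * (Fintype.card ι * H / η) := by
  have := isProbabilityMeasure_pi_expMeasure (ι := ι) hη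
  set P := Measure.pi fun _ : ι => expMeasure η
  have hfa : ∀ t ∈ range n, Integrable (fun ψ => f t (a (t + 1) ψ)) P := fun t _ =>
    (ha t).integrable_comp (hf t) hG (hlip t) hH P
  have habs : ∀ k ∈ (univ : Finset ι), Integrable (fun ψ => |ψ k|) P := fun k _ =>
    integrable_abs_eval_pi_expMeasure hη k
  have hpert : Integrable (fun ψ => (n : ℝ) * (H * ∑ k, |ψ k|)) P :=
    ((integrable_finsetSum _ habs).const_mul H).const_mul (n : ℝ)
  calc ∑ t ∈ range n, ∫ ψ, f t (a (t + 1) ψ) ∂P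
      = ∫ ψ, ∑ t ∈ range n, f t (a (t + 1) ψ) ∂P := (integral_finsetSum _ hfa).symm
    _ ≤ ∫ ψ, (∑ t ∈ range n, f t θ + n * (H * ∑ k, |ψ k|)) ∂P :=
        integral_mono (integrable_finsetSum _ hfa) ((integrable_const _).add hpert)
          (sum_comp_succ_le hH ha n hθ)
    _ = ∑ t ∈ range n, f t θ + n * (H * ∑ k, ∫ ψ, |ψ k| ∂P) := by
        rw [integral_add (integrable_const _) hpert, integral_const_mul, integral_const_mul,
          integral_finsetSum _ habs, integral_const, probReal_univ, one_smul]
    _ = ∑ t ∈ range n, f t θ + n * (Fintype.card ι * H / η) := by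
        simp only [P, integral_abs_eval_pi_expMeasure hη, sum_const, card_univ, nsmul_eq_mul]
        ring

theorem regret_le (hη : 0 < η) (hG : 0 ≤ G) (hH₀ : 0 ≤ H) (hf : ∀ t, Measurable (f t))
    (hlip : ∀ t, L1LipschitzOn G (f t) Θ) (hH : ∀ θ ∈ Θ, ∀ θ' ∈ Θ, ∀ k, |θ k - θ' k| ≤ H)
    (ha₀ : Measurable (a 0)) (ha₀_mem : ∀ ψ, a 0 ψ ∈ Θ)
    (ha : ∀ n, IsPerturbedLeader Θ (runningMean f (n + 1)) (a (n + 1))) (n : ℕ) {θ : ι → ℝ}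
    (hθ : θ ∈ Θ) :
    ∑ t ∈ range n, ∫ ψ, f t (a t ψ) ∂(Measure.pi fun _ : ι => expMeasure η) ≤
      ∑ t ∈ range n, f t θ + n * (Fintype.card ι * H / η) + G * (Fintype.card ι * H) +
        G * Fintype.card ι * (1 + 2 * G * Fintype.card ι) * H * √η * (2 * √n) := by
  have := isProbabilityMeasure_pi_expMeasure (ι := ι) hη
  set P := Measure.pi fun _ : ι => expMeasure η
  set A := G * Fintype.card ι * (1 + 2 * G * Fintype.card ι) * H * √η
  have stability : ∀ t, ∫ ψ, f t (a t ψ) ∂P ≤ ∫ ψ, f t (a (t + 1) ψ) ∂P +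
      ((if t = 0 then G * (Fintype.card ι * H) else 0) + A * (1 / √((t : ℝ) + 1))) := by
    rintro (_ | t)
    · have first_round := (ha 0).integral_comp_le_add_of_mem (hf 0) hG (hlip 0) hH ha₀ ha₀_mem P
      have : 0 ≤ A * (1 / √(((0 : ℕ) : ℝ) + 1)) := by positivity
      rw [if_pos rfl]
      linarith
    · have h := integral_comp_le_integral_comp_succ hη hG hf hlip hH ha t
      rw [if_neg t.succ_ne_zero, zero_add]
      convert h using 4
      push_cast
      ring_nf
  calc ∑ t ∈ range n, ∫ ψ, f t (a t ψ) ∂P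
      ≤ ∑ t ∈ range n, (∫ ψ, f t (a (t + 1) ψ) ∂P +
          ((if t = 0 then G * (Fintype.card ι * H) else 0) + A * (1 / √((t : ℝ) + 1)))) :=
        sum_le_sum fun t _ => stability t
    _ = ∑ t ∈ range n, ∫ ψ, f t (a (t + 1) ψ) ∂P +
          ((∑ t ∈ range n, if t = 0 then G * (Fintype.card ι * H) else 0) +
            A * ∑ t ∈ range n, 1 / √((t : ℝ) + 1)) := by
        rw [sum_add_distrib, sum_add_distrib, mul_sum]
    _ ≤ (∑ t ∈ range n, f t θ + n * (Fintype.card ι * H / η)) +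
          (G * (Fintype.card ι * H) + A * (2 * √n)) := by
        gcongr
        · exact sum_integral_comp_succ_le hη hG hf hlip hH ha n hθ
        · rw [sum_ite_eq']
          split_ifs
          · exact le_rfl
          · positivity
        · exact sum_one_div_sqrt_le n
    _ = _ := by ring

end IsPerturbedLeader

end Regret

end PerturbedLeader

/-! ## The network and the training run -/

section Network

variable {N M E : ℕ} {ξ : EuclideanSpace ℝ (Fin E) → EuclideanSpace ℝ (Fin E)}

theorem Params.act_apply (θ : Params E) (i : Fin 3) (v : EuclideanSpace ℝ (Fin E)) :
    θ.act i v = WithLp.toLp 2 fun a => ∑ b, θ (Sum.inl (i, a, b)) * v b := by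
  ext a
  simp [Params.act, Params.Z, Matrix.ofLp_toEuclideanCLM, Matrix.mulVec, dotProduct]

theorem Params.continuous_act (i : Fin 3) : Continuous fun θ : Params E => θ.act i := by
  have continuous_Z : Continuous fun θ : Params E => θ.Z i :=
    continuous_matrix fun _ _ => continuous_apply _
  exact (LinearMap.continuous_of_finiteDimensional
    (Matrix.toEuclideanCLM (n := Fin E) (𝕜 := ℝ)).toAlgEquiv.toLinearMap).comp continuous_Z

theorem Params.continuous_β : Continuous (Params.β : Params E → _) :=
  (PiLp.continuous_toLp 2 _).comp (by fun_prop)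

theorem Params.measurable_act {X : Type*} [MeasurableSpace X] {θ : X → Params E}
    {v : X → EuclideanSpace ℝ (Fin E)} (hθ : Measurable θ) (hv : Measurable v) (i : Fin 3) :
    Measurable fun x => (θ x).act i (v x) := by
  simp only [Params.act_apply]
  fun_prop

theorem Bounds.measurableSet_paramSet (c : Bounds) (E : ℕ) : MeasurableSet (c.paramSet E) := by
  simp only [Bounds.paramSet, Set.ofPred_and, Set.ofPred_forall]
  exact (MeasurableSet.iInter fun i =>
    measurableSet_le (Params.continuous_act i).norm.measurable measurable_const).inter
      (measurableSet_le Params.continuous_β.norm.measurable measurable_const)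

theorem Bounds.measurableSet_admissible (c : Bounds) :
    MeasurableSet {φ : Features N M E | c.Admissible φ} := by
  simp only [Bounds.Admissible, Set.ofPred_and, Set.ofPred_forall]
  refine MeasurableSet.inter ?_ ?_
  · refine MeasurableSet.iInter fun u => measurableSet_le ?_ measurable_const
    fun_prop
  · refine MeasurableSet.iInter fun n => MeasurableSet.iInter fun m =>
      measurableSet_le ?_ measurable_const
    fun_prop

theorem measurable_embed (hξ : Measurable ξ) (d : ℕ) (u : Fin N ⊕ Fin M) :
    Measurable fun q : Params E × Features N M E => embed ξ q.1 q.2 d u := by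
  induction d generalizing u with
  | zero => exact (measurable_pi_apply u).comp (measurable_fst.comp measurable_snd)
  | succ d ih =>
    have edge : ∀ n m, Measurable fun q : Params E × Features N M E => q.2.2 n m := by fun_prop
    refine hξ.comp ((Params.measurable_act measurable_fst (ih u) 0).add ?_)
    rcases u with n | m
    · exact Finset.measurable_sum _ fun m _ => hξ.comp
        ((Params.measurable_act measurable_fst (ih _) 1).add
          (Params.measurable_act measurable_fst (edge n m) 2))
    · exact Finset.measurable_sum _ fun n _ => hξ.comp
        ((Params.measurable_act measurable_fst (ih _) 1).add
          (Params.measurable_act measurable_fst (edge n m) 2))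

theorem measurable_gnn (hξ : Measurable ξ) (d : ℕ) :
    Measurable fun q : Params E × Features N M E => gnn ξ d q.1 q.2 :=
  (Finset.measurable_sum _ fun u _ => continuous_sigmoid.measurable.comp
    ((Params.continuous_β.measurable.comp measurable_fst).inner
      (measurable_embed hξ d u))).const_mul _

theorem gnn_mem_Ioo (hN : 0 < N) (d : ℕ) (θ : Params E) (φ : Features N M E) :
    gnn ξ d θ φ ∈ Set.Ioo (0 : ℝ) 1 := by
  have : Nonempty (Fin N ⊕ Fin M) := ⟨Sum.inl ⟨0, hN⟩⟩
  have hU : (0 : ℝ) < N + M := by positivity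
  constructor
  · exact mul_pos (by positivity) (sum_pos (fun u _ => Real.sigmoid_pos _) univ_nonempty)
  · rw [gnn, one_div, inv_mul_lt_iff₀ hU, mul_one]
    calc _ < ∑ _u : Fin N ⊕ Fin M, (1 : ℝ) :=
          sum_lt_sum_of_nonempty univ_nonempty fun u _ => Real.sigmoid_lt_one _
      _ = N + M := by simp

end Network

namespace Training

variable {N M E J : ℕ} {Z : Type*} {T : Training N M E J Z}

theorem run_congr {x x' : ℕ → (Fin J → Z) × Params E} {i : ℕ} (h : ∀ k < i, x k = x' k) :
    T.run x i = T.run x' i := by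
  induction i with
  | zero => rfl
  | succ i ih =>
    have previous := ih fun k hk => h k (hk.trans i.lt_succ_self)
    simp only [run, previous, h i i.lt_succ_self]

theorem data_apply (x : ℕ → (Fin J → Z) × Params E) (n : ℕ) (t : Fin n) :
    T.data x n t = fun j => T.gen t (T.param x t) ((x t).1 j) := by
  induction n with
  | zero => exact t.elim0
  | succ n ih =>
    refine Fin.lastCases ?_ (fun t => ?_) t
    · simp [data, run, param]
    · rw [Fin.val_castSucc, ← ih]
      simp [data, run]

/-- Average loss of the parameter `θ` on a batch. -/
noncomputable def batchLoss (T : Training N M E J Z) (D : Fin J → Sample N M E)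
    (θ : Params E) : ℝ :=
  1 / (J : ℝ) * ∑ j, T.sampleLoss θ (D j)

/-- The batch collected in round `i` (counted from `0`). -/
def batch (T : Training N M E J Z) (x : ℕ → (Fin J → Z) × Params E) (i : ℕ) :
    Fin J → Sample N M E :=
  fun j => T.gen i (T.param x i) ((x i).1 j)

theorem g_data_eq (x : ℕ → (Fin J → Z) × Params E) (n : ℕ) (θ : Params E) :
    T.g (T.data x n) θ = runningMean (fun t => T.batchLoss (T.batch x t)) n θ := by
  simp only [g, runningMean, data_apply, ← Fin.sum_univ_eq_sum_range]
  rfl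

variable [MeasurableSpace Z]

/-- What the analysis of the training procedure needs: a bounded measurable loss that is
Lipschitz on every batch in the `ℓ₁` norm, for parameters in `Θ` and features in `F`, a bound `H`
on the coordinatewise diameter of `Θ`, and a measurable exact optimizer. -/
structure Regular (T : Training N M E J Z) (Θ : Set (Params E)) (F : Set (Features N M E))
    (B G H : ℝ≥0) : Prop where
  measurableSet_params : MeasurableSet Θ
  measurableSet_features : MeasurableSet F
  measurable_ξ : Measurable T.ξ
  measurable_loss : ∀ y, Measurable fun x => T.loss x y
  abs_sampleLoss_le : ∀ θ ∈ Θ, ∀ s : Sample N M E, s.1 ∈ F → |T.sampleLoss θ s| ≤ B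
  batchLoss_lip : ∀ D : Fin J → Sample N M E, (∀ j, (D j).1 ∈ F) →
    L1LipschitzOn G (T.batchLoss D) Θ
  diam : ∀ θ ∈ Θ, ∀ θ' ∈ Θ, ∀ a, |θ a - θ' a| ≤ H
  measurable_uncurry_gen : ∀ i, Measurable fun q : Params E × Z => T.gen i q.1 q.2
  gen_mem : ∀ i, ∀ θ ∈ Θ, ∀ z, (T.gen i θ z).1 ∈ F
  init_mem : T.θinit ∈ Θ
  measurable_uncurry_argmin : ∀ i,
    Measurable fun q : Batches N M E J i × Params E => T.argmin i q.1 q.2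
  isPerturbedLeader_argmin : ∀ i (D : Batches N M E J i), (∀ t j, (D t j).1 ∈ F) →
    IsPerturbedLeader Θ (T.g D) (T.argmin i D)

namespace Assumptions

variable {c : Bounds} {I : ℕ} {G H : ℝ}

theorem measurable_ξ (hT : T.Assumptions c I G H) : Measurable T.ξ :=
  (LipschitzWith.of_dist_le_mul (K := ⟨c.Cξ, hT.Cξ_nonneg⟩) fun a b => by
    rw [dist_eq_norm, dist_eq_norm]
    exact hT.ξ_lip a b).continuous.measurable

theorem BL_nonneg (hT : T.Assumptions c I G H) : 0 ≤ c.BL :=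
  (abs_nonneg _).trans (hT.loss_bound _ hT.init_mem (0, true)
    ⟨fun _ => by simpa using hT.Bx_nonneg, fun _ _ => by simpa using hT.Bx_nonneg⟩)

-- A single batch is the case `i = 1` of the hypothesis on the aggregated losses.
theorem regular (hI : 0 < I) (hT : T.Assumptions c I G H) :
    T.Regular (c.paramSet E) {φ | c.Admissible φ} ⟨c.BL, hT.BL_nonneg⟩ (Real.nnabs G)
      (Real.nnabs H) where
  measurableSet_params := c.measurableSet_paramSet E
  measurableSet_features := c.measurableSet_admissible
  measurable_ξ := hT.measurable_ξ
  measurable_loss := hT.loss_meas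
  abs_sampleLoss_le := hT.loss_bound
  batchLoss_lip D hD θ hθ θ' hθ' := by
    have lip := hT.g_lip 1 le_rfl hI (fun _ => D) (fun _ => hD) θ hθ θ' hθ'
    simp only [g, univ_unique, sum_singleton, Nat.cast_one, div_one, one_mul] at lip
    exact lip.trans (mul_le_mul_of_nonneg_right (le_abs_self G)
      (sum_nonneg fun _ _ => abs_nonneg _))
  diam θ hθ θ' hθ' a := (hT.diam θ hθ θ' hθ' a).trans (le_abs_self H)
  measurable_uncurry_gen := hT.gen_meas
  gen_mem := hT.gen_adm
  init_mem := hT.init_mem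
  measurable_uncurry_argmin := hT.argmin_meas
  isPerturbedLeader_argmin i D hD :=
    { measurable := (hT.argmin_meas i).comp measurable_prodMk_left
      mem := fun ψ => hT.argmin_mem i D ψ hD
      le := fun ψ => hT.argmin_min i D ψ hD }

end Assumptions

namespace Regular

variable {Θ : Set (Params E)} {F : Set (Features N M E)} {B G H : ℝ≥0}

theorem measurable_uncurry_sampleLoss (hT : T.Regular Θ F B G H) :
    Measurable fun q : Params E × Sample N M E => T.sampleLoss q.1 q.2 := by
  have measurable_uncurry_loss : Measurable (Function.uncurry T.loss) :=
    measurable_from_prod_countable_left hT.measurable_loss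
  exact measurable_uncurry_loss.comp (((measurable_gnn hT.measurable_ξ T.depth).comp
    (measurable_fst.prodMk measurable_snd.fst)).prodMk measurable_snd.snd)

theorem measurable_gen (hT : T.Regular Θ F B G H) (i : ℕ) (θ : Params E) :
    Measurable (T.gen i θ) :=
  (hT.measurable_uncurry_gen i).comp measurable_prodMk_left

theorem measurable_run (hT : T.Regular Θ F B G H) (i : ℕ) :
    Measurable fun x : ℕ → (Fin J → Z) × Params E => T.run x i := by
  induction i using Nat.strong_induction_on with
  | _ i ih =>
    have measurable_data : Measurable fun x => T.data x i := by
      simp only [measurable_pi_iff, data_apply]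
      intro t j
      have measurable_instance : Measurable fun x : ℕ → (Fin J → Z) × Params E => (x t).1 j := by
        fun_prop
      exact (hT.measurable_uncurry_gen t).comp ((ih t t.2).snd.prodMk measurable_instance)
    cases i with
    | zero => exact measurable_const
    | succ i =>
      have measurable_perturbation : Measurable fun x : ℕ → (Fin J → Z) × Params E => (x i).2 := by
        fun_prop
      exact measurable_data.prodMk ((hT.measurable_uncurry_argmin (i + 1)).comp
        (measurable_data.prodMk measurable_perturbation))

theorem measurable_param (hT : T.Regular Θ F B G H) (i : ℕ) :
    Measurable fun x : ℕ → (Fin J → Z) × Params E => T.param x i :=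
  (hT.measurable_run i).snd

theorem param_mem (hT : T.Regular Θ F B G H) (x : ℕ → (Fin J → Z) × Params E) (i : ℕ) :
    T.param x i ∈ Θ := by
  induction i using Nat.strong_induction_on with
  | _ i ih =>
    cases i with
    | zero => exact hT.init_mem
    | succ i =>
      refine (hT.isPerturbedLeader_argmin (i + 1) (T.data x (i + 1)) fun t j => ?_).mem _
      rw [data_apply]
      exact hT.gen_mem _ _ (ih t t.2) _

theorem batch_mem (hT : T.Regular Θ F B G H) (x : ℕ → (Fin J → Z) × Params E) (i : ℕ)
    (j : Fin J) : (T.batch x i j).1 ∈ F :=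
  hT.gen_mem i _ (hT.param_mem x i) _

theorem isProbabilityMeasure_sampleLaw (hT : T.Regular Θ F B G H) (μ : Measure Z)
    [IsProbabilityMeasure μ] (x : ℕ → (Fin J → Z) × Params E) (i : ℕ) :
    IsProbabilityMeasure (T.sampleLaw μ x i) :=
  Measure.isProbabilityMeasure_map (hT.measurable_gen i _).aemeasurable

end Regular

end Training

/-! ## Concentration -/

section SubgaussianSum

theorem hasSubgaussianMGF_add_prod {Ω A : Type*} [MeasurableSpace Ω] [MeasurableSpace A]
    {μ : Measure Ω} {ν : Measure A} [SFinite μ] [SFinite ν] {X : Ω → ℝ} {Y : Ω → A → ℝ}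
    {cX cY : ℝ≥0} (hX : HasSubgaussianMGF X cX μ)
    (hY_meas : Measurable fun q : Ω × A => Y q.1 q.2)
    (hY : ∀ x, HasSubgaussianMGF (Y x) cY ν) :
    HasSubgaussianMGF (fun q : Ω × A => X q.1 + Y q.1 q.2) (cX + cY) (μ.prod ν) := by
  have exp_mul_add : ∀ t x a, Real.exp (t * (X x + Y x a)) =
      Real.exp (t * X x) * Real.exp (t * Y x a) := fun t x a => by rw [mul_add, Real.exp_add]
  have inner_le : ∀ t x, ∫ a, Real.exp (t * (X x + Y x a)) ∂ν ≤
      Real.exp (t * X x) * Real.exp (cY * t ^ 2 / 2) := fun t x => by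
    simp only [exp_mul_add, integral_const_mul]
    exact mul_le_mul_of_nonneg_left ((hY x).mgf_le t) (Real.exp_pos _).le
  have hXY : ∀ t, Integrable (fun q : Ω × A => Real.exp (t * (X q.1 + Y q.1 q.2))) (μ.prod ν) := by
    intro t
    have meas : AEStronglyMeasurable (fun q : Ω × A => Real.exp (t * (X q.1 + Y q.1 q.2)))
        (μ.prod ν) := (((hX.aemeasurable.comp_fst).add hY_meas.aemeasurable).const_mul
          t).exp.aestronglyMeasurable
    refine (integrable_prod_iff meas).2 ⟨.of_forall fun x => ?_, ?_⟩
    · simpa only [exp_mul_add] using ((hY x).integrable_exp_mul t).const_mul _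
    · simp only [Real.norm_eq_abs, Real.abs_exp]
      refine ((hX.integrable_exp_mul t).mul_const (Real.exp (cY * t ^ 2 / 2))).mono'
        (by simpa using meas.norm.integral_prod_right') (.of_forall fun x => ?_)
      rw [Real.norm_of_nonneg (integral_nonneg fun a => (Real.exp_pos _).le)]
      exact inner_le t x
  refine ⟨hXY, fun t => ?_⟩
  calc mgf (fun q : Ω × A => X q.1 + Y q.1 q.2) (μ.prod ν) t
      = ∫ x, ∫ a, Real.exp (t * (X x + Y x a)) ∂ν ∂μ := integral_prod _ (hXY t)
    _ ≤ ∫ x, Real.exp (t * X x) * Real.exp (cY * t ^ 2 / 2) ∂μ :=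
        integral_mono (hXY t).integral_prod_left ((hX.integrable_exp_mul t).mul_const _)
          (inner_le t)
    _ ≤ Real.exp ((cX + cY : ℝ≥0) * t ^ 2 / 2) := by
        rw [integral_mul_const, NNReal.coe_add, add_mul, add_div, Real.exp_add]
        exact mul_le_mul_of_nonneg_right (hX.mgf_le t) (Real.exp_pos _).le

theorem hasSubgaussianMGF_sum_infinitePi {A : ℕ → Type*} [∀ n, MeasurableSpace (A n)]
    (ν : ∀ n, Measure (A n)) [∀ n, IsProbabilityMeasure (ν n)]
    {F : ∀ n, (∀ k, A k) → A n → ℝ} {c : ℕ → ℝ≥0}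
    (hF : ∀ n, Measurable fun q : (∀ k, A k) × A n => F n q.1 q.2)
    (hdep : ∀ n x x', (∀ k < n, x k = x' k) → F n x = F n x')
    (hsub : ∀ n x, HasSubgaussianMGF (F n x) (c n) (ν n)) (n : ℕ) :
    HasSubgaussianMGF (fun x => ∑ i ∈ range n, F i x (x i)) (∑ i ∈ range n, c i)
      (Measure.infinitePi ν) := by
  induction n with
  | zero => simp
  | succ n ih =>
    have resample : MeasurePreserving (fun q : (∀ k, A k) × A n => Function.update q.1 n q.2)
        ((Measure.infinitePi ν).prod (ν n)) (Measure.infinitePi ν) :=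
      ⟨measurable_update', map_update_infinitePi_prod ν n⟩
    have hS : Measurable fun x : ∀ k, A k => ∑ i ∈ range (n + 1), F i x (x i) :=
      Finset.measurable_sum _ fun i _ =>
        (hF i).comp (measurable_id.prodMk (measurable_pi_apply i))
    have update_agrees : ∀ (x : ∀ k, A k) (a : A n), ∀ k < n, Function.update x n a k = x k :=
      fun x a k hk => Function.update_of_ne hk.ne _ _
    have sum_update : ∀ (x : ∀ k, A k) (a : A n), ∑ i ∈ range (n + 1), F i (Function.update x n a)
        (Function.update x n a i) = ∑ i ∈ range n, F i x (x i) + F n x a := fun x a => by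
      rw [sum_range_succ, hdep n _ x (update_agrees x a), Function.update_self]
      refine congrArg (· + _) (sum_congr rfl fun i hi => ?_)
      have hi := mem_range.1 hi
      rw [hdep i _ x fun k hk => update_agrees x a k (hk.trans hi), update_agrees x a i hi]
    have identDistrib : IdentDistrib
        (fun q : (∀ k, A k) × A n => ∑ i ∈ range n, F i q.1 (q.1 i) + F n q.1 q.2)
        (fun x => ∑ i ∈ range (n + 1), F i x (x i))
        ((Measure.infinitePi ν).prod (ν n)) (Measure.infinitePi ν) := by
      have resample_id : IdentDistrib (fun q : (∀ k, A k) × A n => Function.update q.1 n q.2) id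
          ((Measure.infinitePi ν).prod (ν n)) (Measure.infinitePi ν) :=
        ⟨resample.aemeasurable, aemeasurable_id, by rw [resample.map_eq, Measure.map_id]⟩
      simp only [← sum_update]
      exact resample_id.comp hS
    rw [sum_range_succ]
    exact (hasSubgaussianMGF_add_prod ih (hF n) (hsub n)).congr_identDistrib identDistrib

theorem measure_sqrt_lt_le_of_hasSubgaussianMGF {Ω : Type*} [MeasurableSpace Ω] {μ : Measure Ω}
    [IsFiniteMeasure μ] {X : Ω → ℝ} {c : ℝ≥0} (hX : HasSubgaussianMGF X c μ) {s : ℝ}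
    (hs : 0 ≤ s) : μ {ω | √(2 * c * s) < X ω} ≤ ENNReal.ofReal (Real.exp (-s)) := by
  rcases eq_or_ne c 0 with rfl | hc
  · have : μ {ω | 0 < X ω} = 0 := measure_mono_null (fun ω hω => (ne_of_gt hω : X ω ≠ 0))
      hX.ae_eq_zero_of_hasSubgaussianMGF_zero
    simp [this]
  · rw [← ofReal_measureReal]
    refine ENNReal.ofReal_le_ofReal ?_
    calc μ.real {ω | √(2 * c * s) < X ω} ≤ μ.real {ω | √(2 * c * s) ≤ X ω} :=
          measureReal_mono (Set.ofPred_subset_ofPred.2 fun _ => le_of_lt)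
      _ ≤ Real.exp (-√(2 * c * s) ^ 2 / (2 * c)) := hX.measure_ge_le (Real.sqrt_nonneg _)
      _ = Real.exp (-s) := by
        rw [Real.sq_sqrt (by positivity)]
        field_simp

theorem measurable_integral_sub_mean {X Z : Type*} [MeasurableSpace X] [MeasurableSpace Z]
    (μ : Measure Z) [SFinite μ] {J : ℕ} {u : X × Z → ℝ} (hu : Measurable u) :
    Measurable fun q : X × (Fin J → Z) =>
      ∫ z, u (q.1, z) ∂μ - 1 / (J : ℝ) * ∑ j, u (q.1, q.2 j) := by
  have expectation : Measurable fun x => ∫ z, u (x, z) ∂μ :=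
    hu.stronglyMeasurable.integral_prod_right'.measurable
  exact (expectation.comp measurable_fst).sub ((Finset.measurable_sum _ fun j _ =>
    hu.comp (measurable_fst.prodMk ((measurable_pi_apply j).comp measurable_snd))).const_mul _)

theorem hasSubgaussianMGF_integral_sub_mean {Z : Type*} [MeasurableSpace Z] (μ : Measure Z)
    [IsProbabilityMeasure μ] {J : ℕ} (hJ : 0 < J) {u : Z → ℝ} (hu : Measurable u) {B : ℝ≥0}
    (hB : ∀ z, |u z| ≤ B) :
    HasSubgaussianMGF (fun z => ∫ z, u z ∂μ - 1 / (J : ℝ) * ∑ j, u (z j)) (B ^ 2 / J)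
      (Measure.pi fun _ : Fin J => μ) := by
  set m := ∫ z, u z ∂μ
  have centered : HasSubgaussianMGF (fun z => u z - m) (B ^ 2) μ := by
    have hoeffding := hasSubgaussianMGF_of_mem_Icc hu.aemeasurable
      (.of_forall fun z => abs_le.1 (hB z) : ∀ᵐ z ∂μ, u z ∈ Set.Icc (-B : ℝ) B)
    rwa [show (‖(B - -B : ℝ)‖₊ / 2) ^ 2 = B ^ 2 by ext; simp [← two_mul]] at hoeffding
  have coordinate : ∀ j : Fin J, HasSubgaussianMGF (fun z : Fin J → Z => u (z j) - m)
      (B ^ 2) (Measure.pi fun _ => μ) := fun j => by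
    have eval := measurePreserving_eval (fun _ : Fin J => μ) j
    exact .of_map eval.aemeasurable (eval.map_eq ▸ centered)
  have sum := HasSubgaussianMGF.sum_of_iIndepFun (s := univ)
    (iIndepFun_pi fun _ : Fin J => (hu.sub_const m).aemeasurable) fun j _ => coordinate j
  convert sum.const_mul (-1 / (J : ℝ)) using 1
  · funext z
    rw [sum_sub_distrib, sum_const, card_univ, Fintype.card_fin, nsmul_eq_mul]
    field_simp
    ring
  · refine NNReal.eq ?_
    change (B : ℝ) ^ 2 / J = (-1 / (J : ℝ)) ^ 2 * (∑ _j : Fin J, B ^ 2 : ℝ≥0)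
    simp only [sum_const, card_univ, Fintype.card_fin, nsmul_eq_mul, NNReal.coe_mul,
      NNReal.coe_pow, NNReal.coe_natCast]
    field_simp

end SubgaussianSum

theorem isProbabilityMeasure_perturbLaw (E : ℕ) {η : ℝ} (hη : 0 < η) :
    IsProbabilityMeasure (perturbLaw E η) :=
  isProbabilityMeasure_pi_expMeasure hη

theorem isProbabilityMeasure_roundLaw {Z : Type*} [MeasurableSpace Z] (E J : ℕ) (μ : Measure Z)
    [IsProbabilityMeasure μ] {η : ℝ} (hη : 0 < η) : IsProbabilityMeasure (roundLaw E J μ η) := by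
  have := isProbabilityMeasure_perturbLaw E hη
  unfold roundLaw
  infer_instance

namespace Training

variable {N M E J : ℕ} {Z : Type*} {T : Training N M E J Z}
  {x x' : ℕ → (Fin J → Z) × Params E} {i : ℕ} {η : ℝ}

/-- The parameter of round `i` as a function of a fresh perturbation, with the data collected
before that round fixed. -/
def leader (T : Training N M E J Z) (x : ℕ → (Fin J → Z) × Params E) :
    ℕ → Params E → Params E
  | 0 => fun _ => T.θinit
  | i + 1 => T.argmin (i + 1) (T.data x (i + 1))

/-- Expected loss on the sample `s` for a fresh parameter of round `i`. -/
noncomputable def meanLoss (T : Training N M E J Z) (η : ℝ) (x : ℕ → (Fin J → Z) × Params E)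
    (i : ℕ) (s : Sample N M E) : ℝ :=
  ∫ ψ, T.sampleLoss (T.leader x i ψ) s ∂perturbLaw E η

/-- Amount by which the expected loss of round `i` exceeds the mean over the batch that is
collected with the noise `a`. -/
noncomputable def excess [MeasurableSpace Z] (T : Training N M E J Z) (μ : Measure Z) (η : ℝ)
    (i : ℕ) (x : ℕ → (Fin J → Z) × Params E) (a : (Fin J → Z) × Params E) : ℝ :=
  ∫ z, T.meanLoss η x i (T.gen i (T.param x i) z) ∂μ -
    1 / (J : ℝ) * ∑ j, T.meanLoss η x i (T.gen i (T.param x i) (a.1 j))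

theorem leader_congr (h : ∀ k < i, x k = x' k) : T.leader x i = T.leader x' i := by
  cases i with
  | zero => rfl
  | succ i => simp only [leader, data, run_congr h]

theorem paramLaw_eq_map (hη : 0 < η)
    (x : ℕ → (Fin J → Z) × Params E) (i : ℕ) :
    T.paramLaw η x i = (perturbLaw E η).map (T.leader x i) := by
  have := isProbabilityMeasure_perturbLaw E hη
  cases i with
  | zero => simp [paramLaw, leader, Measure.map_const]
  | succ i => rfl

variable [MeasurableSpace Z]

theorem excess_congr (μ : Measure Z) (η : ℝ) (h : ∀ k < i, x k = x' k) :
    T.excess μ η i x = T.excess μ η i x' := by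
  funext a
  simp only [excess, meanLoss, param, leader_congr h, run_congr h]

namespace Regular

variable {Θ : Set (Params E)} {F : Set (Features N M E)} {B G H : ℝ≥0}

theorem measurable_uncurry_leader (hT : T.Regular Θ F B G H) (i : ℕ) :
    Measurable fun q : (ℕ → (Fin J → Z) × Params E) × Params E => T.leader q.1 i q.2 := by
  cases i with
  | zero => exact measurable_const
  | succ i =>
    exact (hT.measurable_uncurry_argmin (i + 1)).comp
      (((hT.measurable_run (i + 1)).fst.comp measurable_fst).prodMk measurable_snd)

theorem measurable_leader (hT : T.Regular Θ F B G H) (x : ℕ → (Fin J → Z) × Params E) (i : ℕ) :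
    Measurable (T.leader x i) :=
  (hT.measurable_uncurry_leader i).comp measurable_prodMk_left

theorem isPerturbedLeader_leader (hT : T.Regular Θ F B G H)
    (x : ℕ → (Fin J → Z) × Params E) (n : ℕ) :
    IsPerturbedLeader Θ (runningMean (fun t => T.batchLoss (T.batch x t)) (n + 1))
      (T.leader x (n + 1)) := by
  have leader := hT.isPerturbedLeader_argmin (n + 1) (T.data x (n + 1)) fun t j => by
    rw [data_apply]
    exact hT.batch_mem x t j
  rwa [funext (g_data_eq x (n + 1))] at leader

theorem leader_mem (hT : T.Regular Θ F B G H) (x : ℕ → (Fin J → Z) × Params E) (i : ℕ)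
    (ψ : Params E) : T.leader x i ψ ∈ Θ := by
  cases i with
  | zero => exact hT.init_mem
  | succ i => exact (hT.isPerturbedLeader_leader x i).mem ψ

theorem ae_mem_paramLaw (hT : T.Regular Θ F B G H) (hη : 0 < η)
    (x : ℕ → (Fin J → Z) × Params E) (i : ℕ) : ∀ᵐ θ ∂T.paramLaw η x i, θ ∈ Θ := by
  rw [paramLaw_eq_map hη]
  exact (ae_map_iff (hT.measurable_leader x i).aemeasurable hT.measurableSet_params).2
    (.of_forall (hT.leader_mem x i))

theorem measurable_uncurry_meanLoss (hT : T.Regular Θ F B G H) (hη : 0 < η) (i : ℕ) :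
    Measurable fun q : (ℕ → (Fin J → Z) × Params E) × Sample N M E =>
      T.meanLoss η q.1 i q.2 := by
  have := isProbabilityMeasure_perturbLaw E hη
  have measurable_loss : Measurable fun p : ((ℕ → (Fin J → Z) × Params E) × Sample N M E) ×
      Params E => T.sampleLoss (T.leader p.1.1 i p.2) p.1.2 := by
    have := hT.measurable_uncurry_sampleLoss
    have := hT.measurable_uncurry_leader i
    fun_prop
  exact measurable_loss.stronglyMeasurable.integral_prod_right'.measurable

theorem integrable_sampleLoss_leader (hT : T.Regular Θ F B G H) (hη : 0 < η)
    (x : ℕ → (Fin J → Z) × Params E) (i : ℕ) {s : Sample N M E} (hs : s.1 ∈ F) :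
    Integrable (fun ψ => T.sampleLoss (T.leader x i ψ) s) (perturbLaw E η) := by
  have := isProbabilityMeasure_perturbLaw E hη
  have measurable_loss : Measurable fun ψ => T.sampleLoss (T.leader x i ψ) s := by
    have := hT.measurable_uncurry_sampleLoss
    have := hT.measurable_leader x i
    fun_prop
  exact .of_bound measurable_loss.aestronglyMeasurable B
    (.of_forall fun ψ => hT.abs_sampleLoss_le _ (hT.leader_mem x i ψ) s hs)

theorem abs_meanLoss_le (hT : T.Regular Θ F B G H) (hη : 0 < η)
    (x : ℕ → (Fin J → Z) × Params E) (i : ℕ) {s : Sample N M E} (hs : s.1 ∈ F) :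
    |T.meanLoss η x i s| ≤ B := by
  have := isProbabilityMeasure_perturbLaw E hη
  have norm_sampleLoss_le : ∀ᵐ ψ ∂perturbLaw E η, ‖T.sampleLoss (T.leader x i ψ) s‖ ≤ B :=
    .of_forall fun ψ => hT.abs_sampleLoss_le _ (hT.leader_mem x i ψ) s hs
  simpa [meanLoss] using norm_integral_le_of_norm_le_const norm_sampleLoss_le

theorem roundLoss_eq (hT : T.Regular Θ F B G H) (hη : 0 < η) (μ : Measure Z)
    (x : ℕ → (Fin J → Z) × Params E) (i : ℕ) :
    T.roundLoss μ η x i = ∫ z, T.meanLoss η x i (T.gen i (T.param x i) z) ∂μ := by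
  have integral_paramLaw : ∀ s, ∫ θ, T.sampleLoss θ s ∂T.paramLaw η x i = T.meanLoss η x i s :=
    fun s => by
      rw [paramLaw_eq_map hη]
      exact integral_map (hT.measurable_leader x i).aemeasurable
        (hT.measurable_uncurry_sampleLoss.comp measurable_prodMk_right).aestronglyMeasurable
  simp only [roundLoss, expectedLoss, integral_paramLaw]
  exact integral_map (hT.measurable_gen i _).aemeasurable
    ((hT.measurable_uncurry_meanLoss hη i).comp measurable_prodMk_left).aestronglyMeasurable

theorem measurable_uncurry_meanLoss_gen (hT : T.Regular Θ F B G H) (hη : 0 < η) (i : ℕ) :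
    Measurable fun q : (ℕ → (Fin J → Z) × Params E) × Z =>
      T.meanLoss η q.1 i (T.gen i (T.param q.1 i) q.2) := by
  have := hT.measurable_uncurry_meanLoss hη i
  have := hT.measurable_uncurry_gen i
  have := hT.measurable_param i
  fun_prop

theorem measurable_uncurry_excess (hT : T.Regular Θ F B G H) (hη : 0 < η) (μ : Measure Z)
    [IsProbabilityMeasure μ] (i : ℕ) :
    Measurable fun q : (ℕ → (Fin J → Z) × Params E) × ((Fin J → Z) × Params E) =>
      T.excess μ η i q.1 q.2 := by
  have measurable_arguments : Measurable fun q : (ℕ → (Fin J → Z) × Params E) ×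
      ((Fin J → Z) × Params E) => (q.1, q.2.1) := by fun_prop
  simpa only [excess, Function.comp_def] using
    (measurable_integral_sub_mean μ (hT.measurable_uncurry_meanLoss_gen hη i)).comp
      measurable_arguments

theorem hasSubgaussianMGF_excess (hT : T.Regular Θ F B G H) (hη : 0 < η) (hJ : 0 < J)
    (μ : Measure Z) [IsProbabilityMeasure μ] (i : ℕ) (x : ℕ → (Fin J → Z) × Params E) :
    HasSubgaussianMGF (T.excess μ η i x) (B ^ 2 / J) (roundLaw E J μ η) := by
  have := isProbabilityMeasure_perturbLaw E hη
  have measurable_loss : Measurable fun z => T.meanLoss η x i (T.gen i (T.param x i) z) := by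
    simpa only [Function.comp_def] using
      (hT.measurable_uncurry_meanLoss_gen hη i).comp measurable_prodMk_left
  have sampleMean := hasSubgaussianMGF_integral_sub_mean μ hJ measurable_loss
    fun z => hT.abs_meanLoss_le hη x i (hT.gen_mem i _ (hT.param_mem x i) z)
  have instances : MeasurePreserving Prod.fst (roundLaw E J μ η) (Measure.pi fun _ : Fin J => μ) :=
    measurePreserving_fst
  rw [← instances.map_eq] at sampleMean
  exact sampleMean.of_map (Y := Prod.fst) instances.aemeasurable

theorem measure_lt_sum_excess_le (hT : T.Regular Θ F B G H) (hη : 0 < η) (hJ : 0 < J)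
    (μ : Measure Z) [IsProbabilityMeasure μ] (n : ℕ) {s : ℝ} (hs : 0 ≤ s) :
    (Measure.infinitePi fun _ : ℕ => roundLaw E J μ η)
      {x | √(2 * (n * (B ^ 2 / J)) * s) < ∑ i ∈ range n, T.excess μ η i x (x i)} ≤
      ENNReal.ofReal (Real.exp (-s)) := by
  have := isProbabilityMeasure_roundLaw E J μ hη
  have subgaussian := hasSubgaussianMGF_sum_infinitePi (fun _ : ℕ => roundLaw E J μ η)
    (hT.measurable_uncurry_excess hη μ) (fun _ _ _ => excess_congr μ η)
    (hT.hasSubgaussianMGF_excess hη hJ μ) n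
  simpa using measure_sqrt_lt_le_of_hasSubgaussianMGF subgaussian hs

theorem sum_roundLoss_eq (hT : T.Regular Θ F B G H) (hη : 0 < η) (μ : Measure Z)
    (x : ℕ → (Fin J → Z) × Params E) (n : ℕ) :
    ∑ i ∈ range n, T.roundLoss μ η x i = ∑ i ∈ range n, T.excess μ η i x (x i) +
      ∑ i ∈ range n, ∫ ψ, T.batchLoss (T.batch x i) (T.leader x i ψ) ∂perturbLaw E η := by
  rw [← sum_add_distrib]
  refine sum_congr rfl fun i _ => ?_
  simp only [batchLoss]
  rw [integral_const_mul, integral_finsetSum _ fun j _ =>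
    hT.integrable_sampleLoss_leader hη x i (hT.batch_mem x i j), hT.roundLoss_eq hη]
  exact (sub_add_cancel _ _).symm

end Regular

end Training

/-! ## The expected loss of the returned parameter -/

/-- The rate of the exponential perturbation for a training run of `I` rounds; it is `I ^ (1 / 3)`
for `0 < I`, and the maximum keeps it positive for `I = 0`. -/
noncomputable def perturbRate (I : ℕ) : ℝ := max 1 ((I : ℝ) ^ (1 / 3 : ℝ))

theorem perturbRate_pos (I : ℕ) : 0 < perturbRate I := lt_max_of_lt_left one_pos

/-- The constant `C` in the regret bound `C / I ^ (1 / 3)` of the perturbed leader. -/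
noncomputable def regretConst (E : ℕ) (G H : ℝ≥0) : ℝ :=
  Fintype.card (Coord E) * H + G * (Fintype.card (Coord E) * H) +
    2 * (G * Fintype.card (Coord E) * (1 + 2 * G * Fintype.card (Coord E)) * H)

theorem perturbRate_eq {I : ℕ} (hI : 0 < I) : perturbRate I = (I : ℝ) ^ (1 / 3 : ℝ) :=
  max_eq_right (Real.one_le_rpow (by exact_mod_cast hI) (by norm_num))

theorem perturbRate_pow_three {I : ℕ} (hI : 0 < I) : perturbRate I ^ 3 = I := by
  rw [perturbRate_eq hI, ← Real.rpow_natCast, ← Real.rpow_mul (by positivity)]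
  norm_num

theorem sqrt_perturbRate_mul_sqrt {I : ℕ} (hI : 0 < I) :
    √(perturbRate I) * √I = perturbRate I ^ 2 := by
  have rate_pos := perturbRate_pos I
  rw [← Real.sqrt_mul rate_pos.le, ← perturbRate_pow_three hI,
    show perturbRate I * perturbRate I ^ 3 = (perturbRate I ^ 2) ^ 2 by ring,
    Real.sqrt_sq (by positivity)]

theorem regret_perturbRate_le {I : ℕ} (hI : 0 < I) {d : ℝ} (hd : 0 ≤ d) (G H : ℝ≥0) :
    I * (d * H / perturbRate I) + G * (d * H) +
      G * d * (1 + 2 * G * d) * H * √(perturbRate I) * (2 * √I) ≤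
      I * ((d * H + G * (d * H) + 2 * (G * d * (1 + 2 * G * d) * H)) / perturbRate I) := by
  have rate_pos := perturbRate_pos I
  have one_le_sq : 1 ≤ perturbRate I ^ 2 := one_le_pow₀ (le_max_left _ _)
  have div_rate : ∀ y : ℝ, I * (y / perturbRate I) = y * perturbRate I ^ 2 := fun y => by
    rw [← perturbRate_pow_three hI]
    field_simp
  calc _ = d * H * perturbRate I ^ 2 + G * (d * H) +
          2 * (G * d * (1 + 2 * G * d) * H) * (√(perturbRate I) * √I) := by
        rw [div_rate]
        ring
    _ ≤ d * H * perturbRate I ^ 2 + G * (d * H) * perturbRate I ^ 2 +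
          2 * (G * d * (1 + 2 * G * d) * H) * perturbRate I ^ 2 := by
        rw [sqrt_perturbRate_mul_sqrt hI]
        have := le_mul_of_one_le_right (by positivity : 0 ≤ G * (d * H)) one_le_sq
        gcongr
    _ = _ := by
        rw [div_rate]
        ring

theorem sqrt_two_mul_mul_div {n J : ℕ} (hn : 0 < n) {B s : ℝ} (hB : 0 ≤ B) :
    √(2 * (n * (B ^ 2 / J)) * s) = n * (B / √J * √(2 * s / n)) := by
  have hn' : (0 : ℝ) < n := by exact_mod_cast hn
  rw [show 2 * (n * (B ^ 2 / J)) * s = (n : ℝ) ^ 2 * ((B ^ 2 / J) * (2 * s / n)) by field_simp,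
    Real.sqrt_mul (by positivity), Real.sqrt_sq hn'.le, Real.sqrt_mul (by positivity),
    Real.sqrt_div (by positivity), Real.sqrt_sq hB]

namespace Training

variable {N M E J : ℕ} {Z : Type*} {T : Training N M E J Z} {Θ : Set (Params E)}
  {F : Set (Features N M E)} {B G H : ℝ≥0} {I : ℕ}

theorem mean_sampleLoss_data_eq (x : ℕ → (Fin J → Z) × Params E) (θ : Params E) :
    1 / (I * J : ℝ) * ∑ i, ∑ j, T.sampleLoss θ (T.data x I i j) =
      1 / (I : ℝ) * ∑ t ∈ range I, T.batchLoss (T.batch x t) θ := by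
  simp only [data_apply, batchLoss, batch, sum_range, ← mul_sum, ← mul_assoc,
    one_div_mul_one_div]

variable [MeasurableSpace Z]

namespace Regular

theorem sum_integral_batchLoss_le (hT : T.Regular Θ F B G H) (hI : 0 < I)
    (x : ℕ → (Fin J → Z) × Params E) {θ : Params E} (hθ : θ ∈ Θ) :
    ∑ t ∈ range I, ∫ ψ, T.batchLoss (T.batch x t) (T.leader x t ψ) ∂perturbLaw E (perturbRate I) ≤
      ∑ t ∈ range I, T.batchLoss (T.batch x t) θ +
        I * (regretConst E G H / (I : ℝ) ^ (1 / 3 : ℝ)) := by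
  have measurable_batchLoss : ∀ t, Measurable (T.batchLoss (T.batch x t)) := fun t =>
    (Finset.measurable_sum _ fun j _ =>
      hT.measurable_uncurry_sampleLoss.comp measurable_prodMk_right).const_mul _
  have regret := IsPerturbedLeader.regret_le (perturbRate_pos I) G.coe_nonneg H.coe_nonneg
    measurable_batchLoss (fun t => hT.batchLoss_lip _ (hT.batch_mem x t)) hT.diam measurable_const
    (fun _ => hT.init_mem) (hT.isPerturbedLeader_leader x) I hθ
  have rate := regret_perturbRate_le hI (Nat.cast_nonneg (Fintype.card (Coord E))) G H
  rw [← perturbRate_eq hI]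
  simp only [regretConst]
  refine regret.trans ?_
  linarith

theorem roundLoss_le_of_sum_excess_le (hT : T.Regular Θ F B G H) (hI : 0 < I) (μ : Measure Z)
    {x : ℕ → (Fin J → Z) × Params E} {i : ℕ}
    (hi : ∀ k < I, T.roundLoss μ (perturbRate I) x i ≤ T.roundLoss μ (perturbRate I) x k)
    {θ : Params E} (hθ : θ ∈ Θ) {ν e : ℝ}
    (hν : 1 / (I : ℝ) * ∑ t ∈ range I, T.batchLoss (T.batch x t) θ ≤ ν)
    (he : ∑ k ∈ range I, T.excess μ (perturbRate I) k x (x k) ≤ I * e) :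
    T.roundLoss μ (perturbRate I) x i ≤ ν + regretConst E G H / (I : ℝ) ^ (1 / 3 : ℝ) + e := by
  have hI' : (0 : ℝ) < I := by exact_mod_cast hI
  have regret := hT.sum_integral_batchLoss_le hI x hθ
  rw [one_div, inv_mul_le_iff₀ hI'] at hν
  have best_le : I * T.roundLoss μ (perturbRate I) x i ≤
      ∑ k ∈ range I, T.roundLoss μ (perturbRate I) x k := by
    simpa using card_nsmul_le_sum (range I) _ _ fun k hk => hi k (mem_range.1 hk)
  rw [hT.sum_roundLoss_eq (perturbRate_pos I)] at best_le
  refine le_of_mul_le_mul_left ?_ hI'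
  linarith

end Regular

theorem Regular.le_measure_roundLoss_le (hT : T.Regular Θ F B G H) (hI : 0 < I) (hJ : 0 < J)
    (μ : Measure Z) [IsProbabilityMeasure μ] {Ω : Type*} [MeasurableSpace Ω] {P : Measure Ω}
    [IsProbabilityMeasure P] {X : ℕ → Ω → (Fin J → Z) × Params E} (hX : ∀ i, Measurable (X i))
    (hlaw : ∀ i, P.map (X i) = roundLaw E J μ (perturbRate I)) (hind : iIndepFun X P)
    {best : Ω → ℕ} (hbest : ∀ ω, ∀ i < I,
      T.roundLoss μ (perturbRate I) (fun k => X k ω) (best ω) ≤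
        T.roundLoss μ (perturbRate I) (fun k => X k ω) i)
    {ν δ : ℝ} (hδ : 0 < δ) (hδ₁ : δ < 1) (hν : ∀ᵐ ω ∂P, ∃ θ ∈ Θ,
      1 / (I * J : ℝ) * ∑ i, ∑ j, T.sampleLoss θ (T.data (fun k => X k ω) I i j) ≤ ν) :
    ENNReal.ofReal (1 - δ) ≤ P {ω | T.roundLoss μ (perturbRate I) (fun k => X k ω) (best ω) ≤
      ν + regretConst E G H / (I : ℝ) ^ (1 / 3 : ℝ) +
        B / √J * √(2 * Real.log (2 / δ) / I)} := by
  set good := {ω | T.roundLoss μ (perturbRate I) (fun k => X k ω) (best ω) ≤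
      ν + regretConst E G H / (I : ℝ) ^ (1 / 3 : ℝ) + B / √J * √(2 * Real.log (2 / δ) / I)}
  set bad := {x : ℕ → (Fin J → Z) × Params E | √(2 * (I * (B ^ 2 / J)) * Real.log (2 / δ)) <
      ∑ i ∈ range I, T.excess μ (perturbRate I) i x (x i)}
  have law : P.map (fun ω k => X k ω) =
      Measure.infinitePi fun _ : ℕ => roundLaw E J μ (perturbRate I) := by
    rw [hind.map_fun_eq_infinitePi_map hX]
    simp_rw [hlaw]
  have log_nonneg : 0 ≤ Real.log (2 / δ) := Real.log_nonneg (by rw [le_div_iff₀ hδ]; linarith)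
  have measure_bad : P ((fun ω k => X k ω) ⁻¹' bad) ≤ ENNReal.ofReal δ :=
    calc _ ≤ P.map (fun ω k => X k ω) bad :=
          Measure.le_map_apply (measurable_pi_iff.2 hX).aemeasurable _
      _ ≤ ENNReal.ofReal (Real.exp (-Real.log (2 / δ))) := by
          rw [law]
          exact hT.measure_lt_sum_excess_le (perturbRate_pos I) hJ μ I log_nonneg
      _ ≤ ENNReal.ofReal δ := by
          rw [Real.exp_neg, Real.exp_log (by positivity), inv_div]
          exact ENNReal.ofReal_le_ofReal (by linarith)
  have compl_le : P goodᶜ ≤ P ((fun ω k => X k ω) ⁻¹' bad) := by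
    refine measure_mono_ae (hν.mono fun ω ⟨θ, hθ, loss_le⟩ not_good => ?_)
    by_contra not_bad
    rw [mean_sampleLoss_data_eq] at loss_le
    refine not_good (hT.roundLoss_le_of_sum_excess_le hI μ (hbest ω) hθ loss_le ?_)
    rw [← sqrt_two_mul_mul_div hI B.coe_nonneg]
    exact not_lt.1 not_bad
  rw [ENNReal.ofReal_sub _ hδ.le, ENNReal.ofReal_one, tsub_le_iff_right, ← measure_univ (μ := P)]
  exact (measure_univ_le_add_compl good).trans (add_le_add_right (compl_le.trans measure_bad) _)

theorem Assumptions.BL_div_sqrt_le_gap {c : Bounds} {G H : ℝ} (hT : T.Assumptions c I G H)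
    (hJ : 0 < J) (U D : ℕ) {δ : ℝ} (hδ : 0 < δ) (hδ₁ : δ ≤ 1) :
    c.BL / √J ≤ c.gap E U D δ J := by
  have hJ' : (0 : ℝ) < J := by exact_mod_cast hJ
  have hBL := hT.BL_nonneg
  have hCL := hT.CL_nonneg
  have lipschitz_term_nonneg : 0 ≤ 8 * c.CL / J := by positivity
  have covering_term_nonneg : 0 ≤ 24 * c.CL * c.BL / √J *
      √((3 * (E : ℝ) ^ 2 + E) * Real.log (c.Lam E U D J)) := by positivity
  have log_two_le : Real.log 2 ≤ Real.log (2 / δ) :=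
    Real.log_le_log (by norm_num) ((le_div_iff₀ hδ).2 (by linarith))
  have sqrt_le : 1 / 3 * (1 / √J) ≤ √(Real.log (2 / δ) / (2 * J)) := by
    refine Real.le_sqrt_of_sq_le ?_
    rw [mul_pow, div_pow _ (√(J : ℝ)), Real.sq_sqrt hJ'.le]
    calc (1 / 3 : ℝ) ^ 2 * (1 ^ 2 / J) = 2 / 9 / (2 * J) := by ring
      _ ≤ Real.log (2 / δ) / (2 * J) := by
          gcongr
          linarith [Real.log_two_gt_d9]
  calc c.BL / √J = 3 * c.BL * (1 / 3 * (1 / √J)) := by ring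
    _ ≤ 3 * c.BL * √(Real.log (2 / δ) / (2 * J)) := by gcongr
    _ ≤ c.gap E U D δ J := by
        unfold Bounds.gap
        linarith

end Training

/-! ## Accuracy of the classifier -/

theorem volume_restrict_Icc_decide_le {g : ℝ} (hg : g ∈ Set.Ioo (0 : ℝ) 1) (y : Bool) :
    volume.restrict (Set.Icc (0 : ℝ) 1) {r | decide (r ≤ g) = y} =
      ENNReal.ofReal (Real.exp (-logisticLoss g y)) := by
  cases y with
  | true =>
    have accept : {r : ℝ | decide (r ≤ g) = true} ∩ Set.Icc 0 1 = Set.Icc 0 g := by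
      ext r
      simp only [decide_eq_true_eq, Set.mem_inter_iff, Set.mem_ofPred_eq, Set.mem_Icc]
      grind [hg.2]
    rw [Measure.restrict_apply' measurableSet_Icc, accept, Real.volume_Icc]
    simp [logisticLoss, Real.exp_log hg.1]
  | false =>
    have reject : {r : ℝ | decide (r ≤ g) = false} ∩ Set.Icc 0 1 = Set.Ioc g 1 := by
      ext r
      simp only [decide_eq_false_iff_not, not_le, Set.mem_inter_iff, Set.mem_ofPred_eq,
        Set.mem_Icc, Set.mem_Ioc]
      grind [hg.1]
    rw [Measure.restrict_apply' measurableSet_Icc, reject, Real.volume_Ioc]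
    simp [logisticLoss, Real.exp_log (sub_pos.2 hg.2)]

namespace Training

variable {N M E J : ℕ} {Z : Type*} {T : Training N M E J Z}

theorem measurable_classify (hξ : Measurable T.ξ) :
    Measurable fun q : (Params E × ℝ) × Features N M E => T.classify q.1.1 q.1.2 q.2 := by
  have := measurable_gnn hξ T.depth (N := N) (M := M)
  refine measurable_to_bool ?_
  simp only [classify, Set.preimage, Set.mem_singleton_iff, decide_eq_true_eq]
  exact measurableSet_le (by fun_prop) (by fun_prop)

theorem measurableSet_classify_eq (hξ : Measurable T.ξ) :
    MeasurableSet {q : Sample N M E × Params E × ℝ | T.classify q.2.1 q.2.2 q.1.1 = q.1.2} :=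
  measurableSet_eq_fun ((measurable_classify hξ).comp
    (f := fun q : Sample N M E × Params E × ℝ => (q.2, q.1.1)) (by fun_prop)) (by fun_prop)

theorem accuracy_le_one (p : Measure (Sample N M E)) [IsProbabilityMeasure p]
    (κ : Measure (Params E)) [IsProbabilityMeasure κ] (τ : Measure ℝ) [IsProbabilityMeasure τ] :
    T.accuracy p κ τ ≤ 1 :=
  measureReal_le_one

theorem accuracy_dirac (hξ : Measurable T.ξ) (s : Sample N M E) (κ : Measure (Params E))
    (τ : Measure ℝ) [SFinite τ] [SFinite κ] :
    T.accuracy (Measure.dirac s) κ τ = (κ.prod τ).real {a | T.classify a.1 a.2 s.1 = s.2} := by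
  rw [accuracy, measureReal_def, measureReal_def, Measure.dirac_prod,
    Measure.map_apply measurable_prodMk_left (measurableSet_classify_eq hξ)]
  rfl

variable [MeasurableSpace Z]

namespace Regular

variable {Θ : Set (Params E)} {F : Set (Features N M E)} {B G H : ℝ≥0}

theorem ae_mem_sampleLaw (hT : T.Regular Θ F B G H) (μ : Measure Z)
    (x : ℕ → (Fin J → Z) × Params E) (i : ℕ) : ∀ᵐ s ∂T.sampleLaw μ x i, s.1 ∈ F :=
  (ae_map_iff (hT.measurable_gen i _).aemeasurable
    (measurable_fst hT.measurableSet_features)).2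
    (.of_forall (hT.gen_mem i _ (hT.param_mem x i)))

theorem accuracy_eq_integral_exp (hT : T.Regular Θ F B G H) (hN : 0 < N)
    (hloss : T.loss = logisticLoss) (p : Measure (Sample N M E)) [SFinite p]
    (κ : Measure (Params E)) [SFinite κ] :
    T.accuracy p κ (volume.restrict (Set.Icc (0 : ℝ) 1)) =
      ∫ q, Real.exp (-T.sampleLoss q.2 q.1) ∂p.prod κ := by
  have measurable_exp : Measurable fun q : Sample N M E × Params E =>
      Real.exp (-T.sampleLoss q.2 q.1) := by
    have := hT.measurable_uncurry_sampleLoss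
    fun_prop
  have correct := measurableSet_classify_eq hT.measurable_ξ
  rw [accuracy, measureReal_def, Measure.prod_apply correct,
    integral_eq_lintegral_of_nonneg_ae (.of_forall fun q => (Real.exp_pos _).le)
      measurable_exp.aestronglyMeasurable,
    lintegral_prod _ measurable_exp.ennreal_ofReal.aemeasurable]
  congr 1
  refine lintegral_congr fun s => ?_
  rw [Measure.prod_apply (measurable_prodMk_left correct)]
  refine lintegral_congr fun θ => ?_
  have threshold := volume_restrict_Icc_decide_le (gnn_mem_Ioo (ξ := T.ξ) hN T.depth θ s.1) s.2
  rwa [← hloss] at threshold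

theorem exp_neg_expectedLoss_le (hT : T.Regular Θ F B G H) (hN : 0 < N)
    (hloss : T.loss = logisticLoss) {p : Measure (Sample N M E)} [IsProbabilityMeasure p]
    (hp : ∀ᵐ s ∂p, s.1 ∈ F) {κ : Measure (Params E)} [IsProbabilityMeasure κ]
    (hκ : ∀ᵐ θ ∂κ, θ ∈ Θ) :
    Real.exp (-T.expectedLoss p κ) ≤
      T.accuracy p κ (volume.restrict (Set.Icc (0 : ℝ) 1)) := by
  have measurable_loss : Measurable fun q : Sample N M E × Params E =>
      T.sampleLoss q.2 q.1 := by
    have := hT.measurable_uncurry_sampleLoss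
    fun_prop
  have loss_le : ∀ᵐ q ∂p.prod κ, |T.sampleLoss q.2 q.1| ≤ B := by
    filter_upwards [Measure.quasiMeasurePreserving_fst.ae hp,
      Measure.quasiMeasurePreserving_snd.ae hκ] with q hs hθ
    exact hT.abs_sampleLoss_le _ hθ _ hs
  have integrable_loss : Integrable (fun q => T.sampleLoss q.2 q.1) (p.prod κ) :=
    .of_bound measurable_loss.aestronglyMeasurable B loss_le
  have integrable_exp : Integrable (fun q => Real.exp (-T.sampleLoss q.2 q.1)) (p.prod κ) :=
    .of_bound measurable_loss.neg.exp.aestronglyMeasurable (Real.exp B)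
      (loss_le.mono fun q hq => by
        rw [Real.norm_of_nonneg (Real.exp_pos _).le, Real.exp_le_exp]
        exact (neg_le_abs _).trans hq)
  have expectedLoss_eq : T.expectedLoss p κ = ∫ q, T.sampleLoss q.2 q.1 ∂p.prod κ :=
    (integral_prod _ integrable_loss).symm
  rw [hT.accuracy_eq_integral_exp hN hloss, expectedLoss_eq, ← integral_neg]
  exact convexOn_exp.map_integral_le Real.continuous_exp.continuousOn isClosed_univ
    (.of_forall fun _ => Set.mem_univ _) integrable_loss.neg integrable_exp

end Regular

end Training

/-! ## Nodes of the search tree -/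

namespace BBNode

variable {N L : ℕ} {n : BBNode N} {v : Fin N} {Aopt : Finset (Fin N)}

/-- The nodes of the search tree: valid nodes that are leaves or have fewer included and fewer
excluded antennas than a leaf. -/
def Closed (L : ℕ) (n : BBNode N) : Prop :=
  n.Valid L ∧ (n.IsLeaf L ∨ (n.A.card < L ∧ n.B.card < N - L))

/-- The nodes labelled `true`: their decisions agree with `Aopt`. -/
def Relevant (Aopt : Finset (Fin N)) (n : BBNode N) : Prop := n.A ⊆ Aopt ∧ n.B ⊆ univ \ Aopt

/-- The child that excludes `v`, before completion to a leaf. -/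
def withExcluded (n : BBNode N) (v : Fin N) : BBNode N := ⟨n.A, insert v n.B, n.level + 1⟩

/-- The child that includes `v`, before completion to a leaf. -/
def withIncluded (n : BBNode N) (v : Fin N) : BBNode N := ⟨insert v n.A, n.B, n.level + 1⟩

theorem label_eq_true_iff : n.label Aopt = true ↔ n.Relevant Aopt := by simp [label, Relevant]

theorem mem_undecided : v ∈ n.undecided ↔ v ∉ n.A ∧ v ∉ n.B := by simp [undecided]

theorem card_undecided_le (n : BBNode N) : n.undecided.card ≤ N := by
  simpa using card_le_univ n.undecided

theorem Valid.closed_close (h : n.Valid L) (hL : L ≤ N) : (n.close L).Closed L := by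
  obtain ⟨disjoint, card_A, card_B⟩ := h
  unfold close
  split_ifs with full_A full_B
  · have card_sdiff : (univ \ n.A).card = N - L := by simp [card_univ_sdiff, full_A]
    exact ⟨⟨disjoint_sdiff, full_A.le, card_sdiff.le⟩, .inl ⟨full_A, card_sdiff⟩⟩
  · have card_sdiff : (univ \ n.B).card = L := by
      rw [card_univ_sdiff, Fintype.card_fin, full_B]
      omega
    exact ⟨⟨sdiff_disjoint, card_sdiff.le, full_B.le⟩, .inl ⟨card_sdiff, full_B⟩⟩
  · exact ⟨⟨disjoint, card_A, card_B⟩, .inr ⟨card_A.lt_of_ne full_A, card_B.lt_of_ne full_B⟩⟩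

theorem Valid.subset_close (h : n.Valid L) : n.A ⊆ (n.close L).A ∧ n.B ⊆ (n.close L).B := by
  unfold close
  split_ifs
  · exact ⟨Subset.rfl, subset_sdiff.2 ⟨subset_univ _, h.1.symm⟩⟩
  · exact ⟨subset_sdiff.2 ⟨subset_univ _, h.1⟩, Subset.rfl⟩
  · exact ⟨Subset.rfl, Subset.rfl⟩

theorem Valid.undecided_close_subset (h : n.Valid L) : (n.close L).undecided ⊆ n.undecided :=
  sdiff_subset_sdiff Subset.rfl (union_subset_union h.subset_close.1 h.subset_close.2)

theorem Relevant.close (h : n.Relevant Aopt) (hcard : Aopt.card = L) :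
    (n.close L).Relevant Aopt := by
  unfold BBNode.close
  split_ifs with full_A full_B
  · have A_eq : n.A = Aopt := eq_of_subset_of_card_le h.1 (by omega)
    exact ⟨h.1, by rw [A_eq]⟩
  · have B_eq : n.B = univ \ Aopt := eq_of_subset_of_card_le h.2 <| by
      rw [card_univ_sdiff, Fintype.card_fin, hcard, full_B]
    exact ⟨by simp [B_eq], h.2⟩
  · exact h

theorem closed_root (hL : L ≤ N) : (root N L).Closed L :=
  Valid.closed_close ⟨disjoint_empty_left _, by simp, by simp⟩ hL

theorem relevant_root (hcard : Aopt.card = L) : (root N L).Relevant Aopt :=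
  Relevant.close ⟨by simp, by simp⟩ hcard

namespace Closed

theorem undecided_nonempty (h : n.Closed L) (hleaf : ¬ n.IsLeaf L) : n.undecided.Nonempty := by
  obtain ⟨card_A, card_B⟩ := h.2.resolve_left hleaf
  rw [← card_pos, undecided, card_univ_sdiff, Fintype.card_fin, card_union_of_disjoint h.1.1]
  omega

theorem valid_withExcluded (h : n.Closed L) (hleaf : ¬ n.IsLeaf L) (hv : v ∈ n.undecided) :
    (n.withExcluded v).Valid L := by
  obtain ⟨card_A, card_B⟩ := h.2.resolve_left hleaf
  obtain ⟨notMem_A, notMem_B⟩ := mem_undecided.1 hv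
  refine ⟨disjoint_insert_right.2 ⟨notMem_A, h.1.1⟩, card_A.le, ?_⟩
  simpa only [withExcluded, card_insert_of_notMem notMem_B] using Nat.succ_le_of_lt card_B

theorem valid_withIncluded (h : n.Closed L) (hleaf : ¬ n.IsLeaf L) (hv : v ∈ n.undecided) :
    (n.withIncluded v).Valid L := by
  obtain ⟨card_A, card_B⟩ := h.2.resolve_left hleaf
  obtain ⟨notMem_A, notMem_B⟩ := mem_undecided.1 hv
  refine ⟨disjoint_insert_left.2 ⟨notMem_B, h.1.1⟩, ?_, card_B.le⟩
  simpa only [withIncluded, card_insert_of_notMem notMem_A] using Nat.succ_le_of_lt card_A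

theorem left (h : n.Closed L) (hL : L ≤ N) (hleaf : ¬ n.IsLeaf L) (hv : v ∈ n.undecided) :
    (n.left L v).Closed L :=
  (h.valid_withExcluded hleaf hv).closed_close hL

theorem right (h : n.Closed L) (hL : L ≤ N) (hleaf : ¬ n.IsLeaf L) (hv : v ∈ n.undecided) :
    (n.right L v).Closed L :=
  (h.valid_withIncluded hleaf hv).closed_close hL

theorem card_undecided_left_lt (h : n.Closed L) (hleaf : ¬ n.IsLeaf L) (hv : v ∈ n.undecided) :
    (n.left L v).undecided.card < n.undecided.card := by
  have subset : (n.left L v).undecided ⊆ n.undecided.erase v :=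
    (h.valid_withExcluded hleaf hv).undecided_close_subset.trans fun i => by
      simp only [mem_undecided, mem_erase, withExcluded, mem_insert]
      tauto
  exact (card_le_card subset).trans_lt (card_erase_lt_of_mem hv)

theorem card_undecided_right_lt (h : n.Closed L) (hleaf : ¬ n.IsLeaf L) (hv : v ∈ n.undecided) :
    (n.right L v).undecided.card < n.undecided.card := by
  have subset : (n.right L v).undecided ⊆ n.undecided.erase v :=
    (h.valid_withIncluded hleaf hv).undecided_close_subset.trans fun i => by
      simp only [mem_undecided, mem_erase, withIncluded, mem_insert]
      tauto
  exact (card_le_card subset).trans_lt (card_erase_lt_of_mem hv)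

theorem relevant_left_iff (hcard : Aopt.card = L) (h : n.Closed L) (hleaf : ¬ n.IsLeaf L)
    (hv : v ∈ n.undecided) : (n.left L v).Relevant Aopt ↔ n.Relevant Aopt ∧ v ∉ Aopt := by
  obtain ⟨subset_A, subset_B⟩ := (h.valid_withExcluded hleaf hv).subset_close
  refine ⟨fun ⟨hA, hB⟩ => ?_, fun ⟨⟨hA, hB⟩, hvA⟩ => ?_⟩
  · have hB := subset_B.trans hB
    exact ⟨⟨subset_A.trans hA, (subset_insert v n.B).trans hB⟩,
      (mem_sdiff.1 (hB (mem_insert_self v n.B))).2⟩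
  · exact Relevant.close (n := n.withExcluded v) ⟨hA, insert_subset (by simpa using hvA) hB⟩ hcard

theorem relevant_right_iff (hcard : Aopt.card = L) (h : n.Closed L) (hleaf : ¬ n.IsLeaf L)
    (hv : v ∈ n.undecided) : (n.right L v).Relevant Aopt ↔ n.Relevant Aopt ∧ v ∈ Aopt := by
  obtain ⟨subset_A, subset_B⟩ := (h.valid_withIncluded hleaf hv).subset_close
  refine ⟨fun ⟨hA, hB⟩ => ?_, fun ⟨⟨hA, hB⟩, hvA⟩ => ?_⟩
  · have hA := subset_A.trans hA
    exact ⟨⟨(subset_insert v n.A).trans hA, subset_B.trans hB⟩, hA (mem_insert_self v n.A)⟩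
  · exact Relevant.close (n := n.withIncluded v) ⟨insert_subset hvA hA, hB⟩ hcard

end Closed

end BBNode

/-! ## Values of the relaxed problems -/

section SqFrob

variable {N M : ℕ} {W : Matrix (Fin N) (Fin M) ℂ}

theorem sqFrob_nonneg : 0 ≤ sqFrob W := by
  unfold sqFrob
  positivity

theorem eq_zero_of_sqFrob_eq_zero (h : sqFrob W = 0) : W = 0 := by
  ext n m
  have row := (sum_eq_zero_iff_of_nonneg fun n _ => by positivity).1 h n (mem_univ n)
  have entry := (sum_eq_zero_iff_of_nonneg fun m _ => by positivity).1 row m (mem_univ m)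
  simpa using entry

end SqFrob

namespace BFInstance

variable {N M : ℕ} {Q : BFInstance N M} {B B' Aopt : Finset (Fin N)}
  {W : Matrix (Fin N) (Fin M) ℂ}

theorem value_mono (h : B ⊆ B') : Q.value B ≤ Q.value B' :=
  biInf_mono fun _ hW => ⟨hW.1, fun n hn => hW.2 n (h hn)⟩

theorem relaxed_nonempty_of_value_ne_top (h : Q.value B ≠ ⊤) : (Q.relaxed B).Nonempty := by
  by_contra empty
  rw [Set.not_nonempty_iff_eq_empty] at empty
  exact h (by simp [value, empty])

theorem feasible_of_mem_relaxed (hB : B.card = N - Q.L) (hW : W ∈ Q.relaxed B) :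
    Q.Feasible W := by
  refine ⟨hW.1, ?_⟩
  have active_subset : {n : Fin N | ∃ m, W n m ≠ 0} ⊆ ((univ \ B : Finset (Fin N)) : Set _) := by
    rintro n ⟨m, hm⟩
    simpa using fun hn => hm (hW.2 n hn m)
  refine (Set.ncard_le_ncard active_subset (finite_toSet _)).trans ?_
  rw [Set.ncard_coe_finset, card_univ_sdiff, Fintype.card_fin, hB]
  omega

theorem MeetsSINR.sqFrob_pos (hM : 0 < M) (hW : Q.MeetsSINR W) : 0 < sqFrob W := by
  refine sqFrob_nonneg.lt_of_ne' fun h => (Q.gamma_pos ⟨0, hM⟩).not_ge ?_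
  have ratio := hW ⟨0, hM⟩ (Q.h ⟨0, hM⟩) (by simpa using Q.err_nonneg _)
  simpa [gain, eq_zero_of_sqFrob_eq_zero h] using ratio

theorem OptimalWithin.le_value (hW : Q.OptimalWithin 0 W) (hB : B.card = N - Q.L) :
    ENNReal.ofReal (sqFrob W) ≤ Q.value B :=
  le_iInf₂ fun W' hW' => ENNReal.ofReal_le_ofReal <| by
    simpa using hW.2 W' (feasible_of_mem_relaxed hB hW')

namespace IsOptimalSubset

theorem card_sdiff (hA : Q.IsOptimalSubset Aopt) : (univ \ Aopt).card = N - Q.L := by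
  rw [card_univ_sdiff, Fintype.card_fin, hA.1]

theorem exists_value_eq (hA : Q.IsOptimalSubset Aopt) :
    ∃ W, Q.OptimalWithin 0 W ∧ Q.value (univ \ Aopt) = ENNReal.ofReal (sqFrob W) := by
  obtain ⟨W, optimal, vanishes⟩ := hA.2
  exact ⟨W, optimal, le_antisymm
    (iInf₂_le W ⟨optimal.1.1, fun n hn => vanishes n (by simpa using hn)⟩)
    (optimal.le_value hA.card_sdiff)⟩

theorem value_le (hA : Q.IsOptimalSubset Aopt) (hB : B.card = N - Q.L) :
    Q.value (univ \ Aopt) ≤ Q.value B := by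
  obtain ⟨W, optimal, value_eq⟩ := hA.exists_value_eq
  exact value_eq ▸ optimal.le_value hB

theorem value_ne_zero (hA : Q.IsOptimalSubset Aopt) (hM : 0 < M) :
    Q.value (univ \ Aopt) ≠ 0 := by
  obtain ⟨W, optimal, value_eq⟩ := hA.exists_value_eq
  simpa [value_eq] using MeetsSINR.sqFrob_pos hM optimal.1.1

theorem value_ne_top (hA : Q.IsOptimalSubset Aopt) : Q.value (univ \ Aopt) ≠ ⊤ := by
  obtain ⟨W, -, value_eq⟩ := hA.exists_value_eq
  exact value_eq ▸ ENNReal.ofReal_ne_top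

end IsOptimalSubset

end BFInstance

namespace BBRules

variable {N M : ℕ} {Q : BFInstance N M} {R : BBRules Q} {B Aopt : Finset (Fin N)} {n : BBNode N}

theorem value_eq_sqFrob_solve (h : (Q.relaxed B).Nonempty) :
    Q.value B = ENNReal.ofReal (sqFrob (R.solve B)) :=
  le_antisymm (iInf₂_le _ (R.solve_spec B h).1)
    (le_iInf₂ fun W hW => ENNReal.ofReal_le_ofReal ((R.solve_spec B h).2 W hW))

theorem optimalWithin_solve (hA : Q.IsOptimalSubset Aopt) (hB : B.card = N - Q.L) {ε : ℝ≥0}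
    (h : Q.value B ≤ (1 + ε) * Q.value (univ \ Aopt)) : Q.OptimalWithin ε (R.solve B) := by
  have nonempty : (Q.relaxed B).Nonempty :=
    BFInstance.relaxed_nonempty_of_value_ne_top
      (ne_top_of_le_ne_top (ENNReal.mul_ne_top (by simp) hA.value_ne_top) h)
  obtain ⟨W, optimal, value_eq⟩ := hA.exists_value_eq
  have sqFrob_le : sqFrob (R.solve B) ≤ (1 + ε) * sqFrob W := by
    have one_add_eq : (1 + (ε : ℝ≥0∞)) = ENNReal.ofReal (1 + (ε : ℝ)) := by
      simp [ENNReal.ofReal_add zero_le_one ε.coe_nonneg]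
    rwa [value_eq, value_eq_sqFrob_solve nonempty, one_add_eq,
      ← ENNReal.ofReal_mul (by positivity),
      ENNReal.ofReal_le_ofReal_iff (mul_nonneg (by positivity) sqFrob_nonneg)] at h
  refine ⟨BFInstance.feasible_of_mem_relaxed hB (R.solve_spec B nonempty).1, fun W' hW' => ?_⟩
  have le_sqFrob : sqFrob W ≤ sqFrob W' := by simpa using optimal.2 W' hW'
  exact sqFrob_le.trans (by gcongr)

theorem ub_eq_value_of_isLeaf (hn : n.Valid Q.L) (hleaf : n.IsLeaf Q.L) :
    R.ub n = Q.value n.B := by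
  obtain ⟨subset_shut, -, card_shut, -⟩ := R.shut_spec n hn
  rw [ub, eq_of_subset_of_card_le subset_shut (card_shut.trans hleaf.2.symm).le]

end BBRules

/-! ## Invariants of branch and bound -/

namespace BBRules

variable {N M : ℕ} {Q : BFInstance N M} {R : BBRules Q} {ε : ℝ≥0} {S : BBState N M} {d : Bool}
  {n : BBNode N} {Aopt : Finset (Fin N)}

/-- The child of the selected node that excludes the branching antenna. -/
noncomputable def leftChild (R : BBRules Q) (S : BBState N M) : BBNode N :=
  (R.current S).left Q.L (R.branch (R.current S))

/-- The child of the selected node that includes the branching antenna. -/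
noncomputable def rightChild (R : BBRules Q) (S : BBState N M) : BBNode N :=
  (R.current S).right Q.L (R.branch (R.current S))

/-- What holds in every state that the procedure reaches. The global lower bound is only of use
while a relevant node is left: a misclassification may have raised it above the optimal value. -/
structure Invariant (R : BBRules Q) (Aopt : Finset (Fin N)) (S : BBState N M) : Prop where
  closed : ∀ n ∈ S.frontier, n.Closed Q.L
  upper_le_leaf : ∀ n ∈ S.frontier, n.IsLeaf Q.L → S.upper ≤ Q.value n.B
  incumbent_eq : ∃ B : Finset (Fin N), B.card = N - Q.L ∧ S.upper = Q.value B ∧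
    S.incumbent = R.solve B
  lower_le : (∃ n ∈ S.frontier, n.Relevant Aopt) → S.lower ≤ Q.value (univ \ Aopt)

theorem mem_open_ : n ∈ R.open_ S ↔ n ∈ S.frontier ∧ ¬ n.IsLeaf Q.L := by
  simp only [open_, mem_filter]

theorem current_mem_frontier (h : R.Continues ε S) : R.current S ∈ S.frontier :=
  (mem_open_.1 (R.pick_spec _ h.1).1).1

theorem not_isLeaf_current (h : R.Continues ε S) : ¬ (R.current S).IsLeaf Q.L :=
  (mem_open_.1 (R.pick_spec _ h.1).1).2

theorem step_of_not_continues (h : ¬ R.Continues ε S) : R.step ε S d = S := by simp [step, h]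

theorem step_false_upper : (R.step ε S false).upper = S.upper := by
  by_cases h : R.Continues ε S <;> simp [step, h]

theorem step_true_upper (h : R.Continues ε S) : (R.step ε S true).upper =
    min (min (R.ub (R.leftChild S)) (R.ub (R.rightChild S))) S.upper := by
  simp only [step, if_pos h, if_true, ← min_def, apply_ite R.ub, leftChild, rightChild]

theorem step_upper_le : (R.step ε S d).upper ≤ S.upper := by
  by_cases h : R.Continues ε S
  · cases d with
    | false => exact step_false_upper.le
    | true => exact (step_true_upper h).trans_le (min_le_right _ _)
  · rw [step_of_not_continues h]

theorem mem_frontier_step_true (h : R.Continues ε S) : n ∈ (R.step ε S true).frontier ↔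
    (n = R.leftChild S ∨ n = R.rightChild S ∨ n ∈ S.frontier.erase (R.current S)) ∧
      Q.value n.B ≤ (R.step ε S true).upper := by
  simp only [step, if_pos h, if_true, mem_filter, mem_insert, leftChild, rightChild]
  rfl

theorem mem_frontier_step_false (h : R.Continues ε S) : n ∈ (R.step ε S false).frontier ↔
    n ∈ S.frontier.erase (R.current S) ∧ Q.value n.B ≤ S.upper := by
  simp only [step, if_pos h, Bool.false_eq_true, if_false, mem_filter]
  rfl

theorem step_true_lower_le (h : R.Continues ε S) (hn : n ∈ (R.step ε S true).frontier) :
    (R.step ε S true).lower ≤ Q.value n.B := by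
  have mem := ((mem_frontier_step_true h).1 hn).1
  simp only [step, if_pos h, if_true]
  refine inf_le (f := R.lb) ?_
  simpa only [mem_insert, leftChild, rightChild] using mem

theorem step_true_incumbent (h : R.Continues ε S) :
    ((R.step ε S true).upper = S.upper ∧ (R.step ε S true).incumbent = S.incumbent) ∨
    ∃ k, (k = R.leftChild S ∨ k = R.rightChild S) ∧ (R.step ε S true).upper = R.ub k ∧
      (R.step ε S true).incumbent = R.solve (R.shut k) := by
  simp only [step, if_pos h, if_true, leftChild, rightChild]
  grind

namespace Invariant

theorem init (hcard : Aopt.card = Q.L) : R.Invariant Aopt R.init where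
  closed n hn := by
    rw [mem_singleton.1 hn]
    exact BBNode.closed_root Q.L_le
  upper_le_leaf n hn hleaf := by
    rw [mem_singleton.1 hn] at hleaf ⊢
    exact (ub_eq_value_of_isLeaf (BBNode.closed_root Q.L_le).1 hleaf).le
  incumbent_eq := ⟨R.shut (BBNode.root N Q.L),
    (R.shut_spec _ (BBNode.closed_root Q.L_le).1).2.2.1, rfl, rfl⟩
  lower_le _ := BFInstance.value_mono (BBNode.relevant_root hcard).2

theorem closed_current (hS : R.Invariant Aopt S) (h : R.Continues ε S) :
    (R.current S).Closed Q.L :=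
  hS.closed _ (current_mem_frontier h)

theorem branch_mem_undecided (hS : R.Invariant Aopt S) (h : R.Continues ε S) :
    R.branch (R.current S) ∈ (R.current S).undecided :=
  (R.branch_spec _ ((hS.closed_current h).undecided_nonempty (not_isLeaf_current h))).1

theorem closed_leftChild (hS : R.Invariant Aopt S) (h : R.Continues ε S) :
    (R.leftChild S).Closed Q.L :=
  (hS.closed_current h).left Q.L_le (not_isLeaf_current h) (hS.branch_mem_undecided h)

theorem closed_rightChild (hS : R.Invariant Aopt S) (h : R.Continues ε S) :
    (R.rightChild S).Closed Q.L :=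
  (hS.closed_current h).right Q.L_le (not_isLeaf_current h) (hS.branch_mem_undecided h)

theorem card_undecided_leftChild_lt (hS : R.Invariant Aopt S) (h : R.Continues ε S) :
    (R.leftChild S).undecided.card < (R.current S).undecided.card :=
  (hS.closed_current h).card_undecided_left_lt (not_isLeaf_current h) (hS.branch_mem_undecided h)

theorem card_undecided_rightChild_lt (hS : R.Invariant Aopt S) (h : R.Continues ε S) :
    (R.rightChild S).undecided.card < (R.current S).undecided.card :=
  (hS.closed_current h).card_undecided_right_lt (not_isLeaf_current h)
    (hS.branch_mem_undecided h)

theorem relevant_leftChild_iff (hcard : Aopt.card = Q.L) (hS : R.Invariant Aopt S)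
    (h : R.Continues ε S) : (R.leftChild S).Relevant Aopt ↔
      (R.current S).Relevant Aopt ∧ R.branch (R.current S) ∉ Aopt :=
  (hS.closed_current h).relevant_left_iff hcard (not_isLeaf_current h)
    (hS.branch_mem_undecided h)

theorem relevant_rightChild_iff (hcard : Aopt.card = Q.L) (hS : R.Invariant Aopt S)
    (h : R.Continues ε S) : (R.rightChild S).Relevant Aopt ↔
      (R.current S).Relevant Aopt ∧ R.branch (R.current S) ∈ Aopt :=
  (hS.closed_current h).relevant_right_iff hcard (not_isLeaf_current h)
    (hS.branch_mem_undecided h)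

theorem step_false (hS : R.Invariant Aopt S) (h : R.Continues ε S) :
    R.Invariant Aopt (R.step ε S false) := by
  have mem_frontier : ∀ n ∈ (R.step ε S false).frontier, n ∈ S.frontier := fun n hn =>
    mem_of_mem_erase ((mem_frontier_step_false h).1 hn).1
  exact
    { closed n hn := hS.closed n (mem_frontier n hn)
      upper_le_leaf n hn hleaf :=
        step_upper_le.trans (hS.upper_le_leaf n (mem_frontier n hn) hleaf)
      incumbent_eq := by simpa [BBRules.step, h] using hS.incumbent_eq
      lower_le := fun ⟨n, hn, relevant⟩ => by
        simpa [BBRules.step, h] using hS.lower_le ⟨n, mem_frontier n hn, relevant⟩ }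

theorem step_true (hS : R.Invariant Aopt S) (h : R.Continues ε S) :
    R.Invariant Aopt (R.step ε S true) where
  closed n hn := by
    rcases ((mem_frontier_step_true h).1 hn).1 with rfl | rfl | hn
    · exact hS.closed_leftChild h
    · exact hS.closed_rightChild h
    · exact hS.closed n (mem_of_mem_erase hn)
  upper_le_leaf n hn hleaf := by
    rcases ((mem_frontier_step_true h).1 hn).1 with rfl | rfl | hn
    · rw [step_true_upper h, ← ub_eq_value_of_isLeaf (hS.closed_leftChild h).1 hleaf]
      exact (min_le_left _ _).trans (min_le_left _ _)
    · rw [step_true_upper h, ← ub_eq_value_of_isLeaf (hS.closed_rightChild h).1 hleaf]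
      exact (min_le_left _ _).trans (min_le_right _ _)
    · exact step_upper_le.trans (hS.upper_le_leaf n (mem_of_mem_erase hn) hleaf)
  incumbent_eq := by
    rcases step_true_incumbent h with ⟨upper_eq, incumbent_eq⟩ | ⟨k, hk, upper_eq, incumbent_eq⟩
    · rw [upper_eq, incumbent_eq]
      exact hS.incumbent_eq
    · have closed : k.Closed Q.L := by
        rcases hk with rfl | rfl
        exacts [hS.closed_leftChild h, hS.closed_rightChild h]
      exact ⟨R.shut k, (R.shut_spec k closed.1).2.2.1, upper_eq, incumbent_eq⟩
  lower_le := fun ⟨_, hn, relevant⟩ =>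
    (step_true_lower_le h hn).trans (BFInstance.value_mono relevant.2)

theorem step (hS : R.Invariant Aopt S) : R.Invariant Aopt (R.step ε S d) := by
  by_cases h : R.Continues ε S
  · cases d with
    | false => exact hS.step_false h
    | true => exact hS.step_true h
  · rwa [step_of_not_continues h]

theorem value_le_upper (hA : Q.IsOptimalSubset Aopt) (hS : R.Invariant Aopt S) :
    Q.value (univ \ Aopt) ≤ S.upper := by
  obtain ⟨B, hB, upper_eq, -⟩ := hS.incumbent_eq
  exact upper_eq ▸ hA.value_le hB

theorem mem_frontier_step_of_ne (hA : Q.IsOptimalSubset Aopt) (hS : R.Invariant Aopt S)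
    (h : R.Continues ε S) (hn : n ∈ S.frontier) (relevant : n.Relevant Aopt)
    (hne : n ≠ R.current S) : n ∈ (R.step ε S d).frontier := by
  have mem_erase : n ∈ S.frontier.erase (R.current S) := mem_erase.2 ⟨hne, hn⟩
  have value_le : Q.value n.B ≤ Q.value (univ \ Aopt) := BFInstance.value_mono relevant.2
  cases d with
  | false =>
    exact (mem_frontier_step_false h).2 ⟨mem_erase, value_le.trans (hS.value_le_upper hA)⟩
  | true =>
    exact (mem_frontier_step_true h).2
      ⟨.inr (.inr mem_erase), value_le.trans ((hS.step_true h).value_le_upper hA)⟩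

theorem exists_relevant_child (hA : Q.IsOptimalSubset Aopt) (hS : R.Invariant Aopt S)
    (h : R.Continues ε S) (relevant : (R.current S).Relevant Aopt) :
    ∃ m ∈ (R.step ε S true).frontier, m.Relevant Aopt ∧
      m.undecided.card < (R.current S).undecided.card := by
  have le_upper := (hS.step_true h).value_le_upper hA
  by_cases hv : R.branch (R.current S) ∈ Aopt
  · have relevant_right := (hS.relevant_rightChild_iff hA.1 h).2 ⟨relevant, hv⟩
    exact ⟨R.rightChild S, (mem_frontier_step_true h).2 ⟨.inr (.inl rfl),
      (BFInstance.value_mono relevant_right.2).trans le_upper⟩, relevant_right,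
      hS.card_undecided_rightChild_lt h⟩
  · have relevant_left := (hS.relevant_leftChild_iff hA.1 h).2 ⟨relevant, hv⟩
    exact ⟨R.leftChild S, (mem_frontier_step_true h).2 ⟨.inl rfl,
      (BFInstance.value_mono relevant_left.2).trans le_upper⟩, relevant_left,
      hS.card_undecided_leftChild_lt h⟩

theorem upper_le_of_not_continues (hM : 0 < M) (hA : Q.IsOptimalSubset Aopt)
    (hS : R.Invariant Aopt S) (h : ¬ R.Continues ε S) (hn : n ∈ S.frontier)
    (relevant : n.Relevant Aopt) : S.upper ≤ (1 + ε) * Q.value (univ \ Aopt) := by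
  by_cases nonempty : (R.open_ S).Nonempty
  · have lower_le := hS.lower_le ⟨n, hn, relevant⟩
    have upper_ne_zero : S.upper ≠ 0 :=
      (hA.value_ne_zero hM).bot_lt.trans_le (hS.value_le_upper hA) |>.ne'
    have gap_le : (S.upper - S.lower) / S.lower ≤ ε := not_lt.1 fun hlt => h ⟨nonempty, hlt⟩
    have lower_ne_zero : S.lower ≠ 0 := fun lower_eq => by
      rw [lower_eq, tsub_zero, ENNReal.div_zero upper_ne_zero, top_le_iff] at gap_le
      exact ENNReal.coe_ne_top gap_le
    rw [ENNReal.div_le_iff lower_ne_zero (ne_top_of_le_ne_top hA.value_ne_top lower_le)] at gap_le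
    calc S.upper ≤ S.upper - S.lower + S.lower := le_tsub_add
      _ ≤ ε * S.lower + S.lower := by gcongr
      _ = (1 + ε) * S.lower := by ring
      _ ≤ (1 + ε) * Q.value (univ \ Aopt) := by gcongr
  · have leaf : n.IsLeaf Q.L := by
      by_contra hleaf
      exact nonempty ⟨n, mem_open_.2 ⟨hn, hleaf⟩⟩
    have B_eq : n.B = univ \ Aopt :=
      eq_of_subset_of_card_le relevant.2 (hA.card_sdiff.trans leaf.2.symm).le
    calc S.upper ≤ Q.value n.B := hS.upper_le_leaf n hn leaf
      _ = Q.value (univ \ Aopt) := by rw [B_eq]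
      _ ≤ (1 + ε) * Q.value (univ \ Aopt) := le_mul_of_one_le_left zero_le le_self_add

theorem optimalWithin_of_not_continues (hM : 0 < M) (hA : Q.IsOptimalSubset Aopt)
    (hS : R.Invariant Aopt S) (h : ¬ R.Continues ε S) (hn : n ∈ S.frontier)
    (relevant : n.Relevant Aopt) : Q.OptimalWithin ε S.incumbent := by
  obtain ⟨B, hB, upper_eq, incumbent_eq⟩ := hS.incumbent_eq
  rw [incumbent_eq]
  exact optimalWithin_solve hA hB
    (upper_eq ▸ hS.upper_le_of_not_continues hM hA h hn relevant)

end Invariant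

end BBRules

/-! ## Weights of the frontier -/

theorem sum_insert_le_add {α : Type*} [DecidableEq α] {f : α → ℝ} (hf : ∀ a, 0 ≤ f a) (a : α)
    (s : Finset α) : ∑ b ∈ insert a s, f b ≤ f a + ∑ b ∈ s, f b := by
  by_cases h : a ∈ s
  · rw [insert_eq_of_mem h]
    exact le_add_of_nonneg_left (hf a)
  · rw [sum_insert h]

/-- Total weight of the frontier, where the node `n` has the weight `f n`. -/
noncomputable def BBState.weight {N M : ℕ} (f : BBNode N → ℝ) (S : BBState N M) : ℝ :=
  ∑ n ∈ S.frontier, f n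

namespace BBRules

variable {N M : ℕ} {Q : BFInstance N M} {R : BBRules Q} {ε : ℝ≥0} {S : BBState N M} {d : Bool}
  {f : BBNode N → ℝ} {Aopt : Finset (Fin N)}

theorem weight_step_false_add_le (hf : ∀ n, 0 ≤ f n) (h : R.Continues ε S) :
    (R.step ε S false).weight f + f (R.current S) ≤ S.weight f := by
  rw [BBState.weight, BBState.weight, ← sum_erase_add _ _ (current_mem_frontier h)]
  gcongr ?_ + _
  exact sum_le_sum_of_subset_of_nonneg (fun n hn => ((mem_frontier_step_false h).1 hn).1)
    fun n _ _ => hf n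

theorem weight_step_true_add_le (hf : ∀ n, 0 ≤ f n) (h : R.Continues ε S) :
    (R.step ε S true).weight f + f (R.current S) ≤
      S.weight f + (f (R.leftChild S) + f (R.rightChild S)) := by
  set rest := S.frontier.erase (R.current S)
  have weight_le : (R.step ε S true).weight f ≤
      ∑ n ∈ insert (R.leftChild S) (insert (R.rightChild S) rest), f n :=
    sum_le_sum_of_subset_of_nonneg
      (fun n hn => by simpa only [mem_insert] using ((mem_frontier_step_true h).1 hn).1)
      fun n _ _ => hf n
  have insert_left := sum_insert_le_add hf (R.leftChild S) (insert (R.rightChild S) rest)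
  have insert_right := sum_insert_le_add hf (R.rightChild S) rest
  rw [BBState.weight.eq_def f S, ← sum_erase_add _ _ (current_mem_frontier h)]
  linarith

-- Either child has at most a third of the weight of its parent.
theorem Invariant.weight_step_add_one_le (hS : R.Invariant Aopt S) (h : R.Continues ε S) :
    (R.step ε S d).weight (fun n => 3 ^ n.undecided.card) + 1 ≤
      S.weight fun n => 3 ^ n.undecided.card := by
  have nonneg : ∀ n : BBNode N, (0 : ℝ) ≤ 3 ^ n.undecided.card := fun n => by positivity
  have one_le : ∀ n : BBNode N, (1 : ℝ) ≤ 3 ^ n.undecided.card := fun n =>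
    one_le_pow₀ (by norm_num)
  cases d with
  | false => linarith [weight_step_false_add_le nonneg h, one_le (R.current S)]
  | true =>
    have three_mul_le : ∀ c : BBNode N, c.undecided.card < (R.current S).undecided.card →
        (3 : ℝ) * 3 ^ c.undecided.card ≤ 3 ^ (R.current S).undecided.card := fun c hc => by
      rw [← pow_succ']
      exact pow_le_pow_right₀ (by norm_num) hc
    linarith [weight_step_true_add_le nonneg h, one_le (R.leftChild S), one_le (R.rightChild S),
      three_mul_le _ (hS.card_undecided_leftChild_lt h),
      three_mul_le _ (hS.card_undecided_rightChild_lt h)]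

end BBRules

/-! ## Potentials for branch and bound -/

open Classical in
/-- Bound on the expected number of nodes that the tree gains below the node `n`, where `y` is
such a bound for an irrelevant node. -/
noncomputable def BBNode.potential {N : ℕ} (Aopt : Finset (Fin N)) (y : ℝ) (n : BBNode N) : ℝ :=
  if n.Relevant Aopt then n.undecided.card * (2 + y) else y

theorem BBNode.potential_of_relevant {N : ℕ} {Aopt : Finset (Fin N)} {n : BBNode N} (y : ℝ)
    (h : n.Relevant Aopt) : n.potential Aopt y = n.undecided.card * (2 + y) :=
  if_pos h

theorem BBNode.potential_of_not_relevant {N : ℕ} {Aopt : Finset (Fin N)} {n : BBNode N} (y : ℝ)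
    (h : ¬ n.Relevant Aopt) : n.potential Aopt y = y :=
  if_neg h

theorem BBNode.potential_nonneg {N : ℕ} (Aopt : Finset (Fin N)) {y : ℝ} (hy : 0 ≤ y)
    (n : BBNode N) : 0 ≤ n.potential Aopt y := by
  unfold potential
  split_ifs <;> positivity

/-- The number of nodes visited so far together with a bound on the expected number of nodes still
to come. -/
noncomputable def BBState.potential {N M : ℕ} (Aopt : Finset (Fin N)) (y : ℝ)
    (S : BBState N M) : ℝ :=
  S.visited + S.weight (BBNode.potential Aopt y)

open Classical in
/-- Lower bound on the probability that a relevant node stays in the frontier until the end, if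
every node is classified correctly with probability `ρ`. -/
noncomputable def BBState.survival {N M : ℕ} (Aopt : Finset (Fin N)) (ρ : ℝ≥0)
    (S : BBState N M) : ℝ≥0 :=
  (S.frontier.filter fun n => n.Relevant Aopt).sup fun n => ρ ^ n.undecided.card

namespace BBState

variable {N M : ℕ} {S : BBState N M} {Aopt : Finset (Fin N)} {ρ : ℝ≥0} {n : BBNode N}

theorem visited_le_potential (Aopt : Finset (Fin N)) {y : ℝ} (hy : 0 ≤ y) (S : BBState N M) :
    S.visited ≤ S.potential Aopt y :=
  le_add_of_nonneg_right (sum_nonneg fun n _ => n.potential_nonneg Aopt hy)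

theorem pow_le_survival (hn : n ∈ S.frontier) (relevant : n.Relevant Aopt) :
    ρ ^ n.undecided.card ≤ S.survival Aopt ρ := by
  classical
  exact le_sup (f := fun n : BBNode N => ρ ^ n.undecided.card) (mem_filter.2 ⟨hn, relevant⟩)

theorem survival_le_one (hρ : ρ ≤ 1) : S.survival Aopt ρ ≤ 1 :=
  Finset.sup_le fun _ _ => pow_le_one₀ zero_le hρ

open Classical in
theorem survival_eq_zero_or_eq_pow : S.survival Aopt ρ = 0 ∨
    ∃ n ∈ S.frontier, n.Relevant Aopt ∧ S.survival Aopt ρ = ρ ^ n.undecided.card := by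
  rw [survival]
  rcases (S.frontier.filter fun n => n.Relevant Aopt).eq_empty_or_nonempty with empty | nonempty
  · exact .inl (by rw [empty, sup_empty, bot_eq_zero])
  · obtain ⟨n, hn, eq_pow⟩ :=
      exists_mem_eq_sup _ nonempty fun n : BBNode N => ρ ^ n.undecided.card
    exact .inr ⟨n, (mem_filter.1 hn).1, (mem_filter.1 hn).2, eq_pow⟩

end BBState

namespace BBRules

variable {N M : ℕ} {Q : BFInstance N M} {R : BBRules Q} {ε : ℝ≥0} {S : BBState N M} {d : Bool}
  {Aopt : Finset (Fin N)} {y : ℝ}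

theorem step_true_visited (h : R.Continues ε S) :
    (R.step ε S true).visited = S.visited + 2 := by
  simp [step, h]

theorem step_false_visited : (R.step ε S false).visited = S.visited := by
  by_cases h : R.Continues ε S <;> simp [step, h]

theorem visited_le_step : S.visited ≤ (R.step ε S d).visited := by
  by_cases h : R.Continues ε S
  · cases d with
    | false => exact step_false_visited.ge
    | true => exact (step_true_visited h).symm ▸ Nat.le_add_right _ 2
  · rw [step_of_not_continues h]

theorem potential_step_false_add_le (hy : 0 ≤ y) (h : R.Continues ε S) :
    (R.step ε S false).potential Aopt y + (R.current S).potential Aopt y ≤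
      S.potential Aopt y := by
  have weight_le := weight_step_false_add_le (fun n => n.potential_nonneg Aopt hy) h
  simp only [BBState.potential, step_false_visited]
  linarith

theorem potential_step_true_add_le (hy : 0 ≤ y) (h : R.Continues ε S) :
    (R.step ε S true).potential Aopt y + (R.current S).potential Aopt y ≤
      S.potential Aopt y +
        ((R.leftChild S).potential Aopt y + (R.rightChild S).potential Aopt y + 2) := by
  have weight_le := weight_step_true_add_le (fun n => n.potential_nonneg Aopt hy) h
  simp only [BBState.potential, step_true_visited h]
  push_cast
  linarith

namespace Invariant

theorem potential_children_of_relevant (hcard : Aopt.card = Q.L) (hS : R.Invariant Aopt S)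
    (h : R.Continues ε S) (hy : 0 ≤ y) (relevant : (R.current S).Relevant Aopt) :
    (R.leftChild S).potential Aopt y + (R.rightChild S).potential Aopt y + 2 ≤
      (R.current S).potential Aopt y := by
  have add_le : ∀ c : BBNode N, c.undecided.card < (R.current S).undecided.card →
      c.undecided.card * (2 + y) + y + 2 ≤ (R.current S).potential Aopt y := fun c hc => by
    have succ_le : (c.undecided.card : ℝ) + 1 ≤ (R.current S).undecided.card := by
      exact_mod_cast hc
    rw [BBNode.potential_of_relevant y relevant]
    nlinarith
  by_cases hv : R.branch (R.current S) ∈ Aopt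
  · rw [BBNode.potential_of_not_relevant y
        fun left => ((hS.relevant_leftChild_iff hcard h).1 left).2 hv,
      BBNode.potential_of_relevant y ((hS.relevant_rightChild_iff hcard h).2 ⟨relevant, hv⟩)]
    linarith [add_le _ (hS.card_undecided_rightChild_lt h)]
  · rw [BBNode.potential_of_not_relevant y
        fun right => hv ((hS.relevant_rightChild_iff hcard h).1 right).2,
      BBNode.potential_of_relevant y ((hS.relevant_leftChild_iff hcard h).2 ⟨relevant, hv⟩)]
    linarith [add_le _ (hS.card_undecided_leftChild_lt h)]

theorem potential_children_of_not_relevant (hcard : Aopt.card = Q.L) (hS : R.Invariant Aopt S)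
    (h : R.Continues ε S) (irrelevant : ¬ (R.current S).Relevant Aopt) :
    (R.leftChild S).potential Aopt y + (R.rightChild S).potential Aopt y = 2 * y := by
  rw [BBNode.potential_of_not_relevant y
      fun left => irrelevant ((hS.relevant_leftChild_iff hcard h).1 left).1,
    BBNode.potential_of_not_relevant y
      fun right => irrelevant ((hS.relevant_rightChild_iff hcard h).1 right).1, two_mul]

theorem potential_step_le (hcard : Aopt.card = Q.L) (hS : R.Invariant Aopt S)
    (h : R.Continues ε S) {ρ a : ℝ} (hy : 0 ≤ y) (hyρ : y = (1 - ρ) * (2 + 2 * y)) (ha₀ : 0 ≤ a)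
    (ha₁ : a ≤ 1) (ha : ρ ≤ a) :
    a * (R.step ε S ((R.current S).label Aopt)).potential Aopt y +
      (1 - a) * (R.step ε S (!(R.current S).label Aopt)).potential Aopt y ≤
        S.potential Aopt y := by
  have : 0 ≤ 1 - a := sub_nonneg.2 ha₁
  have step_false_le := potential_step_false_add_le (Aopt := Aopt) hy h
  have step_true_le := potential_step_true_add_le (Aopt := Aopt) hy h
  by_cases relevant : (R.current S).Relevant Aopt
  · rw [BBNode.label_eq_true_iff.2 relevant, Bool.not_true]
    have children_le := hS.potential_children_of_relevant hcard h hy relevant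
    have nonneg := (R.current S).potential_nonneg Aopt hy
    calc a * (R.step ε S true).potential Aopt y + (1 - a) * (R.step ε S false).potential Aopt y
        ≤ a * S.potential Aopt y + (1 - a) * S.potential Aopt y := by
          gcongr <;> linarith
      _ = S.potential Aopt y := by ring
  · have label_eq : (R.current S).label Aopt = false := by
      rwa [← Bool.not_eq_true, BBNode.label_eq_true_iff]
    rw [label_eq, Bool.not_false]
    rw [hS.potential_children_of_not_relevant hcard h relevant] at step_true_le
    rw [BBNode.potential_of_not_relevant y relevant] at step_false_le step_true_le
    calc a * (R.step ε S false).potential Aopt y + (1 - a) * (R.step ε S true).potential Aopt y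
        ≤ a * (S.potential Aopt y - y) + (1 - a) * (S.potential Aopt y + y + 2) := by
          gcongr <;> linarith
      _ = S.potential Aopt y + ((1 - a) * (2 + 2 * y) - y) := by ring
      _ ≤ S.potential Aopt y + ((1 - ρ) * (2 + 2 * y) - y) := by gcongr
      _ = S.potential Aopt y := by rw [← hyρ, sub_self, add_zero]

theorem survival_le_step (hA : Q.IsOptimalSubset Aopt) (hS : R.Invariant Aopt S)
    (h : R.Continues ε S) {ρ : ℝ≥0} {a : ℝ} (hρ : ρ ≤ 1) (ha₁ : a ≤ 1) (ha : ρ ≤ a) :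
    (S.survival Aopt ρ : ℝ) ≤ a * (R.step ε S ((R.current S).label Aopt)).survival Aopt ρ +
      (1 - a) * (R.step ε S (!(R.current S).label Aopt)).survival Aopt ρ := by
  have ha₀ : 0 ≤ a := ρ.coe_nonneg.trans ha
  have : 0 ≤ 1 - a := sub_nonneg.2 ha₁
  rcases S.survival_eq_zero_or_eq_pow (Aopt := Aopt) (ρ := ρ) with eq | ⟨n, hn, relevant, eq⟩
  · rw [eq, NNReal.coe_zero]
    positivity
  rw [eq]
  by_cases hne : n = R.current S
  · subst hne
    obtain ⟨m, hm, relevant_m, card_lt⟩ := hS.exists_relevant_child hA h relevant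
    rw [BBNode.label_eq_true_iff.2 relevant]
    have pow_le : ρ ^ (R.current S).undecided.card ≤ ρ * ρ ^ m.undecided.card := by
      rw [← pow_succ']
      exact pow_le_pow_of_le_one zero_le hρ card_lt
    calc ((ρ ^ (R.current S).undecided.card : ℝ≥0) : ℝ)
        ≤ ρ * (ρ ^ m.undecided.card : ℝ≥0) := mod_cast pow_le
      _ ≤ a * (R.step ε S true).survival Aopt ρ := by
        gcongr
        exact BBState.pow_le_survival hm relevant_m
      _ ≤ _ := le_add_of_nonneg_right (by positivity)
  · have pow_le : ∀ d, ((ρ ^ n.undecided.card : ℝ≥0) : ℝ) ≤ (R.step ε S d).survival Aopt ρ :=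
      fun d => NNReal.coe_le_coe.2
        (BBState.pow_le_survival (hS.mem_frontier_step_of_ne hA h hn relevant hne) relevant)
    calc ((ρ ^ n.undecided.card : ℝ≥0) : ℝ)
        = a * (ρ ^ n.undecided.card : ℝ≥0) + (1 - a) * (ρ ^ n.undecided.card : ℝ≥0) := by ring
      _ ≤ _ := by gcongr <;> exact pow_le _

end Invariant

end BBRules

/-! ## Branch and bound with a random classifier -/

namespace Training

variable {N M E J : ℕ} {Z : Type*} {T : Training N M E J Z} {Q : BFInstance N M} {R : BBRules Q}
  {ε : ℝ≥0} {feat : BBState N M → BBNode N → Features N M E} {Aopt : Finset (Fin N)} {t : ℕ}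

theorem minimal_congr {w w' : ℕ → Params E × ℝ} (h : ∀ k < t, w k = w' k) :
    T.minimal R ε feat w t = T.minimal R ε feat w' t := by
  induction t with
  | zero => rfl
  | succ t ih => simp only [minimal, ih fun k hk => h k (by lia), h t (by lia)]

theorem invariant_minimal (hcard : Aopt.card = Q.L) (w : ℕ → Params E × ℝ) (t : ℕ) :
    R.Invariant Aopt (T.minimal R ε feat w t) := by
  induction t with
  | zero => exact .init hcard
  | succ t ih => exact ih.step

theorem weight_minimal_add_le (hcard : Aopt.card = Q.L) (w : ℕ → Params E × ℝ)
    (h : R.Continues ε (T.minimal R ε feat w t)) :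
    (T.minimal R ε feat w t).weight (fun n => 3 ^ n.undecided.card) + t ≤ (3 : ℝ) ^ N := by
  induction t with
  | zero =>
    have pow_le : (3 : ℝ) ^ (BBNode.root N Q.L).undecided.card ≤ 3 ^ N :=
      pow_le_pow_right₀ (by norm_num) (BBNode.card_undecided_le _)
    simpa [minimal, BBRules.init, BBState.weight] using pow_le
  | succ t ih =>
    have continues : R.Continues ε (T.minimal R ε feat w t) := by
      by_contra stopped
      exact stopped (by simpa only [minimal, BBRules.step_of_not_continues stopped] using h)
    have weight_step := ((invariant_minimal hcard w t).weight_step_add_one_le continues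
      (d := T.classify (w t).1 (w t).2
        (feat (T.minimal R ε feat w t) (R.current (T.minimal R ε feat w t)))))
    push_cast
    rw [minimal]
    linarith [ih continues]

theorem not_continues_minimal (hcard : Aopt.card = Q.L) (w : ℕ → Params E × ℝ) :
    ¬ R.Continues ε (T.minimal R ε feat w (3 ^ N + 1)) := by
  intro h
  have weight_le := weight_minimal_add_le hcard w h
  have weight_nonneg : 0 ≤ (T.minimal R ε feat w (3 ^ N + 1)).weight
      fun n => (3 : ℝ) ^ n.undecided.card := sum_nonneg fun n _ => by positivity
  push_cast at weight_le
  linarith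

theorem measurable_minimal (hξ : Measurable T.ξ) (t : ℕ) {β : Type} [MeasurableSpace β]
    (f : BBState N M → β) :
    Measurable fun w : ℕ → Params E × ℝ => f (T.minimal R ε feat w t) := by
  induction t generalizing β with
  | zero => exact measurable_const (a := f R.init)
  | succ t ih =>
    have measurable_decision : Measurable fun w : ℕ → Params E × ℝ => T.classify (w t).1 (w t).2
        (feat (T.minimal R ε feat w t) (R.current (T.minimal R ε feat w t))) :=
      (measurable_classify hξ).comp
        ((measurable_pi_apply t).prodMk (ih fun S => feat S (R.current S)))
    have measurable_uncurry : Measurable fun q : Bool × (ℕ → Params E × ℝ) =>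
        f (R.step ε (T.minimal R ε feat q.2 t) q.1) :=
      measurable_from_prod_countable_right fun d => ih fun S => f (R.step ε S d)
    exact measurable_uncurry.comp (measurable_decision.prodMk measurable_id)

variable {κ : Measure (Params E)} [IsProbabilityMeasure κ] {τ : Measure ℝ}
  [IsProbabilityMeasure τ]

theorem lintegral_classify (hξ : Measurable T.ξ) (s : Sample N M E) {g : Bool → ℝ}
    (hg : ∀ d, 0 ≤ g d) :
    ∫⁻ a, ENNReal.ofReal (g (T.classify a.1 a.2 s.1)) ∂κ.prod τ =
      ENNReal.ofReal (T.accuracy (Measure.dirac s) κ τ * g s.2 +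
        (1 - T.accuracy (Measure.dirac s) κ τ) * g (!s.2)) := by
  set correct := {a : Params E × ℝ | T.classify a.1 a.2 s.1 = s.2}
  have measurableSet_correct : MeasurableSet correct :=
    (measurable_classify hξ).comp measurable_prodMk_right (measurableSet_singleton s.2)
  calc ∫⁻ a, ENNReal.ofReal (g (T.classify a.1 a.2 s.1)) ∂κ.prod τ
      = ∫⁻ a in correct, ENNReal.ofReal (g (T.classify a.1 a.2 s.1)) ∂κ.prod τ +
          ∫⁻ a in correctᶜ, ENNReal.ofReal (g (T.classify a.1 a.2 s.1)) ∂κ.prod τ :=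
        (lintegral_add_compl _ measurableSet_correct).symm
    _ = ∫⁻ _ in correct, ENNReal.ofReal (g s.2) ∂κ.prod τ +
          ∫⁻ _ in correctᶜ, ENNReal.ofReal (g (!s.2)) ∂κ.prod τ := by
        congr 1
        · exact setLIntegral_congr_fun measurableSet_correct fun a ha =>
            congrArg (fun d => ENNReal.ofReal (g d)) ha
        · exact setLIntegral_congr_fun measurableSet_correct.compl fun a ha =>
            congrArg (fun d => ENNReal.ofReal (g d)) (Bool.eq_not_of_ne ha)
    _ = _ := by
        rw [setLIntegral_const, setLIntegral_const, ← ofReal_measureReal, ← ofReal_measureReal,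
          probReal_compl_eq_one_sub measurableSet_correct, accuracy_dirac hξ,
          ← ENNReal.ofReal_mul (hg _), ← ENNReal.ofReal_mul (hg _), ← ENNReal.ofReal_add
            (mul_nonneg (hg _) measureReal_nonneg)
            (mul_nonneg (hg _) (sub_nonneg.2 measureReal_le_one)), mul_comm, mul_comm (g (!s.2))]

theorem lintegral_minimal_succ (hξ : Measurable T.ξ) (f : BBState N M → ℝ≥0∞) (t : ℕ) :
    ∫⁻ w, f (T.minimal R ε feat w (t + 1)) ∂(Measure.infinitePi fun _ : ℕ => κ.prod τ) =
      ∫⁻ w, ∫⁻ a, f (R.step ε (T.minimal R ε feat w t) (T.classify a.1 a.2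
          (feat (T.minimal R ε feat w t) (R.current (T.minimal R ε feat w t))))) ∂κ.prod τ
        ∂(Measure.infinitePi fun _ : ℕ => κ.prod τ) := by
  have measurable_step : Measurable fun q : (ℕ → Params E × ℝ) × (Params E × ℝ) =>
      f (R.step ε (T.minimal R ε feat q.1 t) (T.classify q.2.1 q.2.2
        (feat (T.minimal R ε feat q.1 t) (R.current (T.minimal R ε feat q.1 t))))) := by
    have measurable_decision : Measurable fun q : (ℕ → Params E × ℝ) × (Params E × ℝ) =>
        T.classify q.2.1 q.2.2
          (feat (T.minimal R ε feat q.1 t) (R.current (T.minimal R ε feat q.1 t))) :=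
      (measurable_classify hξ).comp (measurable_snd.prodMk
        ((measurable_minimal hξ t fun S => feat S (R.current S)).comp measurable_fst))
    have measurable_uncurry : Measurable fun q : Bool × (ℕ → Params E × ℝ) =>
        f (R.step ε (T.minimal R ε feat q.2 t) q.1) :=
      measurable_from_prod_countable_right fun d =>
        measurable_minimal hξ t fun S => f (R.step ε S d)
    exact measurable_uncurry.comp (measurable_decision.prodMk measurable_fst)
  exact lintegral_infinitePi_eval (fun _ => κ.prod τ) t
    (F := fun w a => f (R.step ε (T.minimal R ε feat w t) (T.classify a.1 a.2
      (feat (T.minimal R ε feat w t) (R.current (T.minimal R ε feat w t))))))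
    measurable_step fun w w' h => by
      rw [minimal_congr fun k hk => h k hk.ne]

theorem lintegral_minimal_le_init (hξ : Measurable T.ξ) (hcard : Aopt.card = Q.L) {ρ : ℝ}
    (hcls : T.ClassifiesWith R ε feat Aopt κ τ ρ) {f : BBState N M → ℝ} (hf : ∀ S, 0 ≤ f S)
    (step_le : ∀ S, R.Invariant Aopt S → R.Continues ε S → ∀ a, 0 ≤ a → a ≤ 1 → ρ ≤ a →
      a * f (R.step ε S ((R.current S).label Aopt)) +
        (1 - a) * f (R.step ε S (!(R.current S).label Aopt)) ≤ f S) (t : ℕ) :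
    ∫⁻ w, ENNReal.ofReal (f (T.minimal R ε feat w t))
      ∂(Measure.infinitePi fun _ : ℕ => κ.prod τ) ≤ ENNReal.ofReal (f R.init) := by
  induction t with
  | zero => simp [minimal]
  | succ t ih =>
    rw [lintegral_minimal_succ hξ fun S => ENNReal.ofReal (f S)]
    refine (lintegral_mono_ae ((hcls t).mono fun w accurate => ?_)).trans ih
    set S := T.minimal R ε feat w t
    by_cases continues : R.Continues ε S
    · rw [lintegral_classify hξ (feat S (R.current S), (R.current S).label Aopt)
        fun d => hf (R.step ε S d)]
      exact ENNReal.ofReal_le_ofReal (step_le S (invariant_minimal hcard w t) continues _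
        measureReal_nonneg (accuracy_le_one _ κ τ) (accurate continues))
    · simp [BBRules.step_of_not_continues continues]

theorem potential_init_le (hN : 0 < N) (hcard : Aopt.card = Q.L) {ρ : ℝ} (hρ : 1 / 2 < ρ)
    (hρ₁ : ρ ≤ 1) : R.init.potential Aopt (2 * (1 - ρ) / (2 * ρ - 1)) ≤
      2 * N * (2 * ρ - ρ ^ N) / (2 * ρ - 1) + 1 := by
  have pos : 0 < 2 * ρ - 1 := by linarith
  have two_add : 2 + 2 * (1 - ρ) / (2 * ρ - 1) = 2 * ρ / (2 * ρ - 1) := by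
    field_simp
    ring
  have card_le : ((BBNode.root N Q.L).undecided.card : ℝ) ≤ N :=
    mod_cast BBNode.card_undecided_le _
  have pow_le : ρ ^ N ≤ ρ := pow_le_of_le_one (by linarith) hρ₁ hN.ne'
  calc R.init.potential Aopt (2 * (1 - ρ) / (2 * ρ - 1))
      = 1 + (BBNode.root N Q.L).undecided.card * (2 * ρ / (2 * ρ - 1)) := by
        rw [BBState.potential, BBState.weight, BBRules.init, sum_singleton, Nat.cast_one,
          BBNode.potential_of_relevant _ (BBNode.relevant_root hcard), two_add]
    _ ≤ 1 + N * (2 * (2 * ρ - ρ ^ N) / (2 * ρ - 1)) := by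
        gcongr
        linarith
    _ = 2 * N * (2 * ρ - ρ ^ N) / (2 * ρ - 1) + 1 := by ring

theorem expectedNodes_le (hξ : Measurable T.ξ) (hN : 0 < N) (hcard : Aopt.card = Q.L) {ρ : ℝ}
    (hρ : 1 / 2 < ρ) (hρ₁ : ρ ≤ 1) (hcls : T.ClassifiesWith R ε feat Aopt κ τ ρ) :
    T.expectedNodes R ε feat κ τ ≤
      ENNReal.ofReal (2 * N * (2 * ρ - ρ ^ N) / (2 * ρ - 1) + 1) := by
  have pos : 0 < 2 * ρ - 1 := by linarith
  set y := 2 * (1 - ρ) / (2 * ρ - 1) with y_def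
  have hy : 0 ≤ y := div_nonneg (by linarith) pos.le
  have hyρ : y = (1 - ρ) * (2 + 2 * y) := by
    rw [y_def]
    field_simp
    ring
  have monotone : Monotone fun t (w : ℕ → Params E × ℝ) =>
      ((T.minimal R ε feat w t).visited : ℝ≥0∞) :=
    monotone_nat_of_le_succ fun t w => Nat.cast_le.2 BBRules.visited_le_step
  rw [expectedNodes, lintegral_iSup
    (fun t => measurable_minimal hξ t fun S => (S.visited : ℝ≥0∞)) monotone]
  refine iSup_le fun t => ?_
  calc ∫⁻ w, ((T.minimal R ε feat w t).visited : ℝ≥0∞)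
        ∂(Measure.infinitePi fun _ : ℕ => κ.prod τ)
      ≤ ∫⁻ w, ENNReal.ofReal ((T.minimal R ε feat w t).potential Aopt y)
        ∂(Measure.infinitePi fun _ : ℕ => κ.prod τ) := by
        refine lintegral_mono fun w => ?_
        rw [← ENNReal.ofReal_natCast]
        exact ENNReal.ofReal_le_ofReal (BBState.visited_le_potential Aopt hy _)
    _ ≤ ENNReal.ofReal (R.init.potential Aopt y) :=
        lintegral_minimal_le_init hξ hcard hcls
          (fun S => (Nat.cast_nonneg _).trans (S.visited_le_potential Aopt hy))
          (fun S hS continues a ha₀ ha₁ ha =>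
            hS.potential_step_le hcard continues hy hyρ ha₀ ha₁ ha) t
    _ ≤ _ := ENNReal.ofReal_le_ofReal (potential_init_le hN hcard hρ hρ₁)

theorem pow_le_survival_init (hcard : Aopt.card = Q.L) {ρ : ℝ≥0} (hρ : ρ ≤ 1) :
    ρ ^ N ≤ R.init.survival Aopt ρ :=
  (pow_le_pow_of_le_one zero_le hρ (BBNode.card_undecided_le _)).trans
    (BBState.pow_le_survival (mem_singleton_self _) (BBNode.relevant_root hcard))

theorem survival_minimal_eq_zero (hM : 0 < M) (hA : Q.IsOptimalSubset Aopt) (ρ : ℝ≥0)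
    {w : ℕ → Params E × ℝ} (hw : w ∉ T.success R ε feat) :
    (T.minimal R ε feat w (3 ^ N + 1)).survival Aopt ρ = 0 := by
  refine BBState.survival_eq_zero_or_eq_pow.resolve_right ?_
  rintro ⟨n, hn, relevant, -⟩
  have stopped := not_continues_minimal (T := T) (R := R) (ε := ε) (feat := feat) hA.1 w
  exact hw ⟨3 ^ N + 1, stopped, (invariant_minimal hA.1 w _).optimalWithin_of_not_continues hM hA
    stopped hn relevant⟩

theorem pow_le_measure_success (hξ : Measurable T.ξ) (hM : 0 < M) (hA : Q.IsOptimalSubset Aopt)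
    {ρ : ℝ} (hρ₀ : 0 ≤ ρ) (hρ₁ : ρ ≤ 1) (hcls : T.ClassifiesWith R ε feat Aopt κ τ ρ) :
    ENNReal.ofReal (ρ ^ N) ≤
      Measure.infinitePi (fun _ : ℕ => κ.prod τ) (T.success R ε feat) := by
  lift ρ to ℝ≥0 using hρ₀
  have hρ₁ : ρ ≤ 1 := mod_cast hρ₁
  set P := Measure.infinitePi fun _ : ℕ => κ.prod τ
  have survival_le_one (S : BBState N M) : (S.survival Aopt ρ : ℝ) ≤ 1 :=
    mod_cast BBState.survival_le_one hρ₁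
  have measure_compl_le : P (T.success R ε feat)ᶜ ≤ ENNReal.ofReal (1 - ρ ^ N) :=
    calc P (T.success R ε feat)ᶜ
        ≤ ∫⁻ w, ENNReal.ofReal (1 - (T.minimal R ε feat w (3 ^ N + 1)).survival Aopt ρ) ∂P := by
          have measurable_survival := measurable_minimal (R := R) (ε := ε) (feat := feat) hξ
            (3 ^ N + 1) fun S => ENNReal.ofReal (1 - S.survival Aopt ρ)
          refine meas_le_lintegral₀ measurable_survival.aemeasurable fun w hw => ?_
          rw [survival_minimal_eq_zero hM hA ρ hw, NNReal.coe_zero, sub_zero, ENNReal.ofReal_one]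
      _ ≤ ENNReal.ofReal (1 - R.init.survival Aopt ρ) :=
          lintegral_minimal_le_init hξ hA.1 hcls (fun S => sub_nonneg.2 (survival_le_one S))
            (fun S hS continues a _ ha₁ ha => by
              linarith [hS.survival_le_step hA continues hρ₁ ha₁ ha]) _
      _ ≤ ENNReal.ofReal (1 - ρ ^ N) := by
          gcongr
          exact mod_cast pow_le_survival_init hA.1 hρ₁
  have one_le : 1 ≤ P (T.success R ε feat) + P (T.success R ε feat)ᶜ := by
    rw [← measure_univ (μ := P), ← Set.union_compl_self (T.success R ε feat)]
    exact measure_union_le _ _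
  calc ENNReal.ofReal (ρ ^ N) = 1 - ENNReal.ofReal (1 - ρ ^ N) := by
        have pow_le_one : (ρ : ℝ) ^ N ≤ 1 := mod_cast pow_le_one₀ zero_le hρ₁
        rw [← ENNReal.ofReal_one, ← ENNReal.ofReal_sub _ (sub_nonneg.2 pow_le_one),
          sub_sub_cancel]
    _ ≤ 1 - P (T.success R ε feat)ᶜ := by gcongr
    _ ≤ P (T.success R ε feat) := tsub_le_iff_right.2 one_le

end Training

theorem theorem2_general (E : ℕ) (G H : ℝ≥0) :
    ∃ (C : ℝ) (rate : ℕ → ℝ), (∀ I, 0 < rate I) ∧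
    ∀ (N M I J : ℕ), 0 < N → 0 < M → 0 < I → 0 < J →
    ∀ (η : ℝ), 0 < η →
    ∀ (Z : Type*) [MeasurableSpace Z] (μ : Measure Z) [IsProbabilityMeasure μ]
      (T : Training N M E J Z) (Θ : Set (Params E)) (F : Set (Features N M E)) (B : ℝ≥0),
      T.Regular Θ F B G H →
    ∀ (Ω : Type*) [MeasurableSpace Ω] (P : Measure Ω) [IsProbabilityMeasure P]
      (X : ℕ → Ω → (Fin J → Z) × Params E),
      (∀ i, Measurable (X i)) → (∀ i, P.map (X i) = roundLaw E J μ η) → iIndepFun X P →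
    ∀ (best : Ω → ℕ),
      (∀ ω, ∀ i < I, T.roundLoss μ η (fun k => X k ω) (best ω) ≤
        T.roundLoss μ η (fun k => X k ω) i) →
    (∀ (ν δ : ℝ), 0 < δ → δ < 1 → η = rate I →
      (∀ᵐ ω ∂P, ∃ θ ∈ Θ,
        (1 / (I * J : ℝ)) * ∑ i, ∑ j, T.sampleLoss θ (T.data (fun k => X k ω) I i j) ≤ ν) →
      ENNReal.ofReal (1 - δ) ≤ P {ω | T.roundLoss μ η (fun k => X k ω) (best ω) ≤
        ν + C / (I : ℝ) ^ (1 / 3 : ℝ) + B / √J * √(2 * Real.log (2 / δ) / I)}) ∧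
    ∀ (ω : Ω) (κ : Measure (Params E)) [IsProbabilityMeasure κ],
      (κ = T.paramLaw η (fun k => X k ω) (best ω) ∨
        κ = Measure.dirac (T.param (fun k => X k ω) (best ω))) →
      (T.loss = logisticLoss →
        Real.exp (-T.expectedLoss (T.sampleLaw μ (fun k => X k ω) (best ω)) κ) ≤
          T.accuracy (T.sampleLaw μ (fun k => X k ω) (best ω)) κ
            (volume.restrict (Set.Icc (0 : ℝ) 1))) ∧
      ∀ (τ : Measure ℝ) [IsProbabilityMeasure τ] (ρ : ℝ),
        ρ = T.accuracy (T.sampleLaw μ (fun k => X k ω) (best ω)) κ τ →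
        ∀ (Q : BFInstance N M) (R : BBRules Q) (ε : ℝ≥0)
          (feat : BBState N M → BBNode N → Features N M E) (Aopt : Finset (Fin N)),
          Q.IsOptimalSubset Aopt → T.ClassifiesWith R ε feat Aopt κ τ ρ →
          (1 / 2 < ρ → T.expectedNodes R ε feat κ τ ≤
            ENNReal.ofReal (2 * N * (2 * ρ - ρ ^ N) / (2 * ρ - 1) + 1)) ∧
          ENNReal.ofReal (ρ ^ N) ≤
            Measure.infinitePi (fun _ : ℕ => κ.prod τ) (T.success R ε feat) := by
  refine ⟨regretConst E G H, perturbRate, perturbRate_pos, ?_⟩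
  intro N M I J hN hM hI hJ η hη Z _ μ _ T Θ F B hT Ω _ P _ X hX hlaw hind best hbest
  refine ⟨?_, fun ω κ _ hκ => ?_⟩
  · rintro ν δ hδ hδ₁ rfl hν
    exact hT.le_measure_roundLoss_le hI hJ μ hX hlaw hind hbest hδ hδ₁ hν
  have := hT.isProbabilityMeasure_sampleLaw μ (fun k => X k ω) (best ω)
  have ae_mem : ∀ᵐ θ ∂κ, θ ∈ Θ := by
    rcases hκ with rfl | rfl
    · exact hT.ae_mem_paramLaw hη _ _
    · exact (ae_dirac_iff (p := fun θ => θ ∈ Θ) hT.measurableSet_params).2 (hT.param_mem _ _)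
  refine ⟨fun hloss => hT.exp_neg_expectedLoss_le hN hloss (hT.ae_mem_sampleLaw μ _ _) ae_mem, ?_⟩
  rintro τ _ ρ rfl Q R ε feat Aopt hA hcls
  have accuracy_le_one := T.accuracy_le_one (T.sampleLaw μ (fun k => X k ω) (best ω)) κ τ
  exact ⟨fun hρ => Training.expectedNodes_le hT.measurable_ξ hN hA.1 hρ accuracy_le_one hcls,
    Training.pow_le_measure_success hT.measurable_ξ hM hA measureReal_nonneg accuracy_le_one hcls⟩

theorem theorem2 (E : ℕ) (G H : ℝ) :
    ∃ (C : ℝ) (rate : ℕ → ℝ), (∀ I, 0 < rate I) ∧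
    ∀ (N M I J : ℕ), 0 < N → 0 < M → 0 < I → 0 < J →
    ∀ (η : ℝ), 0 < η →
    ∀ (Z : Type*) [MeasurableSpace Z] (μ : Measure Z) [IsProbabilityMeasure μ]
      (T : Training N M E J Z) (c : Bounds), T.Assumptions c I G H →
    ∀ (Ω : Type*) [MeasurableSpace Ω] (P : Measure Ω) [IsProbabilityMeasure P]
      (X : ℕ → Ω → (Fin J → Z) × Params E),
      (∀ i, Measurable (X i)) → (∀ i, P.map (X i) = roundLaw E J μ η) → iIndepFun X P →
    -- the index of the returned parameter
    ∀ (best : Ω → ℕ), (∀ ω, best ω < I) →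
      (∀ ω, ∀ i < I, T.roundLoss μ η (fun k => X k ω) (best ω) ≤ T.roundLoss μ η (fun k => X k ω) i) →
    -- the expected loss
    (∀ (ν δ : ℝ), 0 < δ → δ < 1 → η = rate I → c.α (N + M) ≠ 1 →
      (∀ᵐ ω ∂P, ∃ θ ∈ c.paramSet E,
        (1 / (I * J : ℝ)) * ∑ i, ∑ j, T.sampleLoss θ (T.data (fun k => X k ω) I i j) ≤ ν) →
      ENNReal.ofReal (1 - δ) ≤ P {ω | T.roundLoss μ η (fun k => X k ω) (best ω) ≤
        ν + C / (I : ℝ) ^ (1 / 3 : ℝ)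
          + c.gap E (N + M) T.depth (δ / 2) J * √(2 * Real.log (2 / δ) / I)}) ∧
    -- the learned classifier: averaged over the perturbation, or the realized parameter
    ∀ (ω : Ω) (κ : Measure (Params E)) [IsProbabilityMeasure κ],
      (κ = T.paramLaw η (fun k => X k ω) (best ω) ∨
        κ = Measure.dirac (T.param (fun k => X k ω) (best ω))) →
      -- accuracy from the logistic loss
      (T.loss = logisticLoss →
        Real.exp (-T.expectedLoss (T.sampleLaw μ (fun k => X k ω) (best ω)) κ) ≤
          T.accuracy (T.sampleLaw μ (fun k => X k ω) (best ω)) κ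
            (volume.restrict (Set.Icc (0 : ℝ) 1))) ∧
      -- number of nodes and optimality
      ∀ (τ : Measure ℝ) [IsProbabilityMeasure τ] (ρ : ℝ),
        ρ = T.accuracy (T.sampleLaw μ (fun k => X k ω) (best ω)) κ τ →
        ∀ (Q : BFInstance N M) (R : BBRules Q) (ε : ℝ≥0)
          (feat : BBState N M → BBNode N → Features N M E) (Aopt : Finset (Fin N)),
          Q.IsOptimalSubset Aopt → T.ClassifiesWith R ε feat Aopt κ τ ρ →
          (1 / 2 < ρ → T.expectedNodes R ε feat κ τ ≤
            ENNReal.ofReal (2 * N * (2 * ρ - ρ ^ N) / (2 * ρ - 1) + 1)) ∧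
          ENNReal.ofReal (ρ ^ N) ≤
            Measure.infinitePi (fun _ : ℕ => κ.prod τ) (T.success R ε feat) := by
  obtain ⟨C, rate, rate_pos, h⟩ := theorem2_general E (Real.nnabs G) (Real.nnabs H)
  refine ⟨C, rate, rate_pos, ?_⟩
  intro N M I J hN hM hI hJ η hη Z _ μ _ T c hT Ω _ P _ X hX hlaw hind best _ hbest
  obtain ⟨loss_bound, classifier⟩ := h N M I J hN hM hI hJ η hη Z μ T _ _ _ (hT.regular hI) Ω P X
    hX hlaw hind best hbest
  refine ⟨fun ν δ hδ hδ₁ hη _ hν => ?_, classifier⟩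
  refine (loss_bound ν δ hδ hδ₁ hη hν).trans (measure_mono ?_)
  refine Set.ofPred_subset_ofPred.2 fun ω loss_le => loss_le.trans ?_
  gcongr
  exact hT.BL_div_sqrt_le_gap hJ (N + M) T.depth (half_pos hδ) (by linarith)
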